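/- Theorem 1.1. Let $N\ge 2$, let $\Omega\subseteq\mathbb R^N$ be a bounded domain (open, connected, nonempty) containing the origin $O$, let $\omega\subseteq\mathbb S^{N-1}$ be a domain (nonempty, connected and relatively open; $\omega=\mathbb S^{N-1}$ is allowed), and let $\Sigma=\{tx: x\in\omega,\ t>0\}$. If $\omega\ne\mathbb S^{N-1}$, assume that $\partial\Sigma\setminus\{O\}$ is a hypersurface of class $C^1$ with $\Sigma$ locally on one side of it, and let $\nu$ be its outward unit normal. Put $$\Gamma_0=\Sigma\cap\partial\Omega,\qquad \Gamma_1=\partial(\Sigma\cap\Omega)\setminus\overline{\Gamma_0}.$$ Let $H$ be a norm on $\mathbb R^N$ of class $C^1(\mathbb R^N\setminus\{O\})$ such that $V(\xi)=\frac12H(\xi)^2$ is strictly convex, let $H_0(x)=\sup_{\xi\neq0}\frac{x\cdot\xi}{H(\xi)}$ be its dual norm, and let $B_R(O,H_0)=\{x: H_0(x)<R\}$. Let $q:(0,\infty)\to(0,\infty)$ be such that $q(r)/r$ is strictly increasing. Let $W^{1,2}_{\Gamma_0}(\Omega\cap\Sigma)$ be the set of restrictions to $\Omega\cap\Sigma$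 of functions in $W^{1,2}_0(\Omega)$. Suppose that there is a function $u\in C^1\big((\Sigma\cap\Omega)\cup(\Gamma_1\setminus\{O\})\big)\cap C^0\big(\overline{\Sigma\cap\Omega}\setminus\{O\}\big)$ which is a weak solution of $$-\Delta_Hu=-\operatorname{div}\big(DV(Du)\big)=1\ \text{ in }\Sigma\cap\Omega,\qquad u=0\ \text{ on }\Gamma_0,\qquad DV(Du)\cdot\nu=0\ \text{ on }\Gamma_1\setminus\{O\},$$ that is: $u\in W^{1,2}_{\Gamma_0}(\Omega\cap\Sigma)$ and $\int_{\Omega\cap\Sigma}Dv\cdot DV(Du)\,dx=\int_{\Omega\cap\Sigma}v\,dx$ for every $v\in W^{1,2}_{\Gamma_0}(\Omega\cap\Sigma)$, and the two boundary conditions hold pointwise. Suppose moreover that $$\lim_{\Sigma\cap\Omega\ni x\to z}H(Du(x))=q(H_0(z))\qquad\text{for all } z\in\overline{\Gamma_0}.$$ Then $\Sigma\cap\Omega=\Sigma\cap B_R(O,H_0)$ for some $R>0$. -/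

import Mathlib

open Set Filter Topology MeasureTheory

namespace ConeWulff

/-- `H` is a norm on `ℝ^N`. -/
structure IsNorm {N : ℕ} (H : EuclideanSpace ℝ (Fin N) → ℝ) : Prop where
  nonneg : ∀ x, 0 ≤ H x
  eq_zero_iff : ∀ x, H x = 0 ↔ x = 0
  smul : ∀ (t : ℝ) x, H (t • x) = |t| * H x
  add_le : ∀ x y, H (x + y) ≤ H x + H y

/-- The dual norm `x ↦ sup_{ξ ≠ 0} (x · ξ) / H ξ`. -/
noncomputable def dualNorm {N : ℕ} (H : EuclideanSpace ℝ (Fin N) → ℝ)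
    (x : EuclideanSpace ℝ (Fin N)) : ℝ :=
  ⨆ ξ : {ξ : EuclideanSpace ℝ (Fin N) // ξ ≠ 0}, inner ℝ x ξ.1 / H ξ.1

/-- The ball `B_R(O, H₀)`; for `H₀` the dual norm of `H` this is the Wulff shape. -/
def normBall {N : ℕ} (H₀ : EuclideanSpace ℝ (Fin N) → ℝ) (R : ℝ) :
    Set (EuclideanSpace ℝ (Fin N)) :=
  {x | H₀ x < R}

/-- The Lagrangian `V = H² / 2`. -/
noncomputable def lagrangian {N : ℕ} (H : EuclideanSpace ℝ (Fin N) → ℝ)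
    (ξ : EuclideanSpace ℝ (Fin N)) : ℝ :=
  H ξ ^ 2 / 2

/-- The open cone `{t x : x ∈ ω, t > 0}` over a subset `ω` of the unit sphere.  (For `ω` the whole
sphere this is `ℝ^N` without the origin.) -/
def coneOver {N : ℕ} (ω : Set (Metric.sphere (0 : EuclideanSpace ℝ (Fin N)) 1)) :
    Set (EuclideanSpace ℝ (Fin N)) :=
  {y | ∃ x ∈ ω, ∃ t : ℝ, 0 < t ∧ y = t • (x : EuclideanSpace ℝ (Fin N))}

/-- `φ` is a `C¹` function near `p`, with `φ p = 0` and nonzero gradient at `p`, such that near `p`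
the set `S` is `{φ < 0}`. -/
def IsLocalDefiningFunction {N : ℕ} (S : Set (EuclideanSpace ℝ (Fin N)))
    (p : EuclideanSpace ℝ (Fin N)) (φ : EuclideanSpace ℝ (Fin N) → ℝ) : Prop :=
  ContDiffAt ℝ 1 φ p ∧ φ p = 0 ∧ gradient φ p ≠ 0 ∧ ∀ᶠ x in 𝓝 p, (x ∈ S ↔ φ x < 0)

/-- `∂S ∖ {O}` is a hypersurface of class `C¹`, with `S` locally on one side of it (so that there
is an outward normal).  The condition is void when `∂S ⊆ {O}`. -/
def HasC1BoundaryOffOrigin {N : ℕ} (S : Set (EuclideanSpace ℝ (Fin N))) : Prop :=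
  ∀ p ∈ frontier S \ {0}, ∃ φ, IsLocalDefiningFunction S p φ

/-- `n` is the outward unit normal to `S` at the boundary point `p`. -/
def IsOutwardNormal {N : ℕ} (S : Set (EuclideanSpace ℝ (Fin N)))
    (p n : EuclideanSpace ℝ (Fin N)) : Prop :=
  ∃ φ, IsLocalDefiningFunction S p φ ∧ n = ‖gradient φ p‖⁻¹ • gradient φ p

/-- `Γ₀ = S ∩ ∂Ω`. -/
def gammaZero {N : ℕ} (S Ω : Set (EuclideanSpace ℝ (Fin N))) : Set (EuclideanSpace ℝ (Fin N)) :=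
  S ∩ frontier Ω

/-- `Γ₁ = ∂(S ∩ Ω) ∖ closure Γ₀`, the part of the boundary of `S ∩ Ω` lying on `∂S`. -/
def gammaOne {N : ℕ} (S Ω : Set (EuclideanSpace ℝ (Fin N))) : Set (EuclideanSpace ℝ (Fin N)) :=
  frontier (S ∩ Ω) \ closure (gammaZero S Ω)

/-- `(S ∩ Ω) ∪ (Γ₁ ∖ {O})`. -/
def regularSet {N : ℕ} (S Ω : Set (EuclideanSpace ℝ (Fin N))) : Set (EuclideanSpace ℝ (Fin N)) :=
  (S ∩ Ω) ∪ (gammaOne S Ω \ {0})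

/-- `w ∈ W₀^{1,2}(Ω)` with weak gradient `G`: the pair `(w, G)` is the limit in `L²(Ω)` of pairs
`(φ, Dφ)` with `φ` smooth and compactly supported in `Ω`. -/
def MemW012 {N : ℕ} (Ω : Set (EuclideanSpace ℝ (Fin N))) (w : EuclideanSpace ℝ (Fin N) → ℝ)
    (G : EuclideanSpace ℝ (Fin N) → EuclideanSpace ℝ (Fin N)) : Prop :=
  MemLp w 2 (volume.restrict Ω) ∧ MemLp G 2 (volume.restrict Ω) ∧
    ∃ φ : ℕ → EuclideanSpace ℝ (Fin N) → ℝ,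
      (∀ k, ContDiff ℝ (⊤ : ℕ∞) (φ k) ∧ HasCompactSupport (φ k) ∧ tsupport (φ k) ⊆ Ω) ∧
      Tendsto (fun k => eLpNorm (fun x => φ k x - w x) 2 (volume.restrict Ω)) atTop (𝓝 0) ∧
      Tendsto (fun k => eLpNorm (fun x => gradient (φ k) x - G x) 2 (volume.restrict Ω))
        atTop (𝓝 0)

/-- `v ∈ W_{Γ₀}^{1,2}(Ω ∩ S)` with weak gradient `g`: on `S ∩ Ω`, `v` is the restriction of a
function of `W₀^{1,2}(Ω)` (and `g` that of its gradient), as classes modulo null sets. -/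
def MemWGammaZero {N : ℕ} (S Ω : Set (EuclideanSpace ℝ (Fin N)))
    (v : EuclideanSpace ℝ (Fin N) → ℝ)
    (g : EuclideanSpace ℝ (Fin N) → EuclideanSpace ℝ (Fin N)) : Prop :=
  ∃ w G, MemW012 Ω w G ∧ v =ᵐ[volume.restrict (S ∩ Ω)] w ∧ g =ᵐ[volume.restrict (S ∩ Ω)] G

/-- `u` is a weak solution of `-div (DV(Du)) = f` in `S ∩ Ω`, `u = 0` on `Γ₀`,
`DV(Du) · ν = 0` on `Γ₁ ∖ {O}`. -/
def IsWeakSolution {N : ℕ} (H : EuclideanSpace ℝ (Fin N) → ℝ)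
    (S Ω : Set (EuclideanSpace ℝ (Fin N))) (f u : EuclideanSpace ℝ (Fin N) → ℝ) : Prop :=
  ∃ g, MemWGammaZero S Ω u g ∧
    ∀ v h, MemWGammaZero S Ω v h →
      ∫ x in S ∩ Ω, inner ℝ (h x) (gradient (lagrangian H) (g x)) = ∫ x in S ∩ Ω, f x * v x

end ConeWulff

/-! The comparison functions are b_R = (R² - H₀²) / (2N). Legendre duality identifies D(H₀²/2) with
the inverse of DV, so DV(Db_R) = -x/N. Hence b_R solves the same equation as u, and its flux is
tangent to ∂Σ because the boundary of a cone consists of rays. Moreover H(Db_R) = H₀/N.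

Let R₁ ≤ R₂ be the minimum and maximum of H₀ on the closure of Γ₀, attained at z₁ and z₂. The weak
maximum principle gives b_{R₁} ≤ u ≤ b_{R₂} in Σ ∩ Ω, and the first inequality is sharp at z₁, the
second at z₂, all functions vanishing there. Comparing slopes at these contact points yields R₁/N ≤
q(R₁) and q(R₂) ≤ R₂/N. Thus q(R₂)/R₂ ≤ 1/N ≤ q(R₁)/R₁, and strict monotonicity of q(r)/r forces R₁
= R₂. Following rays, Σ ∩ Ω is squeezed between the sets Σ ∩ {H₀ < R₁} and Σ ∩ {H₀ < R₂}, which now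
coincide.

Two points need work. The first is the maximum principle, `nonpos_of_nonpos_on_gammaZero`. Writing w
for the difference of the two functions and G for the difference of their fluxes, one tests the
equation of G with a truncation of w and uses that DV is strictly monotone. The test function need
not vanish on Γ₁, which is allowed because G is tangential there (`IsTangentialField.integral_eq`).
It must vanish near the vertex, which costs nothing in the limit because a point has zero 2-capacity
when N ≥ 2 (`exists_integral_cutoff_le`).

The second is the comparison of slopes. Γ₀ has no regularity and u need not be differentiable on it,
so there is no normal derivative to compare. For the lower bound, `le_of_radial_le` applies the mean
value theorem along rays, which stay in the cone. For the upper bound, `le_of_le_radial` maximises u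
- c' H₀(· - x₀) for x₀ near z₂: if H(Du) exceeded c' near z₂, no point could be the maximum. -/

namespace ConeWulff

/-! ### First-order inequalities for convex functions. -/

section Convex

variable {E : Type*} [NormedAddCommGroup E] [InnerProductSpace ℝ E] [CompleteSpace E]

theorem _root_.HasGradientAt.hasDerivAt_add_smul {f : E → ℝ} {g x : E} (hf : HasGradientAt f g x)
    (h : E) : HasDerivAt (fun t : ℝ => f (x + t • h)) (inner ℝ g h) 0 := by
  have h1 : HasDerivAt (fun t : ℝ => x + t • h) h 0 := by
    simpa using ((hasDerivAt_id (0 : ℝ)).smul_const h).const_add x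
  have h2 : HasFDerivAt f (InnerProductSpace.toDual ℝ E g) (x + (0 : ℝ) • h) := by
    simpa using hf.hasFDerivAt
  simpa [Function.comp_def] using h2.comp_hasDerivAt (0 : ℝ) h1

/-- If `φ` has derivative `a` at `0` and `φ t ≤ φ 0 + t b + t² c` for small `t > 0`,
then `a ≤ b`. -/
theorem deriv_le_of_le_quadratic {φ : ℝ → ℝ} {a b c : ℝ} (hφ : HasDerivAt φ a 0)
    (h : ∀ t ∈ Ioo (0 : ℝ) 1, φ t ≤ φ 0 + t * b + t ^ 2 * c) : a ≤ b := by
  have h1 : Tendsto (fun t : ℝ => t⁻¹ * (φ t - φ 0)) (𝓝[>] 0) (𝓝 a) := by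
    have := hφ.tendsto_slope_zero_right
    simpa using this
  have h2 : Tendsto (fun t : ℝ => b + t * c) (𝓝[>] 0) (𝓝 b) := by
    have : Continuous fun t : ℝ => b + t * c := by fun_prop
    simpa using (this.tendsto 0).mono_left nhdsWithin_le_nhds
  refine le_of_tendsto_of_tendsto h1 h2 ?_
  filter_upwards [Ioo_mem_nhdsGT (zero_lt_one' ℝ)] with t ht
  have := h t ht
  rw [inv_mul_le_iff₀ ht.1]
  nlinarith

theorem _root_.ConvexOn.add_inner_le {f : E → ℝ} (hf : ConvexOn ℝ univ f) {g x : E}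
    (hg : HasGradientAt f g x) (h : E) : f x + inner ℝ g h ≤ f (x + h) := by
  have := deriv_le_of_le_quadratic (b := f (x + h) - f x) (c := 0) (hg.hasDerivAt_add_smul h) ?_
  · linarith
  · intro t ht
    have h1 := hf.2 (mem_univ x) (mem_univ (x + h)) (sub_nonneg.2 ht.2.le) ht.1.le (by ring)
    have h2 : (1 - t) • x + t • (x + h) = x + t • h := by module
    rw [h2] at h1
    simp only [smul_eq_mul] at h1
    simp only [zero_smul, add_zero]
    linarith

/-- The supporting hyperplanes at x and at y are both evaluated at the midpoint, where strict
convexity makes f smaller than the average of its two end values. -/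
theorem _root_.StrictConvexOn.inner_sub_pos {f : E → ℝ} (hf : StrictConvexOn ℝ univ f)
    {x y gx gy : E} (hx : HasGradientAt f gx x) (hy : HasGradientAt f gy y) (hxy : x ≠ y) :
    0 < inner ℝ (x - y) (gx - gy) := by
  have h1 := hf.convexOn.add_inner_le hx ((1 / 2 : ℝ) • (y - x))
  have h2 := hf.convexOn.add_inner_le hy ((1 / 2 : ℝ) • (x - y))
  have h3 := hf.2 (mem_univ x) (mem_univ y) hxy (show (0 : ℝ) < 1 / 2 by norm_num)
    (show (0 : ℝ) < 1 / 2 by norm_num) (by norm_num)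
  have e1 : x + (1 / 2 : ℝ) • (y - x) = (1 / 2 : ℝ) • x + (1 / 2 : ℝ) • y := by module
  have e2 : y + (1 / 2 : ℝ) • (x - y) = (1 / 2 : ℝ) • x + (1 / 2 : ℝ) • y := by module
  rw [e1] at h1
  rw [e2] at h2
  simp only [inner_smul_right, inner_sub_right, inner_sub_left, smul_eq_mul] at *
  rw [real_inner_comm gx x, real_inner_comm gx y, real_inner_comm gy x, real_inner_comm gy y] at *
  linarith

end Convex

/-! ### The norm H, its Lagrangian V, and Legendre duality with H₀. -/

variable {N : ℕ} {H : EuclideanSpace ℝ (Fin N) → ℝ}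

local notation "𝔼" => EuclideanSpace ℝ (Fin N)

namespace IsNorm

theorem map_zero (hH : IsNorm H) : H 0 = 0 := (hH.eq_zero_iff 0).2 rfl

theorem pos (hH : IsNorm H) {x : 𝔼} (hx : x ≠ 0) : 0 < H x :=
  (hH.nonneg x).lt_of_ne fun h => hx ((hH.eq_zero_iff x).1 h.symm)

theorem map_neg (hH : IsNorm H) (x : 𝔼) : H (-x) = H x := by
  simpa using hH.smul (-1) x

theorem smul_of_nonneg (hH : IsNorm H) {t : ℝ} (ht : 0 ≤ t) (x : 𝔼) : H (t • x) = t * H x := by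
  rw [hH.smul, abs_of_nonneg ht]

theorem convexOn (hH : IsNorm H) : ConvexOn ℝ univ H := by
  refine ⟨convex_univ, fun x _ y _ a b ha hb _ => ?_⟩
  calc H (a • x + b • y) ≤ H (a • x) + H (b • y) := hH.add_le _ _
    _ = a • H x + b • H y := by rw [hH.smul_of_nonneg ha, hH.smul_of_nonneg hb]; rfl

theorem continuous (hH : IsNorm H) : Continuous H :=
  continuousOn_univ.1 (hH.convexOn.continuousOn isOpen_univ)

theorem exists_le_mul_norm (hH : IsNorm H) : ∃ C, 0 < C ∧ ∀ x, H x ≤ C * ‖x‖ := by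
  obtain ⟨C, hC⟩ := ((isCompact_sphere (0 : 𝔼) 1).image hH.continuous).bddAbove
  refine ⟨max C 1, by positivity, fun x => ?_⟩
  rcases eq_or_ne x 0 with rfl | hx
  · simp [hH.map_zero]
  · have hx' : 0 < ‖x‖ := norm_pos_iff.2 hx
    have h1 : H (‖x‖⁻¹ • x) ≤ C :=
      hC ⟨_, by simp [norm_smul, hx'.ne'], rfl⟩
    rw [hH.smul_of_nonneg (by positivity), inv_mul_le_iff₀ hx'] at h1
    nlinarith [le_max_left C 1]

theorem exists_mul_norm_le (hH : IsNorm H) : ∃ c, 0 < c ∧ ∀ x, c * ‖x‖ ≤ H x := by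
  rcases (Metric.sphere (0 : 𝔼) 1).eq_empty_or_nonempty with h | h
  · refine ⟨1, one_pos, fun x => ?_⟩
    rcases eq_or_ne x 0 with rfl | hx
    · simp [hH.map_zero]
    · have : ‖x‖⁻¹ • x ∈ Metric.sphere (0 : 𝔼) 1 := by simp [norm_smul, hx]
      simp [h] at this
  · obtain ⟨z, hz, hmin⟩ := (isCompact_sphere (0 : 𝔼) 1).exists_isMinOn h hH.continuous.continuousOn
    have hz0 : z ≠ 0 := by rintro rfl; simp at hz
    refine ⟨H z, hH.pos hz0, fun x => ?_⟩
    rcases eq_or_ne x 0 with rfl | hx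
    · simp [hH.map_zero]
    · have hx' : 0 < ‖x‖ := norm_pos_iff.2 hx
      have h1 : H z ≤ H (‖x‖⁻¹ • x) := hmin (show _ ∈ Metric.sphere (0 : 𝔼) 1 by
        simp [norm_smul, hx'.ne'])
      rw [hH.smul_of_nonneg (by positivity), le_inv_mul_iff₀ hx'] at h1
      linarith

end IsNorm

/-- H is not differentiable at the origin, but V is bounded by a multiple of ‖x‖² there. This
extends the C¹ regularity of V across 0. -/
theorem hasGradientAt_lagrangian_zero (hH : IsNorm H) : HasGradientAt (lagrangian H) 0 0 := by
  obtain ⟨C, hC0, hC⟩ := hH.exists_le_mul_norm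
  rw [hasGradientAt_iff_isLittleO_nhds_zero]
  simp only [lagrangian, zero_add, hH.map_zero, inner_zero_left, sub_zero, ne_eq,
    OfNat.ofNat_ne_zero, not_false_eq_true, zero_pow, zero_div]
  have h1 : (fun x : 𝔼 => H x ^ 2 / 2) =O[𝓝 0] fun x => ‖x‖ ^ 2 := by
    refine Asymptotics.IsBigO.of_bound (C ^ 2) (Eventually.of_forall fun x => ?_)
    have := hC x
    have h0 := hH.nonneg x
    rw [Real.norm_of_nonneg (by positivity), Real.norm_of_nonneg (by positivity)]
    nlinarith [mul_le_mul this this h0 (by positivity)]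
  refine h1.trans_isLittleO ?_
  have := (Asymptotics.isLittleO_pow_id (𝕜 := ℝ) (n := 2) one_lt_two).comp_tendsto
    (tendsto_norm_zero (E := 𝔼))
  exact this.trans_isBigO (Asymptotics.isBigO_norm_left.2 (Asymptotics.isBigO_refl _ _))

theorem contDiffAt_lagrangian (hC : ContDiffOn ℝ 1 H {0}ᶜ) {ξ : 𝔼} (hξ : ξ ≠ 0) :
    ContDiffAt ℝ 1 (lagrangian H) ξ := by
  have := hC.contDiffAt (isOpen_compl_singleton.mem_nhds hξ)
  exact (this.pow 2).div_const 2

theorem hasGradientAt_lagrangian (hH : IsNorm H) (hC : ContDiffOn ℝ 1 H {0}ᶜ) (ξ : 𝔼) :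
    HasGradientAt (lagrangian H) (gradient (lagrangian H) ξ) ξ := by
  rcases eq_or_ne ξ 0 with rfl | hξ
  · rw [(hasGradientAt_lagrangian_zero hH).gradient]
    exact hasGradientAt_lagrangian_zero hH
  · exact ((contDiffAt_lagrangian hC hξ).differentiableAt one_ne_zero).hasGradientAt

/-- The triangle inequality bounds V(ξ + tη) by (H ξ + t H η)² / 2; the terms of first order in t
give the claim. With Euler's identity below, this is the equality case of the duality pairing. -/
theorem inner_gradient_lagrangian_le (hH : IsNorm H) (hC : ContDiffOn ℝ 1 H {0}ᶜ) (ξ η : 𝔼) :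
    inner ℝ (gradient (lagrangian H) ξ) η ≤ H ξ * H η := by
  refine deriv_le_of_le_quadratic (c := H η ^ 2 / 2)
    ((hasGradientAt_lagrangian hH hC ξ).hasDerivAt_add_smul η) fun t ht => ?_
  have h1 := hH.add_le ξ (t • η)
  rw [hH.smul_of_nonneg ht.1.le] at h1
  have h2 := hH.nonneg (ξ + t • η)
  simp only [lagrangian, zero_smul, add_zero]
  nlinarith

/-- Euler's identity for the 2-homogeneous function V. -/
theorem inner_gradient_lagrangian_self (hH : IsNorm H) (hC : ContDiffOn ℝ 1 H {0}ᶜ) (ξ : 𝔼) :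
    inner ℝ (gradient (lagrangian H) ξ) ξ = H ξ ^ 2 := by
  have h1 := (hasGradientAt_lagrangian hH hC ξ).hasDerivAt_add_smul ξ
  have h2 : HasDerivAt (fun t : ℝ => (1 + t) ^ 2 * (H ξ ^ 2 / 2)) (H ξ ^ 2) 0 := by
    have := ((((hasDerivAt_id (0 : ℝ)).const_add 1).pow 2).mul_const (H ξ ^ 2 / 2))
    exact this.congr_deriv (by norm_num; ring)
  refine h1.unique (h2.congr_of_eventuallyEq (Eventually.of_forall fun t => ?_))
  have : ξ + t • ξ = (1 + t) • ξ := by module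
  simp only [lagrangian]
  rw [this, hH.smul, mul_pow, sq_abs]
  ring

theorem gradient_lagrangian_smul (hH : IsNorm H) (hC : ContDiffOn ℝ 1 H {0}ᶜ) (t : ℝ) (ξ : 𝔼) :
    gradient (lagrangian H) (t • ξ) = t • gradient (lagrangian H) ξ := by
  rcases eq_or_ne t 0 with rfl | ht
  · simp [(hasGradientAt_lagrangian_zero hH).gradient]
  refine ext_inner_right ℝ fun η => ?_
  have h1 := (hasGradientAt_lagrangian hH hC (t • ξ)).hasDerivAt_add_smul (t • η)
  have h2 := ((hasGradientAt_lagrangian hH hC ξ).hasDerivAt_add_smul η).const_mul (t ^ 2)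
  have h3 := h1.unique (h2.congr_of_eventuallyEq (Eventually.of_forall fun s => ?_))
  · rw [inner_smul_right] at h3
    rw [real_inner_smul_left]
    have : t * (inner ℝ (gradient (lagrangian H) (t • ξ)) η)
      = t * (t * inner ℝ (gradient (lagrangian H) ξ) η) := by rw [h3]; ring
    exact mul_left_cancel₀ ht this
  · have : t • ξ + s • t • η = t • (ξ + s • η) := by module
    simp only [lagrangian]
    rw [this, hH.smul, mul_pow, sq_abs]
    ring

theorem exists_norm_gradient_lagrangian_le (hH : IsNorm H) (hC : ContDiffOn ℝ 1 H {0}ᶜ) :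
    ∃ C, 0 < C ∧ ∀ ξ, ‖gradient (lagrangian H) ξ‖ ≤ C * ‖ξ‖ := by
  obtain ⟨C, hC0, hCb⟩ := hH.exists_le_mul_norm
  refine ⟨C ^ 2, by positivity, fun ξ => ?_⟩
  set g := gradient (lagrangian H) ξ
  rcases eq_or_ne g 0 with hg | hg
  · rw [hg, norm_zero]; positivity
  have h1 := inner_gradient_lagrangian_le hH hC ξ g
  rw [real_inner_self_eq_norm_sq] at h1
  have h2 : H ξ * H g ≤ (C * ‖ξ‖) * (C * ‖g‖) :=
    mul_le_mul (hCb ξ) (hCb g) (hH.nonneg g) (by positivity)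
  have h3 : 0 < ‖g‖ := norm_pos_iff.2 hg
  by_contra! h4
  nlinarith

theorem continuous_gradient_lagrangian (hH : IsNorm H) (hC : ContDiffOn ℝ 1 H {0}ᶜ) :
    Continuous (gradient (lagrangian H)) := by
  rw [continuous_iff_continuousAt]
  intro ξ
  rcases eq_or_ne ξ 0 with rfl | hξ
  · obtain ⟨C, hC0, hCb⟩ := exists_norm_gradient_lagrangian_le hH hC
    rw [ContinuousAt, (hasGradientAt_lagrangian_zero hH).gradient]
    refine squeeze_zero_norm hCb ?_
    have : Continuous fun x : 𝔼 => C * ‖x‖ := by fun_prop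
    simpa using this.tendsto 0
  · have h1 : ContinuousAt (fderiv ℝ (lagrangian H)) ξ :=
      (contDiffAt_lagrangian hC hξ).continuousAt_fderiv one_ne_zero
    exact (InnerProductSpace.toDual ℝ 𝔼).symm.continuous.continuousAt.comp h1

theorem gradient_lagrangian_injective (hH : IsNorm H) (hC : ContDiffOn ℝ 1 H {0}ᶜ)
    (hV : StrictConvexOn ℝ univ (lagrangian H)) :
    Function.Injective (gradient (lagrangian H)) := by
  intro x y hxy
  by_contra hne
  have := hV.inner_sub_pos (hasGradientAt_lagrangian hH hC x) (hasGradientAt_lagrangian hH hC y) hne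
  simp [hxy] at this

/-- The function V - ⟨x, ·⟩ is coercive, since V grows quadratically; at its minimum point DV equals
x. -/
theorem gradient_lagrangian_surjective (hH : IsNorm H) (hC : ContDiffOn ℝ 1 H {0}ᶜ) :
    Function.Surjective (gradient (lagrangian H)) := by
  intro x
  obtain ⟨c, hc0, hc⟩ := hH.exists_mul_norm_le
  have hcont : Continuous fun ξ : 𝔼 => lagrangian H ξ - inner ℝ x ξ := by
    have := hH.continuous
    unfold lagrangian
    fun_prop
  have hlim : Tendsto (fun ξ : 𝔼 => lagrangian H ξ - inner ℝ x ξ) (cocompact 𝔼) atTop := by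
    have h1 : Tendsto (fun r : ℝ => r * (c ^ 2 / 2 * r - ‖x‖)) atTop atTop := by
      refine tendsto_id.atTop_mul_atTop₀ ?_
      exact tendsto_atTop_add_const_right _ _ (tendsto_id.const_mul_atTop (by positivity))
    refine tendsto_atTop_mono (fun ξ => ?_) (h1.comp (tendsto_norm_cocompact_atTop (E := 𝔼)))
    have h2 := real_inner_le_norm x ξ
    have h3 : (c * ‖ξ‖) ^ 2 ≤ H ξ ^ 2 := pow_le_pow_left₀ (by positivity) (hc ξ) 2
    simp only [lagrangian, Function.comp]
    nlinarith
  obtain ⟨ξ, hξ⟩ := hcont.exists_forall_le hlim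
  refine ⟨ξ, ext_inner_right ℝ fun η => ?_⟩
  have h1 := (hasGradientAt_lagrangian hH hC ξ).hasDerivAt_add_smul η
  have h2 : HasDerivAt (fun t : ℝ => inner ℝ x (ξ + t • η)) (inner ℝ x η) 0 := by
    have := ((hasDerivAt_id (0 : ℝ)).mul_const (inner ℝ x η)).const_add (inner ℝ x ξ)
    simpa [inner_add_right, inner_smul_right] using this
  have h3 : IsLocalMin (fun t : ℝ => lagrangian H (ξ + t • η) - inner ℝ x (ξ + t • η)) 0 :=
    Eventually.of_forall fun t => by simpa using hξ (ξ + t • η)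
  have := h3.hasDerivAt_eq_zero (h1.sub h2)
  linarith

/-- The inverse of the gradient of the Lagrangian; it is the gradient of `H₀² / 2`. -/
noncomputable def dualGradient (H : 𝔼 → ℝ) : 𝔼 → 𝔼 :=
  Function.invFun (gradient (lagrangian H))

theorem gradient_lagrangian_dualGradient (hH : IsNorm H) (hC : ContDiffOn ℝ 1 H {0}ᶜ) (x : 𝔼) :
    gradient (lagrangian H) (dualGradient H x) = x :=
  Function.rightInverse_invFun (gradient_lagrangian_surjective hH hC) x

theorem dualGradient_gradient_lagrangian (hH : IsNorm H) (hC : ContDiffOn ℝ 1 H {0}ᶜ)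
    (hV : StrictConvexOn ℝ univ (lagrangian H)) (ξ : 𝔼) :
    dualGradient H (gradient (lagrangian H) ξ) = ξ :=
  Function.leftInverse_invFun (gradient_lagrangian_injective hH hC hV) ξ

/-- DV is a continuous bijection with ‖DV(ξ)‖ ≥ c²‖ξ‖, hence proper, hence closed; the inverse of a
closed bijection is continuous. -/
theorem continuous_dualGradient (hH : IsNorm H) (hC : ContDiffOn ℝ 1 H {0}ᶜ)
    (hV : StrictConvexOn ℝ univ (lagrangian H)) : Continuous (dualGradient H) := by
  have hcont := continuous_gradient_lagrangian hH hC
  have hproper : IsProperMap (gradient (lagrangian H)) := by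
    rw [isProperMap_iff_tendsto_cocompact]
    refine ⟨hcont, ?_⟩
    obtain ⟨c, hc0, hc⟩ := hH.exists_mul_norm_le
    rw [← Metric.cobounded_eq_cocompact, ← comap_norm_atTop, tendsto_comap_iff]
    have h1 : Tendsto (fun ξ : 𝔼 => c ^ 2 * ‖ξ‖) (comap norm atTop) atTop :=
      tendsto_comap.const_mul_atTop (by positivity)
    refine tendsto_atTop_mono (fun ξ => ?_) h1
    have h2 := inner_gradient_lagrangian_self hH hC ξ
    have h3 := real_inner_le_norm (gradient (lagrangian H) ξ) ξ
    have h4 : (c * ‖ξ‖) ^ 2 ≤ H ξ ^ 2 := pow_le_pow_left₀ (by positivity) (hc ξ) 2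
    simp only [Function.comp]
    rcases eq_or_ne ξ 0 with rfl | hξ
    · simp
    · have := norm_pos_iff.2 hξ
      by_contra! h5
      nlinarith
  rw [continuous_iff_isClosed]
  intro s hs
  have : dualGradient H ⁻¹' s = gradient (lagrangian H) '' s := by
    ext x
    constructor
    · exact fun hx => ⟨_, hx, gradient_lagrangian_dualGradient hH hC x⟩
    · rintro ⟨ξ, hξ, rfl⟩
      rwa [mem_preimage, dualGradient_gradient_lagrangian hH hC hV]
  rw [this]
  exact hproper.isClosedMap s hs

/-- The quotients defining the dual norm of DV(ξ) are at most H ξ, and Euler's identity shows that ξ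
itself attains this value. -/
theorem dualNorm_gradient_lagrangian (hH : IsNorm H) (hC : ContDiffOn ℝ 1 H {0}ᶜ) (ξ : 𝔼) :
    dualNorm H (gradient (lagrangian H) ξ) = H ξ := by
  have hle : ∀ η : {η : 𝔼 // η ≠ 0}, inner ℝ (gradient (lagrangian H) ξ) η.1 / H η.1 ≤ H ξ :=
    fun η => (div_le_iff₀ (hH.pos η.2)).2 (inner_gradient_lagrangian_le hH hC ξ η)
  rcases eq_or_ne ξ 0 with rfl | hξ
  · rw [(hasGradientAt_lagrangian_zero hH).gradient, hH.map_zero]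
    simp [dualNorm]
  · have : Nonempty {η : 𝔼 // η ≠ 0} := ⟨⟨ξ, hξ⟩⟩
    refine le_antisymm (ciSup_le hle) ?_
    have := le_ciSup (f := fun η : {η : 𝔼 // η ≠ 0} =>
      inner ℝ (gradient (lagrangian H) ξ) η.1 / H η.1) ⟨H ξ, by rintro _ ⟨η, rfl⟩; exact hle η⟩ ⟨ξ, hξ⟩
    refine le_trans (le_of_eq ?_) this
    have hp := (hH.pos hξ).ne'
    simp only [inner_gradient_lagrangian_self hH hC]
    field_simp

theorem map_dualGradient (hH : IsNorm H) (hC : ContDiffOn ℝ 1 H {0}ᶜ) (x : 𝔼) :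
    H (dualGradient H x) = dualNorm H x := by
  rw [← dualNorm_gradient_lagrangian hH hC, gradient_lagrangian_dualGradient hH hC]

theorem inner_le_dualNorm_mul (hH : IsNorm H) (hC : ContDiffOn ℝ 1 H {0}ᶜ) (x η : 𝔼) :
    inner ℝ x η ≤ dualNorm H x * H η := by
  have := inner_gradient_lagrangian_le hH hC (dualGradient H x) η
  rwa [gradient_lagrangian_dualGradient hH hC, map_dualGradient hH hC] at this

theorem isNorm_dualNorm (hH : IsNorm H) (hC : ContDiffOn ℝ 1 H {0}ᶜ) : IsNorm (dualNorm H) where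
  nonneg x := by rw [← map_dualGradient hH hC]; exact hH.nonneg _
  eq_zero_iff x := by
    rw [← map_dualGradient hH hC, hH.eq_zero_iff]
    constructor
    · intro h
      rw [← gradient_lagrangian_dualGradient hH hC x, h, (hasGradientAt_lagrangian_zero hH).gradient]
    · rintro rfl
      rw [← hH.eq_zero_iff, map_dualGradient hH hC]
      simp [dualNorm]
  smul t x := by
    rw [← map_dualGradient hH hC x, ← hH.smul, ← dualNorm_gradient_lagrangian hH hC,
      gradient_lagrangian_smul hH hC, gradient_lagrangian_dualGradient hH hC]
  add_le x y := by
    -- ζ is extremal for x + y: ⟨x + y, ζ⟩ = H₀(x + y)² and H ζ = H₀(x + y). Splitting the pairing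
    -- and dividing by H ζ gives the triangle inequality.
    set ζ := dualGradient H (x + y) with hζ
    have h1 := inner_gradient_lagrangian_self hH hC ζ
    rw [hζ, gradient_lagrangian_dualGradient hH hC, map_dualGradient hH hC, inner_add_left] at h1
    have h2 := inner_le_dualNorm_mul hH hC x ζ
    have h3 := inner_le_dualNorm_mul hH hC y ζ
    rw [hζ, map_dualGradient hH hC] at h2 h3
    have h4 : 0 ≤ dualNorm H x := by rw [← map_dualGradient hH hC]; exact hH.nonneg _
    have h5 : 0 ≤ dualNorm H y := by rw [← map_dualGradient hH hC]; exact hH.nonneg _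
    by_contra! h6
    nlinarith

/-- A continuous selection of subgradients is the gradient: the subgradient inequality at x bounds
the increment from below, the one at y from above, and the two bounds differ by o(‖y - x‖). No
differentiability of H₀ is assumed. -/
theorem hasGradientAt_lagrangian_dualNorm (hH : IsNorm H) (hC : ContDiffOn ℝ 1 H {0}ᶜ)
    (hV : StrictConvexOn ℝ univ (lagrangian H)) (x : 𝔼) :
    HasGradientAt (lagrangian (dualNorm H)) (dualGradient H x) x := by
  have key : ∀ x y : 𝔼, lagrangian (dualNorm H) x + inner ℝ (dualGradient H x) (y - x)
      ≤ lagrangian (dualNorm H) y := by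
    intro x y
    have h1 := inner_le_dualNorm_mul hH hC y (dualGradient H x)
    have h2 := inner_gradient_lagrangian_self hH hC (dualGradient H x)
    rw [gradient_lagrangian_dualGradient hH hC, map_dualGradient hH hC] at h2
    rw [map_dualGradient hH hC] at h1
    rw [inner_sub_right, real_inner_comm, real_inner_comm x, h2]
    simp only [lagrangian]
    nlinarith [sq_nonneg (dualNorm H x - dualNorm H y)]
  rw [hasGradientAt_iff_isLittleO, Asymptotics.isLittleO_iff]
  intro ε hε
  have hcont := (continuous_dualGradient hH hC hV).tendsto x
  filter_upwards [Metric.tendsto_nhds.1 hcont ε hε] with y hy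
  have h1 := key x y
  have h2 := key y x
  have h3 : inner ℝ (dualGradient H y - dualGradient H x) (y - x) ≤ ε * ‖y - x‖ := by
    refine (real_inner_le_norm _ _).trans ?_
    rw [← dist_eq_norm]
    gcongr
  have h4 : inner ℝ (dualGradient H y) (x - y) = - inner ℝ (dualGradient H y) (y - x) := by
    rw [← inner_neg_right, neg_sub]
  rw [inner_sub_left] at h3
  rw [Real.norm_of_nonneg (by linarith)]
  linarith

/-- When steps are measured by H₀, the steepest ascent for the covector ξ is in the direction DV(ξ),
with slope H ξ. This direction is exactly the one which the conormal condition controls on Γ₁. -/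
theorem exists_ascent_direction (hH : IsNorm H) (hC : ContDiffOn ℝ 1 H {0}ᶜ) {ξ : 𝔼}
    (hξ : ξ ≠ 0) : ∃ t : ℝ, 0 < t ∧ dualNorm H (t • gradient (lagrangian H) ξ) = 1 ∧
      inner ℝ ξ (t • gradient (lagrangian H) ξ) = H ξ := by
  have hp := hH.pos hξ
  refine ⟨(H ξ)⁻¹, by positivity, ?_, ?_⟩
  · rw [← gradient_lagrangian_smul hH hC, dualNorm_gradient_lagrangian hH hC,
      hH.smul_of_nonneg (by positivity), inv_mul_cancel₀ hp.ne']
  · rw [inner_smul_right, real_inner_comm, inner_gradient_lagrangian_self hH hC]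
    field_simp

end ConeWulff

/-! ### Topology of the cone and of the C¹ boundary near Γ₁. -/

namespace ConeWulff

/-- Off its frontier the space splits into the disjoint open sets Ω and the complement of its
closure, so a connected set cannot meet both. -/
theorem _root_.IsPreconnected.subset_of_disjoint_frontier {X : Type*} [TopologicalSpace X]
    {A Ω : Set X} (hA : IsPreconnected A) (hΩ : IsOpen Ω) (hd : ∀ x ∈ A, x ∉ frontier Ω)
    (hne : (A ∩ Ω).Nonempty) : A ⊆ Ω := by
  refine hA.subset_left_of_subset_union hΩ isClosed_closure.isOpen_compl
    (disjoint_compl_right.mono_left subset_closure |>.mono_right le_rfl) (fun x hx => ?_) hne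
  by_cases h : x ∈ closure Ω
  · left
    by_contra h'
    exact hd x hx ⟨h, by rwa [hΩ.interior_eq]⟩
  · exact Or.inr h

theorem _root_.IsOpen.mem_of_segment_disjoint_frontier {E : Type*} [NormedAddCommGroup E]
    [NormedSpace ℝ E] {Ω : Set E} {x y : E} (hΩ : IsOpen Ω) (hx : x ∈ Ω)
    (hd : ∀ z ∈ segment ℝ x y, z ∉ frontier Ω) : y ∈ Ω :=
  (convex_segment x y).isPreconnected.subset_of_disjoint_frontier hΩ hd
    ⟨x, left_mem_segment ℝ x y, hx⟩ (right_mem_segment ℝ x y)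

variable {N : ℕ}

local notation "𝔼" => EuclideanSpace ℝ (Fin N)

variable {S Ω : Set (EuclideanSpace ℝ (Fin N))} {p : EuclideanSpace ℝ (Fin N)}
  {φ : EuclideanSpace ℝ (Fin N) → ℝ}

/-! ### Cones -/

theorem smul_mem_coneOver {ω : Set (Metric.sphere (0 : 𝔼) 1)} {x : 𝔼} (hx : x ∈ coneOver ω)
    {t : ℝ} (ht : 0 < t) : t • x ∈ coneOver ω := by
  obtain ⟨y, hy, s, hs, rfl⟩ := hx
  exact ⟨y, hy, t * s, mul_pos ht hs, smul_smul t s _⟩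

theorem zero_notMem_coneOver (ω : Set (Metric.sphere (0 : 𝔼) 1)) : (0 : 𝔼) ∉ coneOver ω := by
  rintro ⟨x, -, t, ht, h⟩
  have hx : ‖(x : 𝔼)‖ = 1 := by simp
  have := congrArg norm h
  rw [norm_smul, hx, norm_zero, mul_one, Real.norm_of_nonneg ht.le] at this
  exact ht.ne this

theorem isOpen_coneOver {ω : Set (Metric.sphere (0 : 𝔼) 1)} (hω : IsOpen ω) :
    IsOpen (coneOver ω) := by
  obtain ⟨W, hW, rfl⟩ := isOpen_induced_iff.1 hω
  have h1 : coneOver (Subtype.val ⁻¹' W) = {x : 𝔼 | x ≠ 0} ∩ (fun x : 𝔼 => ‖x‖⁻¹ • x) ⁻¹' W := by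
    ext y
    constructor
    · rintro ⟨x, hx, t, ht, rfl⟩
      have hx1 : ‖(x : 𝔼)‖ = 1 := by simp
      have hx0 : (x : 𝔼) ≠ 0 := by
        intro h
        simp [h] at hx1
      refine ⟨smul_ne_zero ht.ne' hx0, ?_⟩
      simp only [mem_preimage, norm_smul, hx1, Real.norm_of_nonneg ht.le, mul_one, smul_smul,
        inv_mul_cancel₀ ht.ne', one_smul]
      exact hx
    · rintro ⟨hy0, hy⟩
      have hy0' : ‖y‖ ≠ 0 := norm_ne_zero_iff.2 hy0
      exact ⟨⟨‖y‖⁻¹ • y, by simp [norm_smul, hy0']⟩, hy, ‖y‖, norm_pos_iff.2 hy0, by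
        simp [smul_smul, hy0']⟩
  rw [h1]
  have h2 : ContinuousOn (fun x : 𝔼 => ‖x‖⁻¹ • x) {x : 𝔼 | x ≠ 0} :=
    (continuous_norm.continuousOn.inv₀ fun x hx => norm_ne_zero_iff.2 hx).smul continuousOn_id
  exact h2.isOpen_inter_preimage isOpen_ne hW

theorem smul_mem_frontier_of_cone (hS : ∀ x ∈ S, ∀ t : ℝ, 0 < t → t • x ∈ S) (hp : p ∈ frontier S)
    {t : ℝ} (ht : 0 < t) : t • p ∈ frontier S := by
  have key : (Homeomorph.smulOfNeZero t ht.ne') '' S = S := by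
    ext x
    refine ⟨?_, fun h => ⟨t⁻¹ • x, hS x h _ (inv_pos.2 ht), ?_⟩⟩
    · rintro ⟨y, hy, rfl⟩
      exact hS y hy t ht
    · simp [smul_smul, ht.ne']
  have h2 : (Homeomorph.smulOfNeZero t ht.ne') '' frontier S = frontier S := by
    rw [Homeomorph.image_frontier]
    rw [key]
  rw [← h2]
  exact ⟨p, hp, rfl⟩

/-! ### Local defining functions -/

namespace IsLocalDefiningFunction

/-- A quantitative form of "d points into S", uniform over base points in a small ball; it follows
from strict differentiability of φ at p. -/
theorem eventually_le (h : IsLocalDefiningFunction S p φ) {d : 𝔼}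
    (hd : inner ℝ (gradient φ p) d < 0) :
    ∃ a > 0, ∀ᶠ r in 𝓝[>] (0 : ℝ), ∀ x ∈ Metric.ball p r, ∀ s : ℝ, 0 ≤ s →
      x + s • d ∈ Metric.ball p r → φ (x + s • d) ≤ φ x - s * a := by
  have hs := (h.1.hasStrictFDerivAt one_ne_zero).isLittleO
  rw [inner_gradient_left] at hd
  have hd0 : d ≠ 0 := by
    rintro rfl
    simp at hd
  have hn := norm_pos_iff.2 hd0
  -- Half of the slope |Dφ(p) d| is spent on the linearisation error; the other half remains as the
  -- rate of decrease.
  refine ⟨-(fderiv ℝ φ p d) / 2, by linarith, ?_⟩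
  have h1 := hs.bound (c := -(fderiv ℝ φ p d) / 2 / ‖d‖) (div_pos (by linarith) hn)
  rw [Metric.eventually_nhds_iff] at h1
  obtain ⟨ε, hε, h1⟩ := h1
  filter_upwards [Ioo_mem_nhdsGT hε] with r hr x hx s hs0 hxs
  have h2 := @h1 (x + s • d, x) (by
    rw [Prod.dist_eq]
    exact max_lt (hxs.trans hr.2) (hx.trans hr.2))
  simp only [add_sub_cancel_left, map_smul, norm_smul, smul_eq_mul] at h2
  rw [Real.norm_of_nonneg hs0] at h2
  have h3 := (le_abs_self _).trans h2
  have h4 : -(fderiv ℝ φ p d) / 2 / ‖d‖ * (s * ‖d‖) = s * (-(fderiv ℝ φ p d) / 2) := by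
    field_simp
  rw [h4] at h3
  linarith

theorem inner_neg_gradient (h : IsLocalDefiningFunction S p φ) :
    inner ℝ (gradient φ p) (-gradient φ p) < 0 := by
  rw [inner_neg_right, neg_lt_zero, real_inner_self_eq_norm_sq]
  have := norm_pos_iff.2 h.2.2.1
  positivity

theorem eventually_add_smul_mem (h : IsLocalDefiningFunction S p φ) {d : 𝔼}
    (hd : inner ℝ (gradient φ p) d < 0) : ∀ᶠ s in 𝓝[>] (0 : ℝ), p + s • d ∈ S := by
  obtain ⟨a, ha, hr⟩ := h.eventually_le hd
  obtain ⟨r, hr, hr0⟩ := (hr.and self_mem_nhdsWithin).exists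
  have hc : Tendsto (fun s : ℝ => p + s • d) (𝓝[>] 0) (𝓝 p) := by
    have : Continuous fun s : ℝ => p + s • d := by fun_prop
    simpa using (this.tendsto 0).mono_left nhdsWithin_le_nhds
  filter_upwards [hc.eventually h.2.2.2, hc.eventually (Metric.ball_mem_nhds p hr0),
    self_mem_nhdsWithin] with s h1 h2 hs
  have hs' : 0 < s := hs
  rw [h1]
  have := hr p (Metric.mem_ball_self hr0) s hs'.le h2
  rw [h.2.1] at this
  nlinarith

theorem eventually_eq_zero (h : IsLocalDefiningFunction S p φ) (hS : IsOpen S) :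
    ∀ᶠ x in 𝓝 p, x ∈ frontier S → φ x = 0 := by
  have h1 : ∀ᶠ x in 𝓝 p, ContDiffAt ℝ 1 φ x := h.1.eventually (by simp)
  filter_upwards [h1, h.2.2.2.eventually_nhds, h.2.2.2] with x hx hx1 hx2 hxf
  rw [hS.frontier_eq] at hxf
  refine le_antisymm ?_ (not_lt.1 fun h => hxf.2 (hx2.2 h))
  by_contra! hpos
  have h3 := hx.continuousAt.eventually (lt_mem_nhds hpos)
  obtain ⟨y, hyS, hy1, hy2⟩ :=
    ((mem_closure_iff_frequently.1 hxf.1).and_eventually (h3.and hx1)).exists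
  linarith [hy2.1 hyS]

/-- The frontier of a cone contains the ray through p, so φ vanishes along that ray near p. This is
the tangency of the position field x to ∂S. -/
theorem inner_self_eq_zero_of_cone (h : IsLocalDefiningFunction S p φ) (hSo : IsOpen S)
    (hS : ∀ x ∈ S, ∀ t : ℝ, 0 < t → t • x ∈ S) (hp : p ∈ frontier S) :
    inner ℝ (gradient φ p) p = 0 := by
  have h1 := (h.1.differentiableAt one_ne_zero).hasGradientAt.hasDerivAt_add_smul p
  refine h1.unique ((hasDerivAt_const (0 : ℝ) (0 : ℝ)).congr_of_eventuallyEq ?_)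
  have hc : Tendsto (fun s : ℝ => p + s • p) (𝓝 0) (𝓝 p) := by
    have : Continuous fun s : ℝ => p + s • p := by fun_prop
    simpa using this.tendsto 0
  filter_upwards [hc.eventually (h.eventually_eq_zero hSo), lt_mem_nhds (show (-1 : ℝ) < 0 by simp)]
    with s hs hs1
  refine hs ?_
  have : p + s • p = (1 + s) • p := by module
  rw [this]
  exact smul_mem_frontier_of_cone hS hp (by linarith)

/-- Near p the set S is the region under a C¹ graph, so any two of its points near p are joined
inside S by three segments: push inward along e, translate, pull back out. Such a path avoids ∂Ω, so
it stays in Ω once it starts there. -/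
theorem exists_ball_inter_subset (h : IsLocalDefiningFunction S p φ) (hΩ : IsOpen Ω) {r : ℝ}
    (hr : 0 < r) (hd : ∀ x ∈ S ∩ Metric.ball p r, x ∉ frontier Ω) (hp : p ∈ closure (S ∩ Ω)) :
    ∃ r' > 0, S ∩ Metric.ball p r' ⊆ Ω := by
  obtain ⟨a, ha, hev⟩ := h.eventually_le h.inner_neg_gradient
  set e := -gradient φ p with he
  obtain ⟨r₁, hr₁, hr₁'⟩ := Metric.eventually_nhds_iff_ball.1 h.2.2.2
  obtain ⟨ρ, hev, hρ⟩ := (hev.and (Ioo_mem_nhdsGT (lt_min hr hr₁))).exists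
  have hρ0 : 0 < ρ := hρ.1
  have hρr : ρ < r := hρ.2.trans_le (min_le_left _ _)
  have hρr₁ : ρ < r₁ := hρ.2.trans_le (min_le_right _ _)
  have hSφ : ∀ x ∈ Metric.ball p ρ, (x ∈ S ↔ φ x < 0) := fun x hx =>
    hr₁' x (Metric.ball_subset_ball hρr₁.le hx)
  have hcont : ContinuousAt φ p := h.1.continuousAt
  -- the point `p + s • e` lies deep inside
  obtain ⟨s, hs0, hs⟩ : ∃ s : ℝ, 0 < s ∧ s * ‖e‖ < ρ / 2 := by
    refine ⟨ρ / 2 / (‖e‖ + 1) / 2, by positivity, ?_⟩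
    have h1 : ρ / 2 / (‖e‖ + 1) / 2 * ‖e‖ = ρ / 2 * (‖e‖ / (‖e‖ + 1)) / 2 := by field_simp
    have h2 : ‖e‖ / (‖e‖ + 1) ≤ 1 := (div_le_one (by positivity)).2 (by linarith)
    rw [h1]
    nlinarith
  have hsa : 0 < s * a := mul_pos hs0 ha
  have hlt : ∀ᶠ x in 𝓝 p, φ x < s * a := hcont.eventually (gt_mem_nhds (by rw [h.2.1]; exact hsa))
  obtain ⟨r₂, hr₂, hr₂'⟩ := Metric.eventually_nhds_iff_ball.1 hlt
  refine ⟨min (ρ / 2) r₂, by positivity, ?_⟩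
  set r' := min (ρ / 2) r₂ with hr'
  have hmove : ∀ x ∈ Metric.ball p r', ∀ t ∈ Icc 0 s, x + t • e ∈ Metric.ball p ρ := by
    intro x hx t ht
    rw [Metric.mem_ball, dist_eq_norm] at hx ⊢
    have h1 : ‖x + t • e - p‖ ≤ ‖x - p‖ + t * ‖e‖ := by
      calc ‖x + t • e - p‖ = ‖(x - p) + t • e‖ := by congr 1; abel
        _ ≤ ‖x - p‖ + ‖t • e‖ := norm_add_le _ _
        _ = _ := by rw [norm_smul, Real.norm_of_nonneg ht.1]
    have h2 : t * ‖e‖ ≤ s * ‖e‖ := by gcongr; exact ht.2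
    have h3 := hx.trans_le (min_le_left _ _)
    linarith
  have hball : Metric.ball p r' ⊆ Metric.ball p ρ := fun x hx => by
    simpa using hmove x hx 0 ⟨le_rfl, hs0.le⟩
  have hin : ∀ x ∈ Metric.ball p ρ, x ∈ S → x ∉ frontier Ω := fun x hx hxS =>
    hd x ⟨hxS, Metric.ball_subset_ball hρr.le hx⟩
  have hup : ∀ x ∈ S ∩ Metric.ball p r', ∀ z ∈ segment ℝ x (x + s • e), z ∉ frontier Ω := by
    rintro x ⟨hxS, hx⟩ z hz
    rw [segment_eq_image'] at hz
    obtain ⟨θ, hθ, rfl⟩ := hz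
    have e1 : x + θ • (x + s • e - x) = x + (θ * s) • e := by rw [add_sub_cancel_left, smul_smul]
    simp only [e1]
    have h0 : 0 ≤ θ * s := mul_nonneg hθ.1 hs0.le
    have h1 := hmove x hx (θ * s) ⟨h0, by nlinarith [hθ.2]⟩
    refine hin _ h1 ((hSφ _ h1).2 ?_)
    have h2 := hev x (hball hx) (θ * s) h0 h1
    have h3 := (hSφ x (hball hx)).1 hxS
    nlinarith
  -- The small ball has φ < s a, and the push by s • e lowers φ by at least s a. So the whole
  -- translated ball, which is convex, lies in S.
  have hmid : ∀ x ∈ Metric.ball p r', ∀ y ∈ Metric.ball p r',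
      ∀ z ∈ segment ℝ (x + s • e) (y + s • e), z ∉ frontier Ω := by
    intro x hx y hy z hz
    have hz' : z - s • e ∈ segment ℝ x y := by
      have := (mem_segment_translate ℝ (s • e) (x := z - s • e) (b := x) (c := y)).1
      refine this ?_
      rw [add_sub_cancel, add_comm _ x, add_comm _ y]
      exact hz
    have hz1 : z - s • e ∈ Metric.ball p r' := (convex_ball p r').segment_subset hx hy hz'
    have h1 := hmove _ hz1 s ⟨hs0.le, le_rfl⟩
    have h2 := hev _ (hball hz1) s hs0.le h1
    rw [sub_add_cancel] at h1 h2
    refine hin z h1 ((hSφ z h1).2 ?_)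
    have h3 := hr₂' _ (Metric.ball_subset_ball (min_le_right _ _) hz1)
    linarith
  obtain ⟨x₀, hx₀, hx₀S, hx₀Ω⟩ :=
    mem_closure_iff_nhds.1 hp _ (Metric.ball_mem_nhds p (show 0 < r' by positivity))
  rintro y ⟨hyS, hy⟩
  have h1 := hΩ.mem_of_segment_disjoint_frontier hx₀Ω (hup x₀ ⟨hx₀S, hx₀⟩)
  have h2 := hΩ.mem_of_segment_disjoint_frontier h1 (hmid x₀ hx₀ y hy)
  refine hΩ.mem_of_segment_disjoint_frontier h2 fun z hz => hup y ⟨hyS, hy⟩ z ?_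
  rwa [segment_symm]

/-- A packing argument replaces the coarea formula: about 1/ε translates of the strip along the
inward direction are pairwise disjoint and fit in a ball of twice the radius. -/
theorem exists_volume_strip_le (h : IsLocalDefiningFunction S p φ) :
    ∀ᶠ r in 𝓝[>] (0 : ℝ), ∃ C, ∀ ε > 0,
      volume.real (Metric.closedBall p r ∩ φ ⁻¹' Icc (-2 * ε) (-ε)) ≤ C * ε := by
  obtain ⟨a, ha, hev⟩ := h.eventually_le h.inner_neg_gradient
  set e := -gradient φ p with he
  have he0 : 0 < ‖e‖ := norm_pos_iff.2 (neg_ne_zero.2 h.2.2.1)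
  have h1 : ∀ᶠ x in 𝓝 p, ContDiffAt ℝ 1 φ x := h.1.eventually (by simp)
  obtain ⟨r₁, hr₁, hr₁'⟩ := Metric.eventually_nhds_iff_ball.1 h1
  obtain ⟨ρ, hev, hρ0⟩ := (hev.and self_mem_nhdsWithin).exists
  filter_upwards [Ioo_mem_nhdsGT (lt_min hr₁ hρ0)] with r hr
  have hr0 : 0 < r := hr.1
  have hrr₁ : r < r₁ := hr.2.trans_le (min_le_left _ _)
  have hrρ : r < ρ := hr.2.trans_le (min_le_right _ _)
  refine ⟨2 / a * ‖e‖ / r * volume.real (Metric.closedBall p (2 * r)), fun ε hε => ?_⟩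
  set A := Metric.closedBall p r ∩ φ ⁻¹' Icc (-2 * ε) (-ε) with hA
  have hAm : MeasurableSet A := by
    refine (ContinuousOn.preimage_isClosed_of_isClosed (fun x hx => ?_) Metric.isClosed_closedBall
      isClosed_Icc).measurableSet
    exact (hr₁' x (Metric.closedBall_subset_ball hrr₁ hx)).continuousAt.continuousWithinAt
  -- A shift by s • e lowers φ by at least s a = 2ε, more than the width ε of the strip, so distinct
  -- translates are disjoint.
  set s := 2 * ε / a with hs
  have hs0 : 0 < s := by positivity
  set J := ⌈r / (s * ‖e‖)⌉₊ with hJ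
  have hJ1 : r / (s * ‖e‖) ≤ J := Nat.le_ceil _
  -- disjoint translates of the strip
  let B : ℕ → Set 𝔼 := fun j => (fun x => x + -((j * s) • e)) ⁻¹' A
  have hBd : ∀ i j : ℕ, i < j → Disjoint (B i) (B j) := by
    intro i j hij
    rw [Set.disjoint_left]
    rintro x hxi hxj
    set y := x + -((j * s) • e) with hy
    have e1 : x + -((i * s) • e) = y + ((j - i) * s) • e := by rw [hy]; module
    have hxi' : y + (((j : ℝ) - i) * s) • e ∈ A := by rw [← e1]; exact hxi
    have hxj' : y ∈ A := hxj
    have hij' : (1 : ℝ) ≤ j - i := by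
      have : ((i + 1 : ℕ) : ℝ) ≤ j := by exact_mod_cast hij
      push_cast at this
      linarith
    have h2 := hev y (Metric.closedBall_subset_ball hrρ hxj'.1) (((j : ℝ) - i) * s)
      (by nlinarith) (Metric.closedBall_subset_ball hrρ hxi'.1)
    have h3 : s * a = 2 * ε := by rw [hs]; field_simp
    have h4 := hxi'.2.1
    have h5 := hxj'.2.2
    have h6 : 2 * ε ≤ ((j : ℝ) - i) * s * a := by rw [mul_assoc, h3]; nlinarith
    linarith
  have hBm : ∀ j, MeasurableSet (B j) := fun j => hAm.preimage (measurable_add_const _)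
  have hBsub : ∀ j ∈ Finset.range J, B j ⊆ Metric.closedBall p (2 * r) := by
    intro j hj x hx
    have hj' : (j : ℝ) < r / (s * ‖e‖) := Nat.lt_ceil.1 (Finset.mem_range.1 hj)
    rw [lt_div_iff₀ (by positivity)] at hj'
    have h2 : dist (x + -((j * s) • e)) p ≤ r := hx.1
    rw [Metric.mem_closedBall]
    rw [dist_eq_norm] at h2 ⊢
    calc ‖x - p‖ = ‖(x + -((j * s) • e) - p) + (j * s) • e‖ := by congr 1; module
      _ ≤ ‖x + -((j * s) • e) - p‖ + ‖((j : ℝ) * s) • e‖ := norm_add_le _ _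
      _ ≤ r + j * (s * ‖e‖) := by
        rw [norm_smul, Real.norm_of_nonneg (by positivity), mul_assoc]
        gcongr
      _ ≤ 2 * r := by linarith
  have hsum : volume.real (⋃ j ∈ Finset.range J, B j) = J * volume.real A := by
    rw [measureReal_biUnion_finset ?_ (fun j _ => hBm j) fun j hj =>
      ((measure_mono (hBsub j hj)).trans_lt measure_closedBall_lt_top).ne]
    · have : ∀ j, volume.real (B j) = volume.real A := fun j => by
        simp only [B, Measure.real, measure_preimage_add_right]
      simp [this]
    · intro i _ j _ hij
      rcases lt_or_gt_of_ne hij with h | h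
      · exact hBd i j h
      · exact (hBd j i h).symm
  have hle : J * volume.real A ≤ volume.real (Metric.closedBall p (2 * r)) := by
    rw [← hsum]
    exact measureReal_mono (iUnion₂_subset hBsub) measure_closedBall_lt_top.ne
  have h2 : r / (s * ‖e‖) * volume.real A ≤ volume.real (Metric.closedBall p (2 * r)) :=
    (mul_le_mul_of_nonneg_right hJ1 measureReal_nonneg).trans hle
  have h3 : r / (s * ‖e‖) * volume.real A = volume.real A / (2 / a * ‖e‖ / r * ε) := by
    rw [hs]; field_simp
  rw [h3, div_le_iff₀ (by positivity)] at h2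
  linarith

end IsLocalDefiningFunction

/-! ### The boundary part `Γ₁` -/

theorem closure_gammaZero_subset (hΩ : IsOpen Ω) : closure (gammaZero S Ω) ⊆ Ωᶜ := by
  refine closure_minimal (fun x hx => ?_) hΩ.isClosed_compl
  exact (hΩ.frontier_eq ▸ hx.2).2

theorem exists_ball_disjoint_gammaZero (hp : p ∈ gammaOne S Ω) :
    ∃ r > 0, ∀ x ∈ S ∩ Metric.ball p r, x ∉ frontier Ω := by
  obtain ⟨r, hr, h⟩ := Metric.mem_nhds_iff.1 (isClosed_closure.isOpen_compl.mem_nhds hp.2)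
  exact ⟨r, hr, fun x hx hxΩ => h hx.2 (subset_closure ⟨hx.1, hxΩ⟩)⟩

theorem gammaOne_subset_closure : gammaOne S Ω ⊆ closure (S ∩ Ω) := fun _ hx => hx.1.1

/-- A frontier point of S ∩ Ω that lies in S must lie on ∂Ω, that is on Γ₀. -/
theorem gammaOne_subset_frontier (hSo : IsOpen S) (hΩ : IsOpen Ω) :
    gammaOne S Ω ⊆ frontier S := by
  intro x hx
  have h1 := hx.1
  rw [(hSo.inter hΩ).frontier_eq] at h1
  rw [hSo.frontier_eq]
  refine ⟨closure_mono inter_subset_left h1.1, fun hxS => hx.2 (subset_closure ⟨hxS, ?_⟩)⟩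
  rw [hΩ.frontier_eq]
  exact ⟨closure_mono inter_subset_right h1.1, fun hxΩ => h1.2 ⟨hxS, hxΩ⟩⟩

theorem closure_inter_diff_subset (hSo : IsOpen S) (hΩ : IsOpen Ω) :
    (closure (S ∩ Ω) \ closure (gammaZero S Ω)) \ {0} ⊆ regularSet S Ω := by
  rintro x ⟨⟨h1, h2⟩, h3⟩
  by_cases h : x ∈ S ∩ Ω
  · exact Or.inl h
  · refine Or.inr ⟨⟨?_, h2⟩, h3⟩
    rw [(hSo.inter hΩ).frontier_eq]
    exact ⟨h1, h⟩

theorem regularSet_subset_closure : regularSet S Ω ⊆ closure (S ∩ Ω) :=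
  union_subset subset_closure (sdiff_subset.trans gammaOne_subset_closure)

theorem exists_isLocalDefiningFunction (hSo : IsOpen S) (hΩ : IsOpen Ω)
    (hS : HasC1BoundaryOffOrigin S) (hp : p ∈ gammaOne S Ω \ {0}) :
    ∃ φ, IsLocalDefiningFunction S p φ :=
  hS p ⟨gammaOne_subset_frontier hSo hΩ hp.1, hp.2⟩

theorem exists_ball_inter_eq (hΩ : IsOpen Ω) (hp : p ∈ gammaOne S Ω)
    (h : IsLocalDefiningFunction S p φ) : ∃ r > 0, S ∩ Metric.ball p r ⊆ Ω := by
  obtain ⟨r, hr, hd⟩ := exists_ball_disjoint_gammaZero hp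
  exact h.exists_ball_inter_subset hΩ hr hd (gammaOne_subset_closure hp)

theorem eventually_add_smul_mem_inter (hΩ : IsOpen Ω) (hp : p ∈ gammaOne S Ω)
    (h : IsLocalDefiningFunction S p φ) {d : 𝔼} (hd : inner ℝ (gradient φ p) d < 0) :
    ∀ᶠ s in 𝓝[>] (0 : ℝ), p + s • d ∈ S ∩ Ω := by
  obtain ⟨r, hr, hr'⟩ := exists_ball_inter_eq hΩ hp h
  have hc : Tendsto (fun s : ℝ => p + s • d) (𝓝[>] 0) (𝓝 p) := by
    have : Continuous fun s : ℝ => p + s • d := by fun_prop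
    simpa using (this.tendsto 0).mono_left nhdsWithin_le_nhds
  filter_upwards [h.eventually_add_smul_mem hd, hc.eventually (Metric.ball_mem_nhds p hr)]
    with s h1 h2
  exact ⟨h1, hr' ⟨h1, h2⟩⟩

/-- At a point of Γ₁ the tangent cone contains an open half-space, which spans. This makes the
one-sided gradient of u on Γ₁ unique, hence continuous up to Γ₁ ∖ {O}. -/
theorem uniqueDiffOn_regularSet (hSo : IsOpen S) (hΩ : IsOpen Ω)
    (hS : HasC1BoundaryOffOrigin S) : UniqueDiffOn ℝ (regularSet S Ω) := by
  rintro p (hp | hp)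
  · exact ((hSo.inter hΩ).uniqueDiffWithinAt hp).mono subset_union_left
  · obtain ⟨φ, h⟩ := exists_isLocalDefiningFunction hSo hΩ hS hp
    have hmem : ∀ d : 𝔼, inner ℝ (gradient φ p) d < 0 →
        d ∈ tangentConeAt ℝ (regularSet S Ω) p := by
      intro d hd
      refine mem_tangentConeAt_of_add_smul_mem (l := 𝓝[>] (0 : ℝ)) (c := id) ?_ ?_
      · exact tendsto_id.mono_left (nhdsWithin_mono _ fun x (hx : 0 < x) => hx.ne')
      · filter_upwards [eventually_add_smul_mem_inter hΩ hp.1 h hd] with s hs using Or.inl hs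
    refine ⟨?_, subset_closure (Or.inr hp)⟩
    have htop : Submodule.span ℝ (tangentConeAt ℝ (regularSet S Ω) p) = ⊤ := by
      rw [eq_top_iff]
      intro v _
      set e := -gradient φ p with he
      have hneg := h.inner_neg_gradient
      rw [← he] at hneg
      -- With this k, the pairing of Dφ(p) with v + k • e is ⟨Dφ(p), v⟩ - |⟨Dφ(p), v⟩| - 1 < 0. So v
      -- is a difference of multiples of two inward vectors.
      set k := -((|inner ℝ (gradient φ p) v| + 1) * (inner ℝ (gradient φ p) e)⁻¹) with hk
      have hk0 : k * inner ℝ (gradient φ p) e = -(|inner ℝ (gradient φ p) v| + 1) := by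
        rw [hk, neg_mul, mul_assoc, inv_mul_cancel₀ hneg.ne, mul_one]
      have h1 : v + k • e ∈ tangentConeAt ℝ (regularSet S Ω) p := by
        refine hmem _ ?_
        rw [inner_add_right, inner_smul_right, hk0]
        linarith [le_abs_self (inner ℝ (gradient φ p) v)]
      have h2 : v = (v + k • e) - k • e := by abel
      rw [h2]
      exact Submodule.sub_mem _ (Submodule.subset_span h1)
        (Submodule.smul_mem _ _ (Submodule.subset_span (hmem e hneg)))
    rw [htop]
    exact dense_univ

theorem HasC1BoundaryOffOrigin.continuousOn_gradientWithin (hSo : IsOpen S) (hΩ : IsOpen Ω)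
    (hS : HasC1BoundaryOffOrigin S) {u : 𝔼 → ℝ} (hu : ContDiffOn ℝ 1 u (regularSet S Ω)) :
    ContinuousOn (gradientWithin u (regularSet S Ω)) (regularSet S Ω) :=
  (InnerProductSpace.toDual ℝ 𝔼).symm.continuous.comp_continuousOn
    (hu.continuousOn_fderivWithin (uniqueDiffOn_regularSet hSo hΩ hS) le_rfl)

theorem hasGradientAt_of_mem_inter (hSo : IsOpen S) (hΩ : IsOpen Ω) {u : 𝔼 → ℝ}
    (hu : ContDiffOn ℝ 1 u (regularSet S Ω)) {x : 𝔼} (hx : x ∈ S ∩ Ω) :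
    HasGradientAt u (gradientWithin u (regularSet S Ω) x) x := by
  have h1 := ((hu x (Or.inl hx)).differentiableWithinAt one_ne_zero).hasGradientWithinAt
  rw [hasGradientWithinAt_iff_hasFDerivWithinAt] at h1
  rw [hasGradientAt_iff_hasFDerivAt]
  exact h1.hasFDerivAt (mem_of_superset ((hSo.inter hΩ).mem_nhds hx) subset_union_left)

end ConeWulff

/-! ### Mollification, integration by parts, and the weak equation with the classical gradient. -/

namespace ConeWulff

theorem _root_.contDiff_of_contDiffAt_tsupport {E : Type*} [NormedAddCommGroup E]
    [NormedSpace ℝ E] {n : WithTop ℕ∞} {f : E → ℝ} (h : ∀ x ∈ tsupport f, ContDiffAt ℝ n f x) :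
    ContDiff ℝ n f := by
  refine contDiff_iff_contDiffAt.2 fun x => ?_
  by_cases hx : x ∈ tsupport f
  · exact h x hx
  · exact contDiffAt_const.congr_of_eventuallyEq (notMem_tsupport_iff_eventuallyEq.1 hx)

section Mollification

variable {E : Type*} [NormedAddCommGroup E] [InnerProductSpace ℝ E] [FiniteDimensional ℝ E]
  [MeasurableSpace E] [BorelSpace E]

/-- A compactly supported `C¹` function can be approximated in `C¹` by smooth functions with
support in a given neighbourhood of its support. -/
theorem exists_contDiff_approx {v : E → ℝ} {Ω : Set E} (hv : ContDiff ℝ 1 v)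
    (hvc : HasCompactSupport v) (hΩ : IsOpen Ω) (hvΩ : tsupport v ⊆ Ω) {ε : ℝ} (hε : 0 < ε) :
    ∃ φ : E → ℝ, ContDiff ℝ (⊤ : ℕ∞) φ ∧ HasCompactSupport φ ∧ tsupport φ ⊆ Ω ∧
      (∀ x, ‖φ x - v x‖ ≤ ε) ∧ ∀ x, ‖gradient φ x - gradient v x‖ ≤ ε := by
  obtain ⟨δ, hδ, hδΩ⟩ := hvc.isCompact.exists_cthickening_subset_open hΩ hvΩ
  have hdc : Continuous (fderiv ℝ v) := hv.continuous_fderiv one_ne_zero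
  have hu1 := hvc.uniformContinuous_of_continuous hv.continuous
  have hu2 := (hvc.fderiv ℝ).uniformContinuous_of_continuous hdc
  obtain ⟨δ₁, hδ₁, h1⟩ := Metric.uniformContinuous_iff.1 hu1 ε hε
  obtain ⟨δ₂, hδ₂, h2⟩ := Metric.uniformContinuous_iff.1 hu2 ε hε
  set r := min δ (min δ₁ δ₂) with hr
  have hr0 : 0 < r := by positivity
  let ρ : ContDiffBump (0 : E) := ⟨r / 2, r, by positivity, by linarith⟩
  let L := ContinuousLinearMap.lsmul ℝ ℝ (E := ℝ)
  set φ : E → ℝ := convolution (ρ.normed volume) v L volume with hφ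
  have hρc : HasCompactSupport (ρ.normed (volume : Measure E)) := ρ.hasCompactSupport_normed
  have hρs : ContDiff ℝ (⊤ : ℕ∞) (ρ.normed (volume : Measure E)) := ρ.contDiff_normed
  have hρi : LocallyIntegrable (ρ.normed (volume : Measure E)) volume :=
    hρs.continuous.locallyIntegrable
  have hsupp : tsupport φ ⊆ Metric.cthickening δ (tsupport v) := by
    refine closure_minimal (fun x hx => ?_) Metric.isClosed_cthickening
    obtain ⟨y, hy, z, hz, rfl⟩ := Set.mem_add.1 (support_convolution_subset L hx)
    rw [ρ.support_normed_eq] at hy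
    refine Metric.mem_cthickening_of_dist_le _ z _ _ (subset_closure hz) ?_
    have : dist y 0 < r := hy
    rw [dist_eq_norm, add_sub_cancel_right, ← sub_zero y, ← dist_eq_norm]
    exact this.le.trans (min_le_left _ _)
  have hder : ∀ x y, fderiv ℝ φ x y
      = convolution (ρ.normed volume) (fun a => fderiv ℝ v a y) L volume x := by
    intro x y
    rw [(hvc.hasFDerivAt_convolution_right L hρi hv x).fderiv,
      convolution_precompR_apply L hρi (hvc.fderiv ℝ) hdc]
  refine ⟨φ, hρc.contDiff_convolution_left L hρs hv.continuous.locallyIntegrable,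
    hρc.convolution L hvc, hsupp.trans hδΩ, fun x => ?_, fun x => ?_⟩
  · rw [← dist_eq_norm]
    refine ContDiffBump.dist_normed_convolution_le hv.continuous.aestronglyMeasurable
      fun y hy => (h1 ?_).le
    exact (Metric.mem_ball.1 hy).trans_le ((min_le_right _ _).trans (min_le_left _ _))
  · have h3 : ‖fderiv ℝ φ x - fderiv ℝ v x‖ ≤ ε := by
      refine ContinuousLinearMap.opNorm_le_bound _ hε.le fun y => ?_
      rw [sub_apply, hder, ← dist_eq_norm]
      refine ContDiffBump.dist_normed_convolution_le
        (hdc.clm_apply continuous_const).aestronglyMeasurable fun z hz => ?_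
      rw [dist_eq_norm, ← sub_apply]
      refine (ContinuousLinearMap.le_opNorm _ _).trans ?_
      gcongr
      rw [← dist_eq_norm]
      exact (h2 ((Metric.mem_ball.1 hz).trans_le ((min_le_right _ _).trans (min_le_right _ _)))).le
    simp only [gradient]
    rw [← map_sub, LinearIsometryEquiv.norm_map]
    exact h3

theorem integral_gradient_eq_zero {h : E → ℝ} (hh : ContDiff ℝ 1 h) (hc : HasCompactSupport h) :
    ∫ x, gradient h x = 0 := by
  have hdc : Continuous (gradient h) :=
    (InnerProductSpace.toDual ℝ E).symm.continuous.comp (hh.continuous_fderiv one_ne_zero)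
  have hgc : HasCompactSupport (gradient h) := (hc.fderiv ℝ).comp_left (map_zero _)
  refine ext_inner_left ℝ fun e => ?_
  rw [inner_zero_right, ← integral_inner (hdc.integrable_of_hasCompactSupport hgc)]
  have := integral_mul_fderiv_eq_neg_fderiv_mul_of_integrable (f := fun _ => (1 : ℝ)) (g := h)
    (v := e) (μ := (volume : Measure E)) (by simp) ?_ ?_ (by simp)
    (fun x _ => hh.differentiable one_ne_zero x)
  · simp only [fderiv_fun_const, Pi.zero_apply, _root_.zero_apply, zero_mul,
      integral_zero, neg_zero, one_mul, ← inner_gradient_left] at this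
    simpa only [real_inner_comm] using this
  · have := (((hh.continuous_fderiv one_ne_zero).clm_apply
      (continuous_const (y := e))).integrable_of_hasCompactSupport (hc.fderiv_apply ℝ e)
      (μ := volume))
    simpa using this
  · simpa using hh.continuous.integrable_of_hasCompactSupport hc (μ := volume)

/-- The weak form of div x = N, obtained by integrating by parts in each direction of an orthonormal
basis. -/
theorem integral_inner_gradient_id {v : E → ℝ} (hv : ContDiff ℝ 1 v) (hc : HasCompactSupport v) :
    ∫ x, inner ℝ (gradient v x) x = -(Module.finrank ℝ E : ℝ) * ∫ x, v x := by
  set b := stdOrthonormalBasis ℝ E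
  have hdc : Continuous (gradient v) :=
    (InnerProductSpace.toDual ℝ E).symm.continuous.comp (hv.continuous_fderiv one_ne_zero)
  have hgc : HasCompactSupport (gradient v) := (hc.fderiv ℝ).comp_left (map_zero _)
  have key : ∀ i, ∫ x, inner ℝ (b i) x * inner ℝ (gradient v x) (b i) = - ∫ x, v x := by
    intro i
    have hf : ∀ x, HasFDerivAt (fun x => inner ℝ (b i) x) (innerSL ℝ (b i)) x := fun x =>
      (innerSL ℝ (b i)).hasFDerivAt
    have hb : inner ℝ (b i) (b i) = (1 : ℝ) := by
      rw [real_inner_self_eq_norm_sq, b.orthonormal.1 i, one_pow]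
    have := integral_mul_fderiv_eq_neg_fderiv_mul_of_integrable (f := fun x => inner ℝ (b i) x)
      (g := v) (v := b i) (μ := (volume : Measure E)) ?_ ?_ ?_ (fun x _ => (hf x).differentiableAt)
      (fun x _ => hv.differentiable one_ne_zero x)
    · simp only [(hf _).fderiv, innerSL_apply_apply, hb, one_mul] at this
      simpa only [inner_gradient_left] using this
    · simp only [(hf _).fderiv, innerSL_apply_apply, hb, one_mul]
      exact hv.continuous.integrable_of_hasCompactSupport hc
    · refine Continuous.integrable_of_hasCompactSupport ?_ ?_
      · exact (by fun_prop : Continuous fun x : E => inner ℝ (b i) x).mul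
          ((hv.continuous_fderiv one_ne_zero).clm_apply continuous_const)
      · exact (hc.fderiv_apply ℝ (b i)).mul_left
    · exact ((by fun_prop : Continuous fun x : E => inner ℝ (b i) x).mul
        hv.continuous).integrable_of_hasCompactSupport hc.mul_left
  have hsum : ∀ x, inner ℝ (gradient v x) x
      = ∑ i, inner ℝ (b i) x * inner ℝ (gradient v x) (b i) := fun x => by
    rw [← b.sum_inner_mul_inner]
    simp only [mul_comm]
  simp only [hsum]
  rw [integral_finsetSum]
  · simp only [key, Finset.sum_const, Finset.card_univ, Fintype.card_fin, nsmul_eq_mul]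
    ring
  · intro i _
    refine Continuous.integrable_of_hasCompactSupport (by fun_prop) ?_
    refine HasCompactSupport.mul_left ?_
    exact hgc.comp_left (g := fun y => inner ℝ y (b i)) (by simp)

end Mollification

/-- On a finite measure space L² convergence implies L¹ convergence. It serves to pass to the limit
in integrals of the approximants multiplied by a bounded factor. -/
theorem tendsto_integral_of_tendsto_eLpNorm_two {α : Type*} [MeasurableSpace α] {μ : Measure α}
    [IsFiniteMeasure μ] {E F : Type*} [NormedAddCommGroup E] [NormedAddCommGroup F]
    [NormedSpace ℝ F] {f : ℕ → α → E} {g : α → E} {f' : ℕ → α → F} {g' : α → F} {C : ℝ}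
    (hf' : ∀ k, Integrable (f' k) μ) (hg' : Integrable g' μ)
    (hfm : ∀ k, AEStronglyMeasurable (fun x => f k x - g x) μ)
    (hle : ∀ k x, ‖f' k x - g' x‖ ≤ C * ‖f k x - g x‖)
    (hlim : Tendsto (fun k => eLpNorm (fun x => f k x - g x) 2 μ) atTop (𝓝 0)) :
    Tendsto (fun k => ∫ x, f' k x ∂μ) atTop (𝓝 (∫ x, g' x ∂μ)) := by
  refine tendsto_integral_of_L1' _ hg'.aestronglyMeasurable (Eventually.of_forall hf') ?_
  have h1 : Tendsto (fun k => ENNReal.ofReal C * (eLpNorm (fun x => f k x - g x) 2 μ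
      * μ univ ^ (1 / (1 : ENNReal).toReal - 1 / (2 : ENNReal).toReal))) atTop (𝓝 0) := by
    have h2 : μ univ ^ (1 / (1 : ENNReal).toReal - 1 / (2 : ENNReal).toReal) ≠ ⊤ :=
      ENNReal.rpow_ne_top_of_nonneg (by norm_num) (measure_ne_top μ _)
    have h3 := ENNReal.Tendsto.mul_const hlim (Or.inr h2)
    have h4 := ENNReal.Tendsto.const_mul h3 (Or.inr (ENNReal.ofReal_ne_top (r := C)))
    simpa using h4
  refine tendsto_of_tendsto_of_tendsto_of_le_of_le tendsto_const_nhds h1 (fun _ => zero_le)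
    fun k => ?_
  refine (eLpNorm_le_mul_eLpNorm_of_ae_le_mul (Eventually.of_forall (hle k)) 1).trans ?_
  gcongr
  exact eLpNorm_le_eLpNorm_mul_rpow_measure_univ (by norm_num) (hfm k)

variable {N : ℕ}

local notation "𝔼" => EuclideanSpace ℝ (Fin N)

variable {S Ω : Set (EuclideanSpace ℝ (Fin N))} {H : EuclideanSpace ℝ (Fin N) → ℝ}

theorem continuous_gradient {v : 𝔼 → ℝ} (hv : ContDiff ℝ 1 v) : Continuous (gradient v) :=
  (InnerProductSpace.toDual ℝ 𝔼).symm.continuous.comp (hv.continuous_fderiv one_ne_zero)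

theorem hasCompactSupport_gradient {v : 𝔼 → ℝ} (hv : HasCompactSupport v) :
    HasCompactSupport (gradient v) := (hv.fderiv ℝ).comp_left (map_zero _)

theorem tsupport_gradient_subset (v : 𝔼 → ℝ) : tsupport (gradient v) ⊆ tsupport v := by
  refine closure_minimal (fun x hx => support_fderiv_subset ℝ (f := v) ?_) isClosed_closure
  intro h
  exact hx (by simp [gradient, h])

theorem gradient_mul {f g : 𝔼 → ℝ} {x : 𝔼} (hf : DifferentiableAt ℝ f x)
    (hg : DifferentiableAt ℝ g x) :
    gradient (fun y => f y * g y) x = f x • gradient g x + g x • gradient f x := by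
  simp only [gradient]
  rw [fderiv_fun_mul hf hg]
  simp

/-- W₀^{1,2} is defined by smooth approximants, so a C¹ function enters it through mollification;
uniform C¹ closeness gives L² closeness because Ω is bounded. -/
theorem memWGammaZero_of_contDiff (hΩ : IsOpen Ω) (hΩb : Bornology.IsBounded Ω) {v : 𝔼 → ℝ}
    (hv : ContDiff ℝ 1 v) (hvc : HasCompactSupport v) (hvΩ : tsupport v ⊆ Ω) :
    MemWGammaZero S Ω v (gradient v) := by
  refine ⟨v, gradient v, ⟨(hv.continuous.memLp_of_hasCompactSupport hvc).restrict Ω,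
    ((continuous_gradient hv).memLp_of_hasCompactSupport
      (hasCompactSupport_gradient hvc)).restrict Ω, ?_⟩, EventuallyEq.rfl, EventuallyEq.rfl⟩
  have hfin : IsFiniteMeasure (volume.restrict Ω) :=
    ⟨by rw [Measure.restrict_apply_univ]; exact hΩb.measure_lt_top⟩
  choose φ h1 h2 h3 h4 h5 using fun k : ℕ =>
    exists_contDiff_approx hv hvc hΩ hvΩ (Nat.one_div_pos_of_nat (α := ℝ) (n := k))
  have hlim : Tendsto (fun k : ℕ => volume.restrict Ω univ ^ (2 : ENNReal).toReal⁻¹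
      * ENNReal.ofReal (1 / (k + 1))) atTop (𝓝 0) := by
    have := ENNReal.Tendsto.const_mul (ENNReal.tendsto_ofReal
      (tendsto_one_div_add_atTop_nhds_zero_nat (𝕜 := ℝ)))
      (Or.inr (ENNReal.rpow_ne_top_of_nonneg (y := (2 : ENNReal).toReal⁻¹) (by norm_num)
        (measure_ne_top (volume.restrict Ω) univ)))
    simpa using this
  refine ⟨φ, fun k => ⟨h1 k, h2 k, h3 k⟩, ?_, ?_⟩
  · exact tendsto_of_tendsto_of_tendsto_of_le_of_le tendsto_const_nhds hlim (fun _ => zero_le)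
      fun k => eLpNorm_le_of_ae_bound (Eventually.of_forall (h4 k))
  · exact tendsto_of_tendsto_of_tendsto_of_le_of_le tendsto_const_nhds hlim (fun _ => zero_le)
      fun k => eLpNorm_le_of_ae_bound (Eventually.of_forall (h5 k))

/-- Members of `W₀^{1,2}` satisfy integration by parts against smooth functions. -/
theorem MemW012.integral_smul (hΩb : Bornology.IsBounded Ω) {w : 𝔼 → ℝ} {G : 𝔼 → 𝔼}
    (h : MemW012 Ω w G) {ψ : 𝔼 → ℝ} (hψ : ContDiff ℝ 1 ψ) (hψc : HasCompactSupport ψ)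
    (hψΩ : tsupport ψ ⊆ Ω) :
    ∫ x in Ω, ψ x • G x = - ∫ x in Ω, w x • gradient ψ x := by
  obtain ⟨hw, hG, φ, hφ, hlim1, hlim2⟩ := h
  have hfin : IsFiniteMeasure (volume.restrict Ω) :=
    ⟨by rw [Measure.restrict_apply_univ]; exact hΩb.measure_lt_top⟩
  obtain ⟨C₁, hC₁⟩ := hψ.continuous.bounded_above_of_compact_support hψc
  have hgc := hasCompactSupport_gradient hψc
  have hgcont := continuous_gradient hψ
  obtain ⟨C₂, hC₂⟩ := hgcont.bounded_above_of_compact_support hgc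
  have hφ1 : ∀ k, ContDiff ℝ 1 (φ k) := fun k => (hφ k).1.of_le (by exact_mod_cast le_top)
  have hw1 : Integrable w (volume.restrict Ω) := hw.integrable (by norm_num)
  have hG1 : Integrable G (volume.restrict Ω) := hG.integrable (by norm_num)
  have t1 : Tendsto (fun k => ∫ x in Ω, ψ x • gradient (φ k) x) atTop
      (𝓝 (∫ x in Ω, ψ x • G x)) := by
    refine tendsto_integral_of_tendsto_eLpNorm_two (C := C₁) (fun k => ?_) ?_ (fun k => ?_)
      (fun k x => ?_) hlim2
    · exact ((hψ.continuous.smul (continuous_gradient (hφ1 k))).integrable_of_hasCompactSupport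
        hψc.smul_right).restrict
    · exact hG1.bdd_smul C₁ hψ.continuous.aestronglyMeasurable (Eventually.of_forall hC₁)
    · exact (continuous_gradient (hφ1 k)).aestronglyMeasurable.sub hG.1
    · rw [← smul_sub, norm_smul]
      gcongr
      exact hC₁ x
  have t2 : Tendsto (fun k => ∫ x in Ω, φ k x • gradient ψ x) atTop
      (𝓝 (∫ x in Ω, w x • gradient ψ x)) := by
    refine tendsto_integral_of_tendsto_eLpNorm_two (C := C₂) (fun k => ?_) ?_ (fun k => ?_)
      (fun k x => ?_) hlim1
    · exact (((hφ1 k).continuous.smul hgcont).integrable_of_hasCompactSupport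
        hgc.smul_left).restrict
    · exact hw1.smul_bdd C₂ hgcont.aestronglyMeasurable (Eventually.of_forall hC₂)
    · exact (hφ1 k).continuous.aestronglyMeasurable.sub hw.1
    · rw [← sub_smul, norm_smul, mul_comm]
      gcongr
      exact hC₂ x
  have hk : ∀ k, ∫ x in Ω, ψ x • gradient (φ k) x = - ∫ x in Ω, φ k x • gradient ψ x := by
    intro k
    have e1 : ∫ x in Ω, ψ x • gradient (φ k) x = ∫ x, ψ x • gradient (φ k) x :=
      setIntegral_eq_integral_of_forall_compl_eq_zero fun x hx => by
        rw [image_eq_zero_of_notMem_tsupport fun h => hx (hψΩ h), zero_smul]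
    have e2 : ∫ x in Ω, φ k x • gradient ψ x = ∫ x, φ k x • gradient ψ x :=
      setIntegral_eq_integral_of_forall_compl_eq_zero fun x hx => by
        rw [image_eq_zero_of_notMem_tsupport fun h => hx ((hφ k).2.2 h), zero_smul]
    have i1 : Integrable (fun x => ψ x • gradient (φ k) x) :=
      (hψ.continuous.smul (continuous_gradient (hφ1 k))).integrable_of_hasCompactSupport
        hψc.smul_right
    have i2 : Integrable (fun x => φ k x • gradient ψ x) :=
      ((hφ1 k).continuous.smul hgcont).integrable_of_hasCompactSupport hgc.smul_left
    rw [e1, e2, eq_neg_iff_add_eq_zero, ← integral_add i1 i2]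
    rw [← integral_gradient_eq_zero (hψ.mul (hφ1 k)) hψc.mul_right]
    refine integral_congr_ae (Eventually.of_forall fun x => ?_)
    exact (gradient_mul (hψ.differentiable one_ne_zero x)
      ((hφ1 k).differentiable one_ne_zero x)).symm
  refine tendsto_nhds_unique t1 ?_
  simp only [hk]
  exact t2.neg

theorem gradient_eq_zero_of_notMem_tsupport {ψ : 𝔼 → ℝ} {x : 𝔼} (hx : x ∉ tsupport ψ) :
    gradient ψ x = 0 :=
  image_eq_zero_of_notMem_tsupport fun h => hx (tsupport_gradient_subset ψ h)

theorem _root_.ContDiffOn.continuousOn_gradient {U : Set 𝔼} {u : 𝔼 → ℝ} (hu : ContDiffOn ℝ 1 u U)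
    (hU : IsOpen U) : ContinuousOn (gradient u) U :=
  (InnerProductSpace.toDual ℝ 𝔼).symm.continuous.comp_continuousOn
    (hu.continuousOn_fderiv_of_isOpen hU le_rfl)

/-- Integration by parts for a function of class `C¹` on an open set. -/
theorem integral_smul_gradient_add_eq_zero {U : Set 𝔼} (hU : IsOpen U) {u ψ : 𝔼 → ℝ}
    (hu : ContDiffOn ℝ 1 u U) (hψ : ContDiff ℝ 1 ψ) (hψc : HasCompactSupport ψ)
    (hψU : tsupport ψ ⊆ U) :
    IntegrableOn (fun x => ψ x • gradient u x) U ∧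
      ∫ x in U, ψ x • gradient u x = - ∫ x in U, u x • gradient ψ x := by
  have huc := hu.continuousOn_gradient hU
  have hψu : ContDiff ℝ 1 (fun x => ψ x * u x) := by
    refine contDiff_of_contDiffAt_tsupport fun x hx => ?_
    exact hψ.contDiffAt.mul (hu.contDiffAt (hU.mem_nhds (hψU (tsupport_mul_subset_left hx))))
  have hψ0 : ∀ x ∉ U, ψ x = 0 := fun x hx =>
    image_eq_zero_of_notMem_tsupport fun h => hx (hψU h)
  have hgψ0 : ∀ x ∉ U, gradient ψ x = 0 := fun x hx =>
    gradient_eq_zero_of_notMem_tsupport fun h => hx (hψU h)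
  have hcψu : Continuous fun x => ψ x • gradient u x := by
    refine continuous_of_tsupport fun x hx => ?_
    have hxU := hψU (tsupport_smul_subset_left _ _ hx)
    exact hψ.continuous.continuousAt.smul (huc.continuousAt (hU.mem_nhds hxU))
  have hcuψ : Continuous fun x => u x • gradient ψ x := by
    refine continuous_of_tsupport fun x hx => ?_
    have hxU := hψU (tsupport_gradient_subset _ (tsupport_smul_subset_right _ _ hx))
    exact (hu.continuousOn.continuousAt (hU.mem_nhds hxU)).smul
      (continuous_gradient hψ).continuousAt
  have hi2 : Integrable (fun x => ψ x • gradient u x) :=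
    hcψu.integrable_of_hasCompactSupport (hψc.smul_right (f' := gradient u))
  have hi3 : Integrable (fun x => u x • gradient ψ x) :=
    hcuψ.integrable_of_hasCompactSupport
      ((hasCompactSupport_gradient hψc).smul_left (f := u))
  refine ⟨hi2.integrableOn, ?_⟩
  have e1 : ∫ x in U, ψ x • gradient u x = ∫ x, ψ x • gradient u x :=
    setIntegral_eq_integral_of_forall_compl_eq_zero fun x hx => by rw [hψ0 x hx, zero_smul]
  have e2 : ∫ x in U, u x • gradient ψ x = ∫ x, u x • gradient ψ x :=
    setIntegral_eq_integral_of_forall_compl_eq_zero fun x hx => by rw [hgψ0 x hx, smul_zero]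
  have e3 : ∀ x, gradient (fun x => ψ x * u x) x = ψ x • gradient u x + u x • gradient ψ x := by
    intro x
    by_cases hx : x ∈ U
    · exact gradient_mul (hψ.differentiable one_ne_zero x)
        ((hu.contDiffAt (hU.mem_nhds hx)).differentiableAt one_ne_zero)
    · rw [hψ0 x hx, hgψ0 x hx, zero_smul, smul_zero, add_zero]
      exact gradient_eq_zero_of_notMem_tsupport fun h => hx (hψU (tsupport_mul_subset_left h))
  have e4 := integral_gradient_eq_zero hψu hψc.mul_right
  simp only [e3] at e4
  rw [integral_add hi2 hi3] at e4
  rw [e1, e2]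
  exact eq_neg_of_add_eq_zero_left e4

/-- A weak gradient agrees almost everywhere with the classical one. -/
theorem MemWGammaZero.ae_eq_gradient (hSo : IsOpen S) (hΩ : IsOpen Ω)
    (hΩb : Bornology.IsBounded Ω) {u : 𝔼 → ℝ} {g : 𝔼 → 𝔼}
    (h : MemWGammaZero S Ω u g) (hu : ContDiffOn ℝ 1 u (S ∩ Ω)) :
    g =ᵐ[volume.restrict (S ∩ Ω)] gradient u := by
  obtain ⟨w, G, hwG, huw, hgG⟩ := h
  refine hgG.trans ?_
  have hU := hSo.inter hΩ
  have hfin : IsFiniteMeasure (volume.restrict Ω) :=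
    ⟨by rw [Measure.restrict_apply_univ]; exact hΩb.measure_lt_top⟩
  have hG1 : IntegrableOn G (S ∩ Ω) :=
    IntegrableOn.mono_set (t := Ω) (hwG.2.1.integrable (by norm_num)) inter_subset_right
  have huli : LocallyIntegrableOn (gradient u) (S ∩ Ω) :=
    (hu.continuousOn_gradient hU).locallyIntegrableOn hU.measurableSet
  -- Fundamental lemma of the calculus of variations: both gradients have the same integral against
  -- every smooth ψ supported in S ∩ Ω.
  have key := hU.ae_eq_zero_of_integral_contDiff_smul_eq_zero (μ := volume)
    (f := fun x => G x - gradient u x) (hG1.locallyIntegrableOn.sub huli) ?_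
  · rw [EventuallyEq, ae_restrict_iff' hU.measurableSet]
    filter_upwards [key] with x hx hxU
    exact sub_eq_zero.1 (hx hxU)
  intro ψ hψ hψc hψU
  have hψ1 : ContDiff ℝ 1 ψ := hψ.of_le (by exact_mod_cast le_top)
  have h1 := hwG.integral_smul hΩb hψ1 hψc (hψU.trans inter_subset_right)
  obtain ⟨hi2, e3⟩ := integral_smul_gradient_add_eq_zero hU hu hψ1 hψc hψU
  have hψ0 : ∀ x ∉ S ∩ Ω, ψ x = 0 := fun x hx =>
    image_eq_zero_of_notMem_tsupport fun h => hx (hψU h)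
  have hgψ0 : ∀ x ∉ S ∩ Ω, gradient ψ x = 0 := fun x hx =>
    gradient_eq_zero_of_notMem_tsupport fun h => hx (hψU h)
  have e1 : ∫ x in Ω, ψ x • G x = ∫ x in S ∩ Ω, ψ x • G x := by
    refine setIntegral_eq_of_subset_of_forall_sdiff_eq_zero hΩ.measurableSet inter_subset_right
      fun x hx => ?_
    rw [hψ0 x hx.2, zero_smul]
  have e2 : ∫ x in Ω, w x • gradient ψ x = ∫ x in S ∩ Ω, w x • gradient ψ x := by
    refine setIntegral_eq_of_subset_of_forall_sdiff_eq_zero hΩ.measurableSet inter_subset_right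
      fun x hx => ?_
    rw [hgψ0 x hx.2, smul_zero]
  have e2' : ∫ x in S ∩ Ω, w x • gradient ψ x = ∫ x in S ∩ Ω, u x • gradient ψ x := by
    refine integral_congr_ae ?_
    filter_upwards [huw] with x hx
    rw [hx]
  obtain ⟨C₁, hC₁⟩ := hψ1.continuous.bounded_above_of_compact_support hψc
  have hi1 : IntegrableOn (fun x => ψ x • G x) (S ∩ Ω) :=
    Integrable.bdd_smul hG1 C₁ hψ1.continuous.aestronglyMeasurable (Eventually.of_forall hC₁)
  have e4 : ∫ x, ψ x • (G x - gradient u x) = ∫ x in S ∩ Ω, ψ x • (G x - gradient u x) :=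
    (setIntegral_eq_integral_of_forall_compl_eq_zero fun x hx => by rw [hψ0 x hx, zero_smul]).symm
  rw [e4]
  simp only [smul_sub]
  rw [integral_sub hi1 hi2, ← e1, e3, h1, e2, e2', sub_self]

/-- Only test functions supported inside S ∩ Ω are kept. The behaviour at Γ₁ is recovered later from
the pointwise conormal condition, in a form that applies equally to the field x. -/
theorem IsWeakSolution.integral_inner_eq (hSo : IsOpen S) (hΩ : IsOpen Ω)
    (hΩb : Bornology.IsBounded Ω) {u f : 𝔼 → ℝ} (h : IsWeakSolution H S Ω f u)
    (hu : ContDiffOn ℝ 1 u (S ∩ Ω)) {v : 𝔼 → ℝ} (hv : ContDiff ℝ 1 v)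
    (hvc : HasCompactSupport v) (hvU : tsupport v ⊆ S ∩ Ω) :
    ∫ x in S ∩ Ω, inner ℝ (gradient v x) (gradient (lagrangian H) (gradient u x))
      = ∫ x in S ∩ Ω, f x * v x := by
  obtain ⟨g, hg, hw⟩ := h
  rw [← hw v _ (memWGammaZero_of_contDiff hΩ hΩb hv hvc (hvU.trans inter_subset_right))]
  refine integral_congr_ae ?_
  filter_upwards [hg.ae_eq_gradient hSo hΩ hΩb hu] with x hx
  rw [hx]

theorem IsWeakSolution.memLp_gradient (hSo : IsOpen S) (hΩ : IsOpen Ω)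
    (hΩb : Bornology.IsBounded Ω) {u f : 𝔼 → ℝ} (h : IsWeakSolution H S Ω f u)
    (hu : ContDiffOn ℝ 1 u (S ∩ Ω)) : MemLp (gradient u) 2 (volume.restrict (S ∩ Ω)) := by
  obtain ⟨g, hg, -⟩ := h
  have h1 := hg.ae_eq_gradient hSo hΩ hΩb hu
  obtain ⟨w, G, hwG, -, hgG⟩ := hg
  exact (hwG.2.1.mono_measure (Measure.restrict_mono inter_subset_right le_rfl)).ae_eq
    (hgG.symm.trans h1)

end ConeWulff

/-! ### Extending the weak equation to test functions that do not vanish on Γ₁. -/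

namespace ConeWulff

variable {N : ℕ}

local notation "𝔼" => EuclideanSpace ℝ (Fin N)

/-- `v` is of class `C¹` on `U`, bounded with bounded gradient, and vanishes on `U` off `K`. -/
structure IsTestOn (U K : Set (EuclideanSpace ℝ (Fin N))) (v : EuclideanSpace ℝ (Fin N) → ℝ) :
    Prop where
  contDiffOn : ContDiffOn ℝ 1 v U
  eq_zero : ∀ x ∈ U, x ∉ K → v x = 0
  bdd : ∃ C, ∀ x ∈ U, ‖v x‖ ≤ C ∧ ‖gradient v x‖ ≤ C

namespace IsTestOn

variable {U K R : Set (EuclideanSpace ℝ (Fin N))} {v : EuclideanSpace ℝ (Fin N) → ℝ}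
  {F : EuclideanSpace ℝ (Fin N) → EuclideanSpace ℝ (Fin N)}

theorem eventuallyEq_zero (h : IsTestOn U K v) (hU : IsOpen U) (hK : IsCompact K) {x : 𝔼}
    (hx : x ∈ U) (hxK : x ∉ K) : v =ᶠ[𝓝 x] 0 := by
  filter_upwards [hU.mem_nhds hx, hK.isClosed.isOpen_compl.mem_nhds hxK] with y hy hyK
  exact h.eq_zero y hy hyK

theorem gradient_eq_zero (h : IsTestOn U K v) (hU : IsOpen U) (hK : IsCompact K) {x : 𝔼}
    (hx : x ∈ U) (hxK : x ∉ K) : gradient v x = 0 := by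
  simp only [gradient, (h.eventuallyEq_zero hU hK hx hxK).fderiv_eq]
  simp

theorem integrableOn (h : IsTestOn U K v) (hU : IsOpen U) (hUb : Bornology.IsBounded U) :
    IntegrableOn v U := by
  obtain ⟨C, hC⟩ := h.bdd
  refine IntegrableOn.of_bound hUb.measure_lt_top
    (h.contDiffOn.continuousOn.aestronglyMeasurable hU.measurableSet) C ?_
  filter_upwards [ae_restrict_mem hU.measurableSet] with x hx using (hC x hx).1

/-- F may blow up near Γ₀ and near the origin, but only its values on the compact set K matter. -/
theorem exists_norm_inner_le (h : IsTestOn U K v) (hU : IsOpen U) (hK : IsCompact K)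
    (hF : ContinuousOn F R) (hKR : K ⊆ R) : ∃ C, ∀ x ∈ U, ‖inner ℝ (gradient v x) (F x)‖ ≤ C := by
  obtain ⟨C, hC⟩ := h.bdd
  obtain ⟨M, hM⟩ := hK.exists_bound_of_continuousOn (hF.mono hKR)
  refine ⟨max 0 (C * M), fun x hx => ?_⟩
  by_cases hxK : x ∈ K
  · refine (norm_inner_le_norm _ _).trans (le_max_of_le_right ?_)
    have h1 := (hC x hx).2
    have h2 := hM x hxK
    gcongr
    exact (norm_nonneg _).trans h1
  · rw [h.gradient_eq_zero hU hK hx hxK, inner_zero_left, norm_zero]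
    exact le_max_left _ _

theorem aestronglyMeasurable_inner (h : IsTestOn U K v) (hU : IsOpen U)
    (hF : ContinuousOn F R) (hUR : U ⊆ R) :
    AEStronglyMeasurable (fun x => inner ℝ (gradient v x) (F x)) (volume.restrict U) :=
  ((h.contDiffOn.continuousOn_gradient hU).inner (𝕜 := ℝ) (hF.mono hUR)).aestronglyMeasurable
    hU.measurableSet

theorem integrableOn_inner (h : IsTestOn U K v) (hU : IsOpen U) (hUb : Bornology.IsBounded U)
    (hK : IsCompact K) (hF : ContinuousOn F R) (hUR : U ⊆ R) (hKR : K ⊆ R) :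
    IntegrableOn (fun x => inner ℝ (gradient v x) (F x)) U := by
  obtain ⟨C, hC⟩ := h.exists_norm_inner_le hU hK hF hKR
  refine IntegrableOn.of_bound hUb.measure_lt_top
    (h.aestronglyMeasurable_inner hU hF hUR) C ?_
  filter_upwards [ae_restrict_mem hU.measurableSet] with x hx using hC x hx

theorem gradient_mul_of_mem (h : IsTestOn U K v) (hU : IsOpen U) {ψ : 𝔼 → ℝ} {x : 𝔼}
    (hψ : ContDiffAt ℝ 1 ψ x) (hx : x ∈ U) :
    gradient (fun y => ψ y * v y) x = ψ x • gradient v x + v x • gradient ψ x :=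
  gradient_mul (hψ.differentiableAt one_ne_zero)
    ((h.contDiffOn.contDiffAt (hU.mem_nhds hx)).differentiableAt one_ne_zero)

/-- The product with a function which is `C¹` near the support is again a test function. -/
theorem mul (h : IsTestOn U K v) (hU : IsOpen U) (hK : IsCompact K) {ψ : 𝔼 → ℝ}
    (hψ : ∀ x ∈ K, ContDiffAt ℝ 1 ψ x) {K' : Set 𝔼} (hK' : ∀ x ∈ U ∩ K, x ∉ K' → ψ x = 0) :
    IsTestOn U K' (fun x => ψ x * v x) := by
  have hψc : ContinuousOn ψ K := fun x hx => (hψ x hx).continuousAt.continuousWithinAt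
  have hψg : ContinuousOn (gradient ψ) K := fun x hx =>
    ((InnerProductSpace.toDual ℝ 𝔼).symm.continuous.continuousAt.comp
      ((hψ x hx).continuousAt_fderiv one_ne_zero)).continuousWithinAt
  have hzero : ∀ x ∈ U, x ∉ K → (fun x => ψ x * v x) =ᶠ[𝓝 x] 0 := fun x hx hxK => by
    filter_upwards [h.eventuallyEq_zero hU hK hx hxK] with y hy
    simp [hy]
  refine ⟨fun x hx => ?_, fun x hx hxK => ?_, ?_⟩
  · by_cases hxK : x ∈ K
    · exact ((hψ x hxK).mul (h.contDiffOn.contDiffAt (hU.mem_nhds hx))).contDiffWithinAt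
    · exact (contDiffAt_const.congr_of_eventuallyEq (hzero x hx hxK)).contDiffWithinAt
  · by_cases hxK' : x ∈ K
    · rw [hK' x ⟨hx, hxK'⟩ hxK, zero_mul]
    · rw [h.eq_zero x hx hxK', mul_zero]
  · obtain ⟨C, hC⟩ := h.bdd
    obtain ⟨M₁, hM₁⟩ := hK.exists_bound_of_continuousOn hψc
    obtain ⟨M₂, hM₂⟩ := hK.exists_bound_of_continuousOn hψg
    refine ⟨max 0 (M₁ * C + C * M₂ + M₁ * C), fun x hx => ?_⟩
    obtain ⟨c1, c2⟩ := hC x hx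
    have c0 := (norm_nonneg _).trans c1
    by_cases hxK : x ∈ K
    · have m1 := hM₁ x hxK
      have m2 := hM₂ x hxK
      have m10 := (norm_nonneg _).trans m1
      have m20 := (norm_nonneg _).trans m2
      have hb1 : ‖ψ x * v x‖ ≤ M₁ * C := by
        rw [norm_mul]
        gcongr
      have p1 : 0 ≤ M₁ * C := by positivity
      have p2 : 0 ≤ C * M₂ := by positivity
      refine ⟨le_max_of_le_right (by linarith), le_max_of_le_right ?_⟩
      rw [h.gradient_mul_of_mem hU (hψ x hxK) hx]
      have b1 : ‖ψ x • gradient v x‖ ≤ M₁ * C := by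
        rw [norm_smul]
        gcongr
      have b2 : ‖v x • gradient ψ x‖ ≤ C * M₂ := by
        rw [norm_smul]
        gcongr
      linarith [norm_add_le (ψ x • gradient v x) (v x • gradient ψ x)]
    · have e := hzero x hx hxK
      have : gradient (fun x => ψ x * v x) x = 0 := by
        simp only [gradient, e.fderiv_eq]
        simp
      rw [this, h.eq_zero x hx hxK]
      simp

/-- The weak equation against `C¹` functions with compact support extends to test functions
vanishing off a compact subset of `U`. -/
theorem integral_inner_eq_of_subset (h : IsTestOn U K v) (hU : IsOpen U) (hK : IsCompact K)
    (hKU : K ⊆ U) {c : ℝ}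
    (hF : ∀ v : 𝔼 → ℝ, ContDiff ℝ 1 v → HasCompactSupport v → tsupport v ⊆ U →
      ∫ x in U, inner ℝ (gradient v x) (F x) = c * ∫ x in U, v x) :
    ∫ x in U, inner ℝ (gradient v x) (F x) = c * ∫ x in U, v x := by
  have heq : ∀ x ∈ U, U.indicator v =ᶠ[𝓝 x] v := fun x hx =>
    (eqOn_indicator).eventuallyEq_of_mem (hU.mem_nhds hx)
  have hts : tsupport (U.indicator v) ⊆ K := by
    refine closure_minimal (fun x hx => ?_) hK.isClosed
    by_contra hxK
    refine hx ?_
    by_cases hxU : x ∈ U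
    · rw [indicator_of_mem hxU, h.eq_zero x hxU hxK]
    · exact indicator_of_notMem hxU v
  have h1 : ContDiff ℝ 1 (U.indicator v) := by
    refine contDiff_of_contDiffAt_tsupport fun x hx => ?_
    have hxU := hKU (hts hx)
    exact (h.contDiffOn.contDiffAt (hU.mem_nhds hxU)).congr_of_eventuallyEq (heq x hxU)
  have h2 := hF _ h1 (hK.of_isClosed_subset isClosed_closure hts) (hts.trans hKU)
  rw [setIntegral_congr_fun hU.measurableSet (g := v) eqOn_indicator] at h2
  rw [← h2]
  refine setIntegral_congr_fun hU.measurableSet fun x hx => ?_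
  simp only [gradient, (heq x hx).fderiv_eq]

end IsTestOn

/-- A smooth transition from `0` on `(-∞, 1]` to `1` on `[2, ∞)`. -/
noncomputable def ramp (t : ℝ) : ℝ := Real.smoothTransition (t - 1)

theorem contDiff_ramp {n : ℕ∞} : ContDiff ℝ n ramp :=
  Real.smoothTransition.contDiff.comp (contDiff_id.sub contDiff_const)

theorem ramp_of_le {t : ℝ} (ht : t ≤ 1) : ramp t = 0 :=
  Real.smoothTransition.zero_of_nonpos (by linarith)

theorem ramp_of_ge {t : ℝ} (ht : 2 ≤ t) : ramp t = 1 :=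
  Real.smoothTransition.one_of_one_le (by linarith)

theorem norm_ramp_le (t : ℝ) : ‖ramp t‖ ≤ 1 := by
  rw [ramp, Real.norm_of_nonneg (Real.smoothTransition.nonneg _)]
  exact Real.smoothTransition.le_one _

theorem ramp_nonneg (t : ℝ) : 0 ≤ ramp t := Real.smoothTransition.nonneg _

theorem deriv_ramp_eq_zero {t : ℝ} (ht : t ∉ Icc (1 : ℝ) 2) : deriv ramp t = 0 := by
  rw [mem_Icc, not_and_or, not_le, not_le] at ht
  rcases ht with ht | ht
  · have : ramp =ᶠ[𝓝 t] fun _ => 0 := by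
      filter_upwards [gt_mem_nhds ht] with s hs using ramp_of_le hs.le
    rw [this.deriv_eq, deriv_const]
  · have : ramp =ᶠ[𝓝 t] fun _ => 1 := by
      filter_upwards [lt_mem_nhds ht] with s hs using ramp_of_ge hs.le
    rw [this.deriv_eq, deriv_const]

theorem exists_norm_deriv_ramp_le : ∃ M, 0 ≤ M ∧ ∀ t, ‖deriv ramp t‖ ≤ M := by
  have hc : Continuous (deriv ramp) := (contDiff_ramp (n := 1)).continuous_deriv le_rfl
  obtain ⟨M, hM⟩ := isCompact_Icc.exists_bound_of_continuousOn (hc.continuousOn (s := Icc 1 2))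
  refine ⟨max 0 M, le_max_left _ _, fun t => ?_⟩
  by_cases ht : t ∈ Icc (1 : ℝ) 2
  · exact (hM t ht).trans (le_max_right _ _)
  · rw [deriv_ramp_eq_zero ht, norm_zero]
    exact le_max_left _ _

theorem gradient_ramp_comp {f : 𝔼 → ℝ} {x : 𝔼} (hf : DifferentiableAt ℝ f x) :
    gradient (fun y => ramp (f y)) x = deriv ramp (f x) • gradient f x := by
  have h1 : HasDerivAt ramp (deriv ramp (f x)) (f x) :=
    ((contDiff_ramp (n := 1)).differentiable one_ne_zero _).hasDerivAt
  have h2 := h1.comp_hasFDerivAt x hf.hasFDerivAt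
  have h3 : fderiv ℝ (fun y => ramp (f y)) x = deriv ramp (f x) • fderiv ℝ f x := h2.fderiv
  simp only [gradient, h3]
  simp

theorem gradient_const_mul {f : 𝔼 → ℝ} {x : 𝔼} (hf : DifferentiableAt ℝ f x) (c : ℝ) :
    gradient (fun y => c * f y) x = c • gradient f x := by
  simp only [gradient]
  rw [fderiv_const_mul hf]
  simp

variable {S Ω : Set (EuclideanSpace ℝ (Fin N))}
  {F : EuclideanSpace ℝ (Fin N) → EuclideanSpace ℝ (Fin N)} {c : ℝ}

/-- `F` is a vector field on `S ∩ Ω`, continuous up to `Γ₁ ∖ {O}` and tangential there, with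
`-div F = c`. -/
structure IsTangentialField (S Ω : Set (EuclideanSpace ℝ (Fin N))) (c : ℝ)
    (F : EuclideanSpace ℝ (Fin N) → EuclideanSpace ℝ (Fin N)) : Prop where
  continuousOn : ContinuousOn F (regularSet S Ω)
  tangential : ∀ p ∈ gammaOne S Ω \ {0}, ∀ φ, IsLocalDefiningFunction S p φ →
    inner ℝ (gradient φ p) (F p) = 0
  weak : ∀ v : EuclideanSpace ℝ (Fin N) → ℝ, ContDiff ℝ 1 v → HasCompactSupport v →
    tsupport v ⊆ S ∩ Ω → ∫ x in S ∩ Ω, inner ℝ (gradient v x) (F x) = c * ∫ x in S ∩ Ω, v x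

/-- Multiply v by the cut-off χ_ε = `ramp` (-φ/ε), which vanishes near Γ₁, and let ε → 0. The error
carries a factor 1/ε, but it lives on a strip of volume O(ε), on which ⟨Dφ, F⟩ tends to 0 uniformly
because F is tangential on Γ₁. So the error vanishes in the limit, with no surface integral or
trace. -/
theorem IsTangentialField.integral_eq_local (hF : IsTangentialField S Ω c F) (hSo : IsOpen S)
    (hΩ : IsOpen Ω) (hΩb : Bornology.IsBounded Ω) (hS : HasC1BoundaryOffOrigin S) {p : 𝔼}
    (hp : p ∈ gammaOne S Ω \ {0}) :
    ∃ W, IsOpen W ∧ p ∈ W ∧ ∀ K ⊆ regularSet S Ω ∩ W, IsCompact K → ∀ v, IsTestOn (S ∩ Ω) K v →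
      ∫ x in S ∩ Ω, inner ℝ (gradient v x) (F x) = c * ∫ x in S ∩ Ω, v x := by
  obtain ⟨φ, hφ⟩ := exists_isLocalDefiningFunction hSo hΩ hS hp
  have hU := hSo.inter hΩ
  have hUb : Bornology.IsBounded (S ∩ Ω) := hΩb.subset inter_subset_right
  have n1 : ∀ᶠ x in 𝓝 p, ContDiffAt ℝ 1 φ x := hφ.1.eventually (by simp)
  have hgc : ContinuousAt (gradient φ) p :=
    (InnerProductSpace.toDual ℝ 𝔼).symm.continuous.continuousAt.comp
      (hφ.1.continuousAt_fderiv one_ne_zero)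
  have n2 : ∀ᶠ x in 𝓝 p, gradient φ x ≠ 0 := hgc.eventually_ne hφ.2.2.1
  have n3 := n1.and (n2.and (hφ.2.2.2.and (hφ.eventually_eq_zero hSo)))
  obtain ⟨r₁, hr₁, hr₁'⟩ := Metric.eventually_nhds_iff_ball.1 n3
  obtain ⟨r, ⟨C, hC⟩, hr0, hr⟩ := (hφ.exists_volume_strip_le.and (Ioo_mem_nhdsGT hr₁)).exists
  refine ⟨Metric.ball p r, Metric.isOpen_ball, Metric.mem_ball_self hr0, fun K hK hKc v hv => ?_⟩
  have hKR : K ⊆ regularSet S Ω := fun x hx => (hK hx).1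
  have hUR : S ∩ Ω ⊆ regularSet S Ω := subset_union_left
  have hKr₁ : ∀ x ∈ K, x ∈ Metric.ball p r₁ := fun x hx =>
    Metric.ball_subset_ball hr.le (hK hx).2
  have hφK : ∀ x ∈ K, ContDiffAt ℝ 1 φ x := fun x hx => (hr₁' x (hKr₁ x hx)).1
  have hφc : ContinuousOn φ K := fun x hx => (hφK x hx).continuousAt.continuousWithinAt
  have hφg : ContinuousOn (gradient φ) K := fun x hx =>
    ((InnerProductSpace.toDual ℝ 𝔼).symm.continuous.continuousAt.comp
      ((hφK x hx).continuousAt_fderiv one_ne_zero)).continuousWithinAt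
  -- on `K`, either `x` is an interior point and `φ x < 0`, or `x` is on `Γ₁` and `φ x = 0`
  have hcase : ∀ x ∈ K, (x ∈ S ∩ Ω ∧ φ x < 0) ∨ (φ x = 0 ∧ inner ℝ (gradient φ x) (F x) = 0) := by
    intro x hx
    obtain ⟨c1, c2, c3, c4⟩ := hr₁' x (hKr₁ x hx)
    rcases hKR hx with h | h
    · exact Or.inl ⟨h, c3.1 h.1⟩
    · have h0 := c4 (gammaOne_subset_frontier hSo hΩ h.1)
      refine Or.inr ⟨h0, hF.tangential x h φ ⟨c1, h0, c2, ?_⟩⟩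
      filter_upwards [Metric.isOpen_ball.mem_nhds (hKr₁ x hx)] with y hy
      exact (hr₁' y hy).2.2.1
  let χ : ℝ → 𝔼 → ℝ := fun ε x => ramp (-ε⁻¹ * φ x)
  have hχc : ∀ ε, ∀ x ∈ K, ContDiffAt ℝ 1 (χ ε) x := fun ε x hx =>
    (contDiff_ramp (n := 1)).contDiffAt.comp x (contDiffAt_const.mul (hφK x hx))
  -- the cut off test functions
  have hw : ∀ ε > 0, ∫ x in S ∩ Ω, inner ℝ (gradient (fun y => χ ε y * v y) x) (F x)
      = c * ∫ x in S ∩ Ω, χ ε x * v x := by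
    intro ε hε
    have hcl : IsCompact (K ∩ φ ⁻¹' Iic (-ε)) :=
      hKc.of_isClosed_subset (hφc.preimage_isClosed_of_isClosed hKc.isClosed isClosed_Iic)
        inter_subset_left
    refine IsTestOn.integral_inner_eq_of_subset (K := K ∩ φ ⁻¹' Iic (-ε)) ?_ hU hcl ?_ hF.weak
    · refine hv.mul hU hKc (hχc ε) fun x hx hx' => ramp_of_le ?_
      have h1 : -ε < φ x := by
        by_contra! h
        exact hx' ⟨hx.2, h⟩
      rw [neg_mul, neg_le, le_inv_mul_iff₀ hε]
      linarith
    · rintro x ⟨hx, hxε⟩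
      rcases hcase x hx with h | h
      · exact h.1
      · have : φ x ≤ -ε := hxε
        linarith [h.1]
  obtain ⟨C₁, hC₁⟩ := hv.bdd
  obtain ⟨M, hM0, hM⟩ := exists_norm_deriv_ramp_le
  -- the error term
  have herr : ∀ η > 0, ∀ᶠ ε in 𝓝[>] (0 : ℝ),
      ‖∫ x in S ∩ Ω, (inner ℝ (gradient (fun y => χ ε y * v y) x) (F x)
        - χ ε x * inner ℝ (gradient v x) (F x))‖ ≤ |C₁| * M * |C| * η := by
    intro η hη
    -- Uniform smallness by compactness: where |⟨Dφ, F⟩| ≥ η on K, the point is not on Γ₁, so φ is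
    -- negative there and its maximum over this compact set is negative.
    obtain ⟨δ, hδ, hδ'⟩ : ∃ δ > 0, ∀ x ∈ K, -δ < φ x → |inner ℝ (gradient φ x) (F x)| < η := by
      set K₁ := K ∩ (fun x => |inner ℝ (gradient φ x) (F x)|) ⁻¹' Ici η with hK₁
      have hK₁c : IsCompact K₁ := hKc.of_isClosed_subset
        (((hφg.inner (𝕜 := ℝ) (hF.continuousOn.mono hKR)).abs).preimage_isClosed_of_isClosed
          hKc.isClosed isClosed_Ici) inter_subset_left
      rcases K₁.eq_empty_or_nonempty with h | h
      · refine ⟨1, one_pos, fun x hx _ => ?_⟩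
        by_contra! h'
        exact (h ▸ (⟨hx, h'⟩ : x ∈ K₁) : x ∈ (∅ : Set 𝔼))
      · obtain ⟨z, hz, hmax⟩ := hK₁c.exists_isMaxOn h (hφc.mono inter_subset_left)
        have hz0 : φ z < 0 := by
          rcases hcase z hz.1 with h | h
          · exact h.2
          · have : η ≤ |inner ℝ (gradient φ z) (F z)| := hz.2
            rw [h.2, abs_zero] at this
            linarith
        refine ⟨-φ z, by linarith, fun x hx hxz => ?_⟩
        by_contra! h'
        have : φ x ≤ φ z := hmax ⟨hx, h'⟩
        linarith
    filter_upwards [Ioo_mem_nhdsGT (show 0 < δ / 2 by positivity)] with ε hε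
    have hε0 : 0 < ε := hε.1
    set A := Metric.closedBall p r ∩ φ ⁻¹' Icc (-2 * ε) (-ε) with hA
    -- The product rule leaves the term with Dχ_ε, which is nonzero only where -2ε ≤ φ ≤ -ε.
    have hdiff : ∀ x ∈ S ∩ Ω, x ∈ K → inner ℝ (gradient (fun y => χ ε y * v y) x) (F x)
        - χ ε x * inner ℝ (gradient v x) (F x)
        = v x * (deriv ramp (-ε⁻¹ * φ x) * (-ε⁻¹ * inner ℝ (gradient φ x) (F x))) := by
      intro x hx hxK
      have hd := (hφK x hxK).differentiableAt one_ne_zero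
      rw [hv.gradient_mul_of_mem hU (hχc ε x hxK) hx, gradient_ramp_comp (hd.const_mul _),
        gradient_const_mul hd]
      simp only [inner_add_left, real_inner_smul_left]
      ring
    have hzero : ∀ x ∈ S ∩ Ω, x ∉ (S ∩ Ω) ∩ (K ∩ A) →
        inner ℝ (gradient (fun y => χ ε y * v y) x) (F x)
        - χ ε x * inner ℝ (gradient v x) (F x) = 0 := by
      intro x hx hxA
      by_cases hxK : x ∈ K
      · rw [hdiff x hx hxK, deriv_ramp_eq_zero]
        · simp
        · intro ht
          refine hxA ⟨hx, hxK, Metric.ball_subset_closedBall (hK hxK).2, ?_⟩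
          obtain ⟨t1, t2⟩ := ht
          rw [neg_mul, le_neg, inv_mul_le_iff₀ hε0] at t1
          rw [neg_mul, neg_le, le_inv_mul_iff₀ hε0] at t2
          exact ⟨by linarith, by linarith⟩
      · have h1 := (hv.mul hU hKc (hχc ε) (K' := K) fun x hx hx' => absurd hx.2 hx')
        rw [h1.gradient_eq_zero hU hKc hx hxK, hv.gradient_eq_zero hU hKc hx hxK]
        simp
    rw [setIntegral_eq_of_subset_of_forall_sdiff_eq_zero hU.measurableSet
      (inter_subset_left (t := K ∩ A)) fun x hx => hzero x hx.1 hx.2]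
    have hAfin : volume (S ∩ Ω ∩ (K ∩ A)) < ⊤ :=
      (measure_mono inter_subset_left).trans_lt hUb.measure_lt_top
    refine (norm_setIntegral_le_of_norm_le_const (C := |C₁| * (M * (ε⁻¹ * η))) hAfin ?_).trans ?_
    · rintro x ⟨hx, hxK, hxA⟩
      rw [hdiff x hx hxK, norm_mul, norm_mul, norm_mul, norm_neg, norm_inv,
        Real.norm_of_nonneg hε0.le]
      have b1 := (hC₁ x hx).1.trans (le_abs_self _)
      have b2 := hM (-ε⁻¹ * φ x)
      have b3 : ‖inner ℝ (gradient φ x) (F x)‖ ≤ η :=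
        (hδ' x hxK (by linarith [hxA.2.1, hε.2])).le
      gcongr
    · have h1 : volume.real (S ∩ Ω ∩ (K ∩ A)) ≤ |C| * ε := by
        refine (measureReal_mono (inter_subset_right.trans inter_subset_right) ?_).trans
          ((hC ε hε0).trans (by gcongr; exact le_abs_self C))
        exact ((measure_mono inter_subset_left).trans_lt measure_closedBall_lt_top).ne
      calc |C₁| * (M * (ε⁻¹ * η)) * volume.real (S ∩ Ω ∩ (K ∩ A))
          ≤ |C₁| * (M * (ε⁻¹ * η)) * (|C| * ε) := by gcongr
        _ = |C₁| * M * |C| * η := by field_simp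
  have hvi := hv.integrableOn hU hUb
  have hgi := hv.integrableOn_inner hU hUb hKc hF.continuousOn hUR hKR
  have hχm : ∀ ε, AEStronglyMeasurable (fun x => χ ε x * v x) (volume.restrict (S ∩ Ω)) :=
    fun ε => ((hv.mul hU hKc (hχc ε) (K' := K)
      fun x hx hx' => absurd hx.2 hx').integrableOn hU hUb).1
  -- pointwise convergence of the cut off
  have hlim : ∀ x ∈ K, x ∈ S ∩ Ω → ∀ᶠ ε in 𝓝[>] (0 : ℝ), χ ε x = 1 := by
    intro x hx hxU
    have hneg : φ x < 0 := (hr₁' x (hKr₁ x hx)).2.2.1.1 hxU.1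
    filter_upwards [Ioo_mem_nhdsGT (show 0 < -φ x / 2 by linarith)] with ε hε
    refine ramp_of_ge ?_
    rw [neg_mul, le_neg, inv_mul_le_iff₀ hε.1]
    linarith [hε.2]
  have l1 : Tendsto (fun ε => ∫ x in S ∩ Ω, χ ε x * v x) (𝓝[>] 0) (𝓝 (∫ x in S ∩ Ω, v x)) := by
    refine tendsto_integral_filter_of_dominated_convergence (fun x => ‖v x‖)
      (Eventually.of_forall hχm) (Eventually.of_forall fun ε => Eventually.of_forall fun x => ?_)
      hvi.norm ?_
    · rw [norm_mul]
      exact mul_le_of_le_one_left (norm_nonneg _) (norm_ramp_le _)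
    · filter_upwards [ae_restrict_mem hU.measurableSet] with x hx
      refine tendsto_const_nhds.congr' ?_
      by_cases hxK : x ∈ K
      · filter_upwards [hlim x hxK hx] with ε hε
        rw [hε, one_mul]
      · filter_upwards with ε
        rw [hv.eq_zero x hx hxK, mul_zero]
  have hint : ∀ ε, IntegrableOn (fun x => inner ℝ (gradient (fun y => χ ε y * v y) x) (F x))
      (S ∩ Ω) := fun ε => (hv.mul hU hKc (hχc ε) (K' := K)
      fun x hx hx' => absurd hx.2 hx').integrableOn_inner hU hUb hKc hF.continuousOn hUR hKR
  have hm2 : ∀ ε, AEStronglyMeasurable (fun x => χ ε x * inner ℝ (gradient v x) (F x))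
      (volume.restrict (S ∩ Ω)) := by
    intro ε
    refine ContinuousOn.aestronglyMeasurable (fun x hx => ?_) hU.measurableSet
    have hgc := ((hv.contDiffOn.continuousOn_gradient hU).inner (𝕜 := ℝ)
      (hF.continuousOn.mono hUR)) x hx
    by_cases hxK : x ∈ K
    · exact (hχc ε x hxK).continuousAt.continuousWithinAt.mul hgc
    · have e : (fun x => χ ε x * inner ℝ (gradient v x) (F x)) =ᶠ[𝓝 x] fun _ => 0 := by
        filter_upwards [hU.mem_nhds hx, hKc.isClosed.isOpen_compl.mem_nhds hxK] with y hy hyK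
        rw [hv.gradient_eq_zero hU hKc hy hyK, inner_zero_left, mul_zero]
      exact (continuousAt_const.congr e.symm).continuousWithinAt
  have hint2 : ∀ ε, IntegrableOn (fun x => χ ε x * inner ℝ (gradient v x) (F x)) (S ∩ Ω) :=
    fun ε => hgi.norm.mono' (hm2 ε) (Eventually.of_forall fun x => by
      rw [norm_mul]
      exact mul_le_of_le_one_left (norm_nonneg _) (norm_ramp_le _))
  have l2 : Tendsto (fun ε => ∫ x in S ∩ Ω, χ ε x * inner ℝ (gradient v x) (F x)) (𝓝[>] 0)
      (𝓝 (∫ x in S ∩ Ω, inner ℝ (gradient v x) (F x))) := by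
    refine tendsto_integral_filter_of_dominated_convergence
      (fun x => ‖inner ℝ (gradient v x) (F x)‖) (Eventually.of_forall hm2)
      (Eventually.of_forall fun ε => Eventually.of_forall fun x => ?_) hgi.norm ?_
    · rw [norm_mul]
      exact mul_le_of_le_one_left (norm_nonneg _) (norm_ramp_le _)
    · filter_upwards [ae_restrict_mem hU.measurableSet] with x hx
      refine tendsto_const_nhds.congr' ?_
      by_cases hxK : x ∈ K
      · filter_upwards [hlim x hxK hx] with ε hε
        rw [hε, one_mul]
      · filter_upwards with ε
        rw [hv.gradient_eq_zero hU hKc hx hxK, inner_zero_left, mul_zero]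
  have l3 : Tendsto (fun ε => ∫ x in S ∩ Ω, (inner ℝ (gradient (fun y => χ ε y * v y) x) (F x)
        - χ ε x * inner ℝ (gradient v x) (F x))) (𝓝[>] 0) (𝓝 0) := by
    rw [Metric.tendsto_nhds]
    intro κ hκ
    have hpos : 0 < |C₁| * M * |C| + 1 := by positivity
    filter_upwards [herr (κ / (|C₁| * M * |C| + 1)) (by positivity)] with ε hε
    rw [dist_zero_right]
    refine hε.trans_lt ?_
    rw [mul_div_assoc', div_lt_iff₀ hpos]
    nlinarith
  have l4 := l3.add l2
  rw [zero_add] at l4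
  refine tendsto_nhds_unique l4 ((l1.const_mul c).congr' ?_)
  filter_upwards [self_mem_nhdsWithin] with ε hε
  rw [integral_sub (hint ε) (hint2 ε), sub_add_cancel, hw ε hε]

/-- The weak equation for a tangential field holds for test functions that do not vanish
on `Γ₁ ∖ {O}`. -/
theorem IsTangentialField.integral_eq (hF : IsTangentialField S Ω c F) (hSo : IsOpen S)
    (hΩ : IsOpen Ω) (hΩb : Bornology.IsBounded Ω) (hS : HasC1BoundaryOffOrigin S) {K : Set 𝔼}
    (hK : IsCompact K) (hKR : K ⊆ regularSet S Ω) {v : 𝔼 → ℝ} (hv : IsTestOn (S ∩ Ω) K v) :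
    ∫ x in S ∩ Ω, inner ℝ (gradient v x) (F x) = c * ∫ x in S ∩ Ω, v x := by
  have hU := hSo.inter hΩ
  have hUb : Bornology.IsBounded (S ∩ Ω) := hΩb.subset inter_subset_right
  have hUR : S ∩ Ω ⊆ regularSet S Ω := subset_union_left
  have hloc : ∀ p : K, ∃ W, IsOpen W ∧ (p : 𝔼) ∈ W ∧ ∀ K ⊆ regularSet S Ω ∩ W, IsCompact K →
      ∀ v, IsTestOn (S ∩ Ω) K v →
      ∫ x in S ∩ Ω, inner ℝ (gradient v x) (F x) = c * ∫ x in S ∩ Ω, v x := by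
    intro p
    rcases hKR p.2 with h | h
    · exact ⟨S ∩ Ω, hU, h, fun K hK hKc v hv =>
        hv.integral_inner_eq_of_subset hU hKc (fun x hx => (hK hx).2) hF.weak⟩
    · exact hF.integral_eq_local hSo hΩ hΩb hS h
  choose W hWo hpW hW using hloc
  obtain ⟨t, ht⟩ := hK.elim_finite_subcover W hWo fun x hx => mem_iUnion.2 ⟨⟨x, hx⟩, hpW ⟨x, hx⟩⟩
  -- Each piece f i * v vanishes off a compact part of one neighbourhood in which the equation is
  -- known; both sides are linear in v.
  obtain ⟨f, hf⟩ := SmoothPartitionOfUnity.exists_isSubordinate (modelWithCornersSelf ℝ 𝔼)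
    hK.isClosed (fun i : t => W i) (fun i => hWo i) (fun x hx => by
      obtain ⟨i, hi, hxi⟩ := mem_iUnion₂.1 (ht hx)
      exact mem_iUnion.2 ⟨⟨i, hi⟩, hxi⟩)
  have hfc : ∀ i, ContDiff ℝ 1 (f i) := fun i =>
    ((f i).contMDiff.contDiff).of_le (by exact_mod_cast le_top)
  have hsum : ∀ x ∈ K, ∑ i, f i x = 1 := fun x hx => by
    rw [← finsum_eq_sum_of_fintype]
    exact f.sum_eq_one hx
  have htest : ∀ i, IsTestOn (S ∩ Ω) (K ∩ tsupport (f i)) (fun x => f i x * v x) := fun i =>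
    hv.mul hU hK (fun x _ => (hfc i).contDiffAt) fun x hx hx' =>
      image_eq_zero_of_notMem_tsupport fun h => hx' ⟨hx.2, h⟩
  have hKi : ∀ i, IsCompact (K ∩ tsupport (f i)) := fun i => hK.inter_right isClosed_closure
  have heach : ∀ i, ∫ x in S ∩ Ω, inner ℝ (gradient (fun y => f i y * v y) x) (F x)
      = c * ∫ x in S ∩ Ω, f i x * v x := fun i =>
    hW i _ (fun x hx => ⟨hKR hx.1, hf i hx.2⟩) (hKi i) _ (htest i)
  have hv1 : ∀ x ∈ S ∩ Ω, v x = ∑ i, f i x * v x := by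
    intro x hx
    by_cases hxK : x ∈ K
    · rw [← Finset.sum_mul, hsum x hxK, one_mul]
    · simp [hv.eq_zero x hx hxK]
  have hv2 : ∀ x ∈ S ∩ Ω, gradient v x = ∑ i, gradient (fun y => f i y * v y) x := by
    intro x hx
    have e : v =ᶠ[𝓝 x] fun y => ∑ i, f i y * v y := by
      filter_upwards [hU.mem_nhds hx] with y hy using hv1 y hy
    have hd : ∀ i ∈ Finset.univ, DifferentiableAt ℝ (fun y => f i y * v y) x := fun i _ =>
      ((htest i).contDiffOn.contDiffAt (hU.mem_nhds hx)).differentiableAt one_ne_zero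
    simp only [gradient]
    rw [e.fderiv_eq, fderiv_fun_sum hd, map_sum]
  rw [setIntegral_congr_fun hU.measurableSet (g := fun x =>
      ∑ i, inner ℝ (gradient (fun y => f i y * v y) x) (F x)) fun x hx => by
        simp only [hv2 x hx, sum_inner],
    setIntegral_congr_fun hU.measurableSet hv1, integral_finsetSum, integral_finsetSum,
    Finset.mul_sum]
  · exact Finset.sum_congr rfl fun i _ => heach i
  · exact fun i _ => (htest i).integrableOn hU hUb
  · exact fun i _ => (htest i).integrableOn_inner hU hUb (hKi i) hF.continuousOn hUR
      (inter_subset_left.trans hKR)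

end ConeWulff

/-! ### The weak maximum principle, with the vertex removed by capacity. -/

namespace ConeWulff

variable {N : ℕ}

local notation "𝔼" => EuclideanSpace ℝ (Fin N)

variable {S Ω : Set (EuclideanSpace ℝ (Fin N))}

theorem hasDerivAt_expNegInvGlue (t : ℝ) :
    HasDerivAt expNegInvGlue (t⁻¹ ^ 2 * expNegInvGlue t) t := by
  simpa using expNegInvGlue.hasDerivAt_polynomial_eval_inv_mul 1 t

theorem expNegInvGlue_le_one (t : ℝ) : expNegInvGlue t ≤ 1 := by
  rw [expNegInvGlue]
  split_ifs with h
  · exact zero_le_one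
  · rw [Real.exp_le_one_iff, neg_nonpos]
    exact inv_nonneg.2 (le_of_not_ge h)

/-- The gradient of f extends continuously to Γ₁ ∖ {O}, so it is bounded on the compact set K even
where K reaches Γ₁. -/
theorem IsTestOn.of_contDiffOn {f : 𝔼 → ℝ} {K : Set 𝔼} (hSo : IsOpen S) (hΩ : IsOpen Ω)
    (hS : HasC1BoundaryOffOrigin S) (hf : ContDiffOn ℝ 1 f (regularSet S Ω)) (hK : IsCompact K)
    (hKR : K ⊆ regularSet S Ω) (h0 : ∀ x ∈ S ∩ Ω, x ∉ K → f x = 0) : IsTestOn (S ∩ Ω) K f := by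
  have hU := hSo.inter hΩ
  refine ⟨hf.mono subset_union_left, h0, ?_⟩
  obtain ⟨C₁, hC₁⟩ := hK.exists_bound_of_continuousOn (hf.continuousOn.mono hKR)
  obtain ⟨C₂, hC₂⟩ := hK.exists_bound_of_continuousOn
    ((hS.continuousOn_gradientWithin hSo hΩ hf).mono hKR)
  refine ⟨max 0 (max C₁ C₂), fun x hx => ?_⟩
  by_cases hxK : x ∈ K
  · rw [(hasGradientAt_of_mem_inter hSo hΩ hf hx).gradient]
    exact ⟨(hC₁ x hxK).trans (le_max_of_le_right (le_max_left _ _)),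
      (hC₂ x hxK).trans (le_max_of_le_right (le_max_right _ _))⟩
  · have e : f =ᶠ[𝓝 x] 0 := by
      filter_upwards [hU.mem_nhds hx, hK.isClosed.isOpen_compl.mem_nhds hxK] with y hy hyK
      exact h0 y hy hyK
    have : gradient f x = 0 := by
      simp only [gradient, e.fderiv_eq]
      simp
    rw [this, h0 x hx hxK]
    simp

theorem closure_gammaZero_subset_closure (hSo : IsOpen S) :
    closure (gammaZero S Ω) ⊆ closure (S ∩ Ω) := by
  refine closure_minimal (fun x hx => ?_) isClosed_closure
  rw [mem_closure_iff_nhds]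
  intro t ht
  obtain ⟨y, hy, hyΩ⟩ := mem_closure_iff_nhds.1 (frontier_subset_closure hx.2) (t ∩ S)
    (inter_mem ht (hSo.mem_nhds hx.1))
  exact ⟨y, hy.1, hy.2, hyΩ⟩

/-- The ray through a point of `S ∩ Ω` leaves `Ω` through `Γ₀`. -/
theorem exists_smul_mem_gammaZero (hSc : ∀ x ∈ S, ∀ t : ℝ, 0 < t → t • x ∈ S) (hS0 : (0 : 𝔼) ∉ S)
    (hΩ : IsOpen Ω) (hΩb : Bornology.IsBounded Ω) {x : 𝔼} (hx : x ∈ S ∩ Ω) :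
    ∃ t : ℝ, 1 < t ∧ t • x ∈ gammaZero S Ω ∧ ∀ s ∈ Ico 1 t, s • x ∈ S ∩ Ω := by
  have hx0 : 0 < ‖x‖ := norm_pos_iff.2 fun h => hS0 (h ▸ hx.1)
  obtain ⟨M, hM0, hM⟩ := hΩb.exists_pos_norm_le
  have hcont : Continuous fun s : ℝ => s • x := by fun_prop
  set T := Icc 1 (2 + M / ‖x‖) ∩ (fun s : ℝ => s • x) ⁻¹' Ωᶜ with hT
  have hTc : IsCompact T := isCompact_Icc.inter_right (hΩ.isClosed_compl.preimage hcont)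
  have hTn : T.Nonempty := by
    refine ⟨2 + M / ‖x‖, ⟨by have : 0 ≤ M / ‖x‖ := by positivity
                             linarith, le_rfl⟩, fun h => ?_⟩
    have h1 := hM _ h
    have h2 : 0 ≤ 2 + M / ‖x‖ := by positivity
    rw [norm_smul, Real.norm_of_nonneg h2, add_mul, div_mul_cancel₀ _ hx0.ne'] at h1
    linarith
  obtain ⟨t, ht, hmin⟩ := hTc.exists_isLeast hTn
  have hlt : ∀ s ∈ Ico 1 t, s • x ∈ S ∩ Ω := by
    intro s hs
    refine ⟨hSc x hx.1 s (by linarith [hs.1]), ?_⟩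
    by_contra h
    have := hmin ⟨⟨hs.1, hs.2.le.trans ht.1.2⟩, h⟩
    linarith [hs.2]
  have h1t : 1 < t := by
    refine lt_of_le_of_ne ht.1.1 fun h => ht.2 ?_
    rw [← h]
    simpa using hx.2
  refine ⟨t, h1t, ⟨hSc x hx.1 t (by linarith), ?_⟩, hlt⟩
  rw [hΩ.frontier_eq]
  refine ⟨?_, ht.2⟩
  have h2 : t ∈ closure (Ico 1 t) := by
    rw [closure_Ico h1t.ne]
    exact ⟨h1t.le, le_rfl⟩
  have h3 := mem_closure_image hcont.continuousAt h2
  refine closure_mono ?_ h3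
  rintro _ ⟨s, hs, rfl⟩
  exact (hlt s hs).2

/-- A point of the cone outside `Ω` has `Γ₀` between itself and the origin. -/
theorem exists_smul_mem_gammaZero_of_notMem (hSc : ∀ x ∈ S, ∀ t : ℝ, 0 < t → t • x ∈ S)
    (hΩ : IsOpen Ω) (hΩ0 : (0 : 𝔼) ∈ Ω) {x : 𝔼} (hx : x ∈ S) (hxΩ : x ∉ Ω) :
    ∃ t : ℝ, 0 < t ∧ t ≤ 1 ∧ t • x ∈ gammaZero S Ω := by
  by_contra! h
  refine hxΩ (hΩ.mem_of_segment_disjoint_frontier hΩ0 fun z hz hzf => ?_)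
  rw [segment_eq_image'] at hz
  obtain ⟨θ, hθ, rfl⟩ := hz
  simp only [sub_zero, zero_add] at hzf
  rcases hθ.1.eq_or_lt with h0 | h0
  · rw [← h0, zero_smul, hΩ.frontier_eq] at hzf
    exact hzf.2 hΩ0
  · exact h θ h0 hθ.2 ⟨hSc x hx θ h0, hzf⟩

/-- A cut-off function vanishing near the origin. -/
noncomputable def originCutoff (N j : ℕ) (x : EuclideanSpace ℝ (Fin N)) : ℝ :=
  ramp ((j : ℝ) ^ 2 * ‖x‖ ^ 2)

theorem contDiff_originCutoff (j : ℕ) : ContDiff ℝ 1 (originCutoff N j) :=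
  (contDiff_ramp (n := 1)).comp (contDiff_const.mul (contDiff_norm_sq ℝ))

theorem gradient_originCutoff (j : ℕ) (x : 𝔼) : gradient (originCutoff N j) x
    = (deriv ramp ((j : ℝ) ^ 2 * ‖x‖ ^ 2) * (2 * (j : ℝ) ^ 2)) • x := by
  have hd : Differentiable ℝ fun x : 𝔼 => ‖x‖ ^ 2 :=
    (contDiff_norm_sq ℝ (n := 1)).differentiable one_ne_zero
  have h1 : gradient (fun x : 𝔼 => ‖x‖ ^ 2) x = (2 : ℝ) • x := by
    refine HasGradientAt.gradient ?_
    rw [hasGradientAt_iff_hasFDerivAt]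
    refine (hasStrictFDerivAt_norm_sq x).hasFDerivAt.congr_fderiv ?_
    ext y
    simp
  have h2 := gradient_ramp_comp (f := fun x : 𝔼 => (j : ℝ) ^ 2 * ‖x‖ ^ 2) ((hd x).const_mul _)
  rw [gradient_const_mul (hd x), h1, smul_smul, smul_smul] at h2
  rw [mul_comm 2, ← mul_assoc]
  exact h2

/-- The cut-off changes from 0 to 1 at distance of order 1/j, so its gradient is O(j) and vanishes
off the ball of radius 2/j. -/
theorem exists_norm_gradient_originCutoff_le (N : ℕ) : ∃ M, 0 ≤ M ∧ ∀ j : ℕ, 0 < j →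
    ∀ x : EuclideanSpace ℝ (Fin N), ‖gradient (originCutoff N j) x‖ ≤ M * j ∧
      (x ∉ Metric.closedBall 0 (2 / (j : ℝ)) → gradient (originCutoff N j) x = 0) := by
  obtain ⟨M, hM0, hM⟩ := exists_norm_deriv_ramp_le
  refine ⟨M * 4, by positivity, fun j hj x => ?_⟩
  have hj' : (0 : ℝ) < j := by exact_mod_cast hj
  rw [gradient_originCutoff]
  have hout : 2 / (j : ℝ) < ‖x‖ → deriv ramp ((j : ℝ) ^ 2 * ‖x‖ ^ 2) = 0 := by
    intro h
    refine deriv_ramp_eq_zero fun ht => ?_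
    rw [div_lt_iff₀ hj'] at h
    nlinarith [ht.2]
  refine ⟨?_, fun h => ?_⟩
  · rcases lt_or_ge (2 / (j : ℝ)) ‖x‖ with h | h
    · rw [hout h, zero_mul, zero_smul, norm_zero]
      positivity
    · rw [norm_smul, norm_mul, Real.norm_of_nonneg (show 0 ≤ 2 * (j : ℝ) ^ 2 by positivity)]
      calc ‖deriv ramp ((j : ℝ) ^ 2 * ‖x‖ ^ 2)‖ * (2 * (j : ℝ) ^ 2) * ‖x‖
          ≤ M * (2 * (j : ℝ) ^ 2) * (2 / j) := by
            gcongr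
            exact hM _
        _ = M * 4 * j := by field_simp; norm_num
  · rw [hout (by simpa using h), zero_mul, zero_smul]

theorem originCutoff_eq_zero {j : ℕ} (hj : 0 < j) {x : 𝔼} (hx : ‖x‖ < 1 / (j : ℝ)) :
    originCutoff N j x = 0 := by
  have hj' : (0 : ℝ) < j := by exact_mod_cast hj
  refine ramp_of_le ?_
  rw [lt_div_iff₀ hj'] at hx
  have : 0 ≤ ‖x‖ * j := by positivity
  nlinarith

theorem originCutoff_eq_one {j : ℕ} (hj : 0 < j) {x : 𝔼} (hx : 2 / (j : ℝ) ≤ ‖x‖) :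
    originCutoff N j x = 1 := by
  have hj' : (0 : ℝ) < j := by exact_mod_cast hj
  refine ramp_of_ge ?_
  rw [div_le_iff₀ hj'] at hx
  nlinarith

/-- Mass of a square integrable field near the origin, tested against the gradients of the
cut-off functions. This is where `2 ≤ N` is needed. -/
theorem exists_integral_cutoff_le (hN : 2 ≤ N) {U : Set 𝔼} (hUb : Bornology.IsBounded U)
    {G : 𝔼 → 𝔼} (hG : MemLp G 2 (volume.restrict U)) {κ : ℝ} (hκ : 0 < κ) :
    ∀ᶠ j : ℕ in atTop, IntegrableOn (fun x => ‖gradient (originCutoff N j) x‖ * ‖G x‖) U ∧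
      ∫ x in U, ‖gradient (originCutoff N j) x‖ * ‖G x‖ ≤ κ := by
  obtain ⟨M, hM0, hM⟩ := exists_norm_gradient_originCutoff_le N
  have hfin : IsFiniteMeasure (volume.restrict U) :=
    ⟨by rw [Measure.restrict_apply_univ]; exact hUb.measure_lt_top⟩
  have hG2 : Integrable (fun x => ‖G x‖ ^ 2) (volume.restrict U) := hG.integrable_norm_pow two_ne_zero
  have hG1 : Integrable G (volume.restrict U) := hG.integrable (by norm_num)
  set V := volume.real (Metric.closedBall (0 : 𝔼) 1) with hV
  set μ := volume.restrict U with hμ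
  let B : ℕ → Set 𝔼 := fun j => Metric.closedBall 0 (2 / (j : ℝ))
  have hBvol : ∀ j : ℕ, volume.real (B j) = (2 / (j : ℝ)) ^ N * V := fun j => by
    have := Measure.addHaar_real_closedBall' (volume : Measure 𝔼) 0
      (show (0 : ℝ) ≤ 2 / (j : ℝ) by positivity)
    rw [this, finrank_euclideanSpace_fin]
  have hμB : ∀ j, μ.real (B j) ≤ volume.real (B j) := fun j =>
    ENNReal.toReal_mono measure_closedBall_lt_top.ne (Measure.restrict_apply_le _ _)
  -- The squared gradient of the cut-off is O(j²) on a ball of volume O(j⁻ᴺ), so its integral stays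
  -- bounded for N ≥ 2. The smallness then comes from the L² mass of G on the shrinking balls.
  have hjj : ∀ j : ℕ, 0 < j → (j : ℝ) ^ 2 * μ.real (B j) ≤ 2 ^ N * V := by
    intro j hj
    have hj' : (1 : ℝ) ≤ j := by exact_mod_cast hj
    have h1 : (j : ℝ) ^ 2 ≤ (j : ℝ) ^ N := pow_le_pow_right₀ hj' hN
    calc (j : ℝ) ^ 2 * μ.real (B j) ≤ (j : ℝ) ^ N * ((2 / (j : ℝ)) ^ N * V) := by
          rw [← hBvol]
          gcongr
          exact hμB j
      _ = 2 ^ N * V := by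
          rw [div_pow]
          field_simp
  have hB0 : Tendsto (μ ∘ B) atTop (𝓝 0) := by
    have h1 : Tendsto (fun j : ℕ => (2 ^ N * V) / (j : ℝ) ^ 2) atTop (𝓝 0) :=
      Tendsto.div_atTop tendsto_const_nhds
        ((tendsto_pow_atTop two_ne_zero).comp tendsto_natCast_atTop_atTop)
    have h2 : Tendsto (fun j => μ.real (B j)) atTop (𝓝 0) := by
      refine squeeze_zero' (Eventually.of_forall fun j => measureReal_nonneg) ?_ h1
      filter_upwards [eventually_gt_atTop 0] with j hj
      have hj' : (0 : ℝ) < j := by exact_mod_cast hj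
      rw [le_div_iff₀ (by positivity), mul_comm]
      exact hjj j hj
    have h3 := ENNReal.tendsto_ofReal h2
    rw [ENNReal.ofReal_zero] at h3
    refine h3.congr fun j => ?_
    rw [ofReal_measureReal]
    rfl
  have hI := hG2.tendsto_setIntegral_nhds_zero hB0
  -- choice of the weight in the arithmetic-geometric mean inequality
  set τ := κ / (2 * (M + 1) * (2 ^ N * V + 1)) with hτ
  have hV0 : 0 ≤ V := measureReal_nonneg
  have hτ0 : 0 < τ := by positivity
  have hsmall : ∀ᶠ j in atTop, ∫ x in B j, ‖G x‖ ^ 2 ∂μ < τ * (κ / (2 * (M + 1))) :=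
    hI.eventually (gt_mem_nhds (by positivity))
  filter_upwards [hsmall, eventually_gt_atTop 0] with j hj hj0
  have hmeas : AEStronglyMeasurable (fun x => ‖gradient (originCutoff N j) x‖ * ‖G x‖) μ :=
    (continuous_gradient (contDiff_originCutoff j)).norm.aestronglyMeasurable.mul hG1.1.norm
  have hint : Integrable (fun x => ‖gradient (originCutoff N j) x‖ * ‖G x‖) μ := by
    refine (hG1.norm.const_mul (M * j)).mono' hmeas (Eventually.of_forall fun x => ?_)
    rw [Real.norm_of_nonneg (by positivity)]
    gcongr
    exact (hM j hj0 x).1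
  refine ⟨hint, ?_⟩
  have e1 : ∫ x, ‖gradient (originCutoff N j) x‖ * ‖G x‖ ∂μ
      = ∫ x in B j, ‖gradient (originCutoff N j) x‖ * ‖G x‖ ∂μ := by
    refine (setIntegral_eq_integral_of_forall_compl_eq_zero fun x hx => ?_).symm
    rw [(hM j hj0 x).2 hx, norm_zero, zero_mul]
  have hBi : IntegrableOn (fun _ => τ * (j : ℝ) ^ 2) (B j) μ := integrableOn_const (by
    exact (measure_lt_top μ _).ne)
  have hle : ∫ x in B j, ‖gradient (originCutoff N j) x‖ * ‖G x‖ ∂μ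
      ≤ ∫ x in B j, M * (τ * (j : ℝ) ^ 2 + τ⁻¹ * ‖G x‖ ^ 2) ∂μ := by
    refine setIntegral_mono hint.integrableOn
      ((hBi.add (hG2.integrableOn.const_mul τ⁻¹)).const_mul M) fun x => ?_
    have h1 : (j : ℝ) * ‖G x‖ ≤ τ * (j : ℝ) ^ 2 + τ⁻¹ * ‖G x‖ ^ 2 := by
      have h2 : τ * (j : ℝ) ^ 2 + τ⁻¹ * ‖G x‖ ^ 2 - (j : ℝ) * ‖G x‖
          = τ⁻¹ * ((τ * j - ‖G x‖ / 2) ^ 2 + 3 / 4 * ‖G x‖ ^ 2) := by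
        field_simp
        ring
      have h3 : 0 ≤ τ⁻¹ * ((τ * j - ‖G x‖ / 2) ^ 2 + 3 / 4 * ‖G x‖ ^ 2) := by positivity
      linarith
    calc ‖gradient (originCutoff N j) x‖ * ‖G x‖ ≤ M * j * ‖G x‖ := by
          gcongr
          exact (hM j hj0 x).1
      _ ≤ _ := by
          rw [mul_assoc]
          gcongr
  have e2 : ∫ x in B j, M * (τ * (j : ℝ) ^ 2 + τ⁻¹ * ‖G x‖ ^ 2) ∂μ
      = M * (τ * ((j : ℝ) ^ 2 * μ.real (B j)) + τ⁻¹ * ∫ x in B j, ‖G x‖ ^ 2 ∂μ) := by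
    rw [integral_const_mul, integral_add hBi (hG2.integrableOn.const_mul τ⁻¹),
      integral_const_mul τ⁻¹, setIntegral_const, smul_eq_mul]
    ring
  rw [e1]
  refine hle.trans ?_
  rw [e2]
  have b1 : τ * ((j : ℝ) ^ 2 * μ.real (B j)) ≤ κ / (2 * (M + 1)) := by
    calc τ * ((j : ℝ) ^ 2 * μ.real (B j)) ≤ τ * (2 ^ N * V + 1) := by
          gcongr
          linarith [hjj j hj0]
      _ = κ / (2 * (M + 1)) := by
          rw [hτ]
          field_simp
  have b2 : τ⁻¹ * ∫ x in B j, ‖G x‖ ^ 2 ∂μ ≤ κ / (2 * (M + 1)) := by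
    rw [inv_mul_le_iff₀ hτ0]
    exact hj.le
  calc M * (τ * ((j : ℝ) ^ 2 * μ.real (B j)) + τ⁻¹ * ∫ x in B j, ‖G x‖ ^ 2 ∂μ)
      ≤ (M + 1) * (κ / (2 * (M + 1)) + κ / (2 * (M + 1))) := by
        have : 0 ≤ κ / (2 * (M + 1)) := by positivity
        refine (mul_le_mul_of_nonneg_left (add_le_add b1 b2) hM0).trans ?_
        gcongr
        linarith
    _ = κ := by field_simp; norm_num

/-- The weak maximum principle, first half: `w` is locally constant where it is positive. -/
theorem gradient_eq_zero_of_pos (hN : 2 ≤ N) (hSo : IsOpen S) (hS0 : (0 : 𝔼) ∉ S) (hΩ : IsOpen Ω)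
    (hΩb : Bornology.IsBounded Ω) (hS : HasC1BoundaryOffOrigin S) {w : 𝔼 → ℝ} {G : 𝔼 → 𝔼} {c : ℝ}
    (hw : ContDiffOn ℝ 1 w (regularSet S Ω)) (hwc : ContinuousOn w (closure (S ∩ Ω) \ {0}))
    (hw0 : ∀ z ∈ closure (gammaZero S Ω), w z ≤ 0) (hG : IsTangentialField S Ω c G)
    (hG2 : MemLp G 2 (volume.restrict (S ∩ Ω))) (hc : c ≤ 0)
    (hpos : ∀ x ∈ S ∩ Ω, 0 ≤ inner ℝ (gradient w x) (G x))
    (hzero : ∀ x ∈ S ∩ Ω, inner ℝ (gradient w x) (G x) = 0 → gradient w x = 0) :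
    ∀ x ∈ S ∩ Ω, 0 < w x → gradient w x = 0 := by
  intro x₀ hx₀ hwx₀
  have hU := hSo.inter hΩ
  have hUb : Bornology.IsBounded (S ∩ Ω) := hΩb.subset inter_subset_right
  have hUR : S ∩ Ω ⊆ regularSet S Ω := subset_union_left
  -- Truncating at a positive level below w x₀ keeps the support away from Γ₀, where w ≤ 0, and
  -- keeps x₀ in the region where T' > 0. T is a smooth bounded substitute for the positive part of
  -- w - ε.
  set ε := w x₀ / 2 with hε
  have hε0 : 0 < ε := by positivity
  let T : ℝ → ℝ := fun s => expNegInvGlue (s - ε)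
  let T' : ℝ → ℝ := fun s => (s - ε)⁻¹ ^ 2 * expNegInvGlue (s - ε)
  have hT : ∀ s, HasDerivAt T (T' s) s := fun s =>
    (hasDerivAt_expNegInvGlue (s - ε)).comp_sub_const s ε
  have hTs : ContDiff ℝ 1 T := (expNegInvGlue.contDiff (n := 1)).comp (contDiff_id.sub contDiff_const)
  have hT'c : Continuous T' := by
    have : deriv T = T' := funext fun s => (hT s).deriv
    rw [← this]
    exact hTs.continuous_deriv le_rfl
  have hT'0 : ∀ s, 0 ≤ T' s := fun s => mul_nonneg (by positivity) (expNegInvGlue.nonneg _)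
  have hT'pos : ∀ s, ε < s → 0 < T' s := fun s hs => by
    have h1 : 0 < s - ε := by linarith
    have := expNegInvGlue.pos_of_pos h1
    positivity
  have hTle : ∀ s, ‖T s‖ ≤ 1 := fun s => by
    rw [Real.norm_of_nonneg (expNegInvGlue.nonneg _)]
    exact expNegInvGlue_le_one _
  have hwd : ∀ x ∈ S ∩ Ω, DifferentiableAt ℝ w x := fun x hx =>
    (hasGradientAt_of_mem_inter hSo hΩ hw hx).differentiableAt
  have hTw : ∀ x ∈ S ∩ Ω, HasGradientAt (fun y => T (w y)) (T' (w x) • gradient w x) x := by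
    intro x hx
    rw [hasGradientAt_iff_hasFDerivAt]
    have h1 := (hT (w x)).comp_hasFDerivAt x (hwd x hx).hasGradientAt.hasFDerivAt
    rw [map_smul]
    exact h1
  set h : 𝔼 → ℝ := fun x => T' (w x) * inner ℝ (gradient w x) (G x) with hh
  have hwU : ContDiffOn ℝ 1 w (S ∩ Ω) := hw.mono hUR
  have hhc : ContinuousOn h (S ∩ Ω) :=
    (hT'c.comp_continuousOn hwU.continuousOn).mul
      ((hwU.continuousOn_gradient hU).inner (𝕜 := ℝ) (hG.continuousOn.mono hUR))
  have hh0 : ∀ x ∈ S ∩ Ω, 0 ≤ h x := fun x hx => mul_nonneg (hT'0 _) (hpos x hx)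
  -- the weak inequality with the cut-off truncation of `w`
  have hmain : ∀ j : ℕ, 0 < j →
      IntegrableOn (fun x => ‖gradient (originCutoff N j) x‖ * ‖G x‖) (S ∩ Ω) →
      IntegrableOn (fun x => originCutoff N j x * h x) (S ∩ Ω) ∧
      ∫ x in S ∩ Ω, originCutoff N j x * h x
        ≤ ∫ x in S ∩ Ω, ‖gradient (originCutoff N j) x‖ * ‖G x‖ := by
    intro j hj hint
    have hj' : (0 : ℝ) < j := by exact_mod_cast hj
    set D := closure (S ∩ Ω) ∩ {x : 𝔼 | 1 / (j : ℝ) ≤ ‖x‖} with hD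
    have hDcl : IsClosed D := isClosed_closure.inter (isClosed_le continuous_const continuous_norm)
    have hDsub : D ⊆ closure (S ∩ Ω) \ {0} := by
      rintro x ⟨hx1, hx2⟩
      refine ⟨hx1, ?_⟩
      rintro rfl
      have : 0 < 1 / (j : ℝ) := by positivity
      have h2 : 1 / (j : ℝ) ≤ ‖(0 : 𝔼)‖ := hx2
      rw [norm_zero] at h2
      linarith
    -- K avoids Γ₀ because w ≥ ε on it, and avoids the origin by the cut-off, so it is a compact
    -- subset of (S ∩ Ω) ∪ (Γ₁ ∖ {O}); this is what the extended weak equation requires.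
    set K := D ∩ w ⁻¹' Ici ε with hK
    have hKc : IsCompact K := by
      refine Metric.isCompact_of_isClosed_isBounded
        ((hwc.mono hDsub).preimage_isClosed_of_isClosed hDcl isClosed_Ici) ?_
      exact hUb.closure.subset fun x hx => hx.1.1
    have hKR : K ⊆ regularSet S Ω := by
      rintro x ⟨hxD, hxw⟩
      refine closure_inter_diff_subset hSo hΩ ⟨⟨hxD.1, fun hx => ?_⟩, (hDsub hxD).2⟩
      have h1 : ε ≤ w x := hxw
      linarith [hw0 x hx]
    set f : 𝔼 → ℝ := fun x => originCutoff N j x * T (w x) with hf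
    have htest : IsTestOn (S ∩ Ω) K f := by
      refine IsTestOn.of_contDiffOn hSo hΩ hS
        ((contDiff_originCutoff j).contDiffOn.mul (hTs.comp_contDiffOn hw)) hKc hKR ?_
      intro x hx hxK
      by_cases hxj : 1 / (j : ℝ) ≤ ‖x‖
      · have h1 : w x < ε := by
          by_contra! h1
          exact hxK ⟨⟨subset_closure hx, hxj⟩, h1⟩
        have : T (w x) = 0 := expNegInvGlue.zero_of_nonpos (by linarith)
        rw [hf]
        simp only [this, mul_zero]
      · rw [hf]
        simp only [originCutoff_eq_zero hj (not_le.1 hxj), zero_mul]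
    have heq := hG.integral_eq hSo hΩ hΩb hS hKc hKR htest
    have hf0 : ∀ x, 0 ≤ f x := fun x => mul_nonneg (ramp_nonneg _) (expNegInvGlue.nonneg _)
    have hle : ∫ x in S ∩ Ω, inner ℝ (gradient f x) (G x) ≤ 0 := by
      rw [heq]
      exact mul_nonpos_of_nonpos_of_nonneg hc (integral_nonneg hf0)
    have hgrad : ∀ x ∈ S ∩ Ω, inner ℝ (gradient f x) (G x) = originCutoff N j x * h x
        + T (w x) * inner ℝ (gradient (originCutoff N j) x) (G x) := by
      intro x hx
      rw [hf, gradient_mul ((contDiff_originCutoff j).differentiable one_ne_zero x)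
        (hTw x hx).differentiableAt, (hTw x hx).gradient]
      simp only [inner_add_left, real_inner_smul_left, hh]
    have hi1 := htest.integrableOn_inner hU hUb hKc hG.continuousOn hUR hKR
    have hmeas2 : AEStronglyMeasurable
        (fun x => T (w x) * inner ℝ (gradient (originCutoff N j) x) (G x))
        (volume.restrict (S ∩ Ω)) := by
      refine ContinuousOn.aestronglyMeasurable ?_ hU.measurableSet
      exact (hTs.continuous.comp_continuousOn hwU.continuousOn).mul
        ((continuous_gradient (contDiff_originCutoff j)).continuousOn.inner (𝕜 := ℝ)
          (hG.continuousOn.mono hUR))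
    have hbound : ∀ x, ‖T (w x) * inner ℝ (gradient (originCutoff N j) x) (G x)‖
        ≤ ‖gradient (originCutoff N j) x‖ * ‖G x‖ := fun x => by
      rw [norm_mul]
      exact (mul_le_of_le_one_left (norm_nonneg _) (hTle _)).trans (norm_inner_le_norm _ _)
    have hi2 : IntegrableOn (fun x => T (w x) * inner ℝ (gradient (originCutoff N j) x) (G x))
        (S ∩ Ω) := hint.mono' hmeas2 (Eventually.of_forall hbound)
    have hi3 : IntegrableOn (fun x => originCutoff N j x * h x) (S ∩ Ω) := by
      refine (hi1.sub hi2).congr_fun (fun x hx => ?_) hU.measurableSet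
      simp only [Pi.sub_apply, hgrad x hx]
      ring
    refine ⟨hi3, ?_⟩
    rw [setIntegral_congr_fun hU.measurableSet hgrad, integral_add hi3 hi2] at hle
    have h4 : -∫ x in S ∩ Ω, T (w x) * inner ℝ (gradient (originCutoff N j) x) (G x)
        ≤ ∫ x in S ∩ Ω, ‖gradient (originCutoff N j) x‖ * ‖G x‖ := by
      refine (neg_le_abs _).trans ?_
      rw [← Real.norm_eq_abs]
      refine (norm_integral_le_integral_norm _).trans ?_
      exact integral_mono hi2.norm hint hbound
    linarith
  -- hence `h` vanishes on `S ∩ Ω`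
  have hx00 : 0 < ‖x₀‖ := norm_pos_iff.2 fun h0 => hS0 (h0 ▸ hx₀.1)
  have hhx₀ : h x₀ = 0 := by
    by_contra hne
    have hpos0 : 0 < h x₀ := (hh0 x₀ hx₀).lt_of_ne (Ne.symm hne)
    have n1 := (hhc.continuousAt (hU.mem_nhds hx₀)).eventually (lt_mem_nhds (half_lt_self hpos0))
    have n2 : ∀ᶠ x in 𝓝 x₀, ‖x₀‖ / 2 < ‖x‖ :=
      continuous_norm.continuousAt.eventually (lt_mem_nhds (half_lt_self hx00))
    obtain ⟨ρ, hρ, hball⟩ := Metric.eventually_nhds_iff_ball.1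
      (n1.and (n2.and (hU.eventually_mem hx₀)))
    set a := h x₀ / 2 * volume.real (Metric.ball x₀ ρ) with ha
    have ha0 : 0 < a := mul_pos (half_pos hpos0)
      (ENNReal.toReal_pos (Metric.measure_ball_pos volume x₀ hρ).ne' measure_ball_lt_top.ne)
    have hjlarge : ∀ᶠ j : ℕ in atTop, 2 / (j : ℝ) ≤ ‖x₀‖ / 2 := by
      have : Tendsto (fun j : ℕ => 2 / (j : ℝ)) atTop (𝓝 0) :=
        Tendsto.div_atTop tendsto_const_nhds tendsto_natCast_atTop_atTop
      filter_upwards [this.eventually (gt_mem_nhds (half_pos hx00))] with j hj using hj.le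
    obtain ⟨j, ⟨hint, hle⟩, hj, hj0⟩ := ((exists_integral_cutoff_le hN hUb hG2
      (half_pos ha0)).and (hjlarge.and (eventually_gt_atTop 0))).exists
    obtain ⟨hi, hle'⟩ := hmain j hj0 hint
    have hsub : Metric.ball x₀ ρ ⊆ S ∩ Ω := fun x hx => (hball x hx).2.2
    have h1 : a ≤ ∫ x in Metric.ball x₀ ρ, originCutoff N j x * h x := by
      have h2 : ∫ x in Metric.ball x₀ ρ, h x₀ / 2 = a := by
        rw [setIntegral_const, smul_eq_mul, mul_comm]
      rw [← h2]
      refine setIntegral_mono_on (integrableOn_const measure_ball_lt_top.ne) (hi.mono_set hsub)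
        measurableSet_ball fun x hx => ?_
      obtain ⟨b1, b2, -⟩ := hball x hx
      rw [originCutoff_eq_one hj0 (hj.trans b2.le), one_mul]
      exact b1.le
    have h2 : ∫ x in Metric.ball x₀ ρ, originCutoff N j x * h x
        ≤ ∫ x in S ∩ Ω, originCutoff N j x * h x := by
      refine setIntegral_mono_set hi ?_ hsub.eventuallyLE
      filter_upwards [ae_restrict_mem hU.measurableSet] with x hx
      exact mul_nonneg (ramp_nonneg _) (hh0 x hx)
    linarith
  refine hzero x₀ hx₀ ?_
  rcases mul_eq_zero.1 hhx₀ with h1 | h1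
  · exact absurd h1 (hT'pos _ (by rw [hε]; linarith)).ne'
  · exact h1

/-- The weak maximum principle. -/
theorem nonpos_of_nonpos_on_gammaZero (hN : 2 ≤ N) (hSo : IsOpen S) (hS0 : (0 : 𝔼) ∉ S)
    (hSc : ∀ x ∈ S, ∀ t : ℝ, 0 < t → t • x ∈ S) (hΩ : IsOpen Ω) (hΩb : Bornology.IsBounded Ω)
    (hS : HasC1BoundaryOffOrigin S) {w : 𝔼 → ℝ} {G : 𝔼 → 𝔼} {c : ℝ}
    (hw : ContDiffOn ℝ 1 w (regularSet S Ω)) (hwc : ContinuousOn w (closure (S ∩ Ω) \ {0}))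
    (hw0 : ∀ z ∈ closure (gammaZero S Ω), w z ≤ 0) (hG : IsTangentialField S Ω c G)
    (hG2 : MemLp G 2 (volume.restrict (S ∩ Ω))) (hc : c ≤ 0)
    (hpos : ∀ x ∈ S ∩ Ω, 0 ≤ inner ℝ (gradient w x) (G x))
    (hzero : ∀ x ∈ S ∩ Ω, inner ℝ (gradient w x) (G x) = 0 → gradient w x = 0) :
    ∀ x ∈ S ∩ Ω, w x ≤ 0 := by
  have key := gradient_eq_zero_of_pos hN hSo hS0 hΩ hΩb hS hw hwc hw0 hG hG2 hc hpos hzero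
  intro x hx
  by_contra! hwx
  obtain ⟨t, ht, htΓ, hts⟩ := exists_smul_mem_gammaZero hSc hS0 hΩ hΩb hx
  have hcl := subset_closure (s := gammaZero S Ω) htΓ
  have hcont : ContinuousOn (fun s : ℝ => w (s • x)) (Icc 1 t) := by
    refine hwc.comp (by fun_prop) fun s hs => ?_
    refine ⟨?_, fun h => hS0 ((mem_singleton_iff.1 h) ▸ hSc x hx.1 s (by linarith [hs.1]))⟩
    rcases hs.2.eq_or_lt with h | h
    · rw [h]
      exact closure_gammaZero_subset_closure hSo hcl
    · exact subset_closure (hts s ⟨hs.1, h⟩)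
  -- Up to the first time the ray from x sees w ≤ w x / 2, w is positive, hence constant along the
  -- ray; this contradicts the drop. The drop occurs because the ray ends on Γ₀. No connectedness of
  -- S ∩ Ω is needed.
  set A := Icc 1 t ∩ (fun s : ℝ => w (s • x)) ⁻¹' Iic (w x / 2) with hA
  have hAc : IsCompact A := isCompact_Icc.of_isClosed_subset
    (hcont.preimage_isClosed_of_isClosed isClosed_Icc isClosed_Iic) inter_subset_left
  have hAn : A.Nonempty :=
    ⟨t, ⟨ht.le, le_rfl⟩, (hw0 _ hcl).trans (half_pos hwx).le⟩
  obtain ⟨s₁, hs₁, hmin⟩ := hAc.exists_isLeast hAn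
  have hconst := constant_of_has_deriv_right_zero (f := fun s : ℝ => w (s • x)) (a := 1) (b := s₁)
    (hcont.mono (Icc_subset_Icc_right hs₁.1.2)) ?_ s₁ ⟨hs₁.1.1, le_rfl⟩
  · have h2 : w (s₁ • x) ≤ w x / 2 := hs₁.2
    simp only [one_smul] at hconst
    linarith
  · intro s hs
    have hsU := hts s ⟨hs.1, hs.2.trans_le hs₁.1.2⟩
    have hws : 0 < w (s • x) := by
      by_contra! hneg
      have := hmin ⟨⟨hs.1, hs.2.le.trans hs₁.1.2⟩, hneg.trans (half_pos hwx).le⟩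
      linarith [hs.2]
    have hg := hasGradientAt_of_mem_inter hSo hΩ hw hsU
    rw [← hg.gradient, key _ hsU hws] at hg
    have h1 : HasDerivAt (fun s : ℝ => s • x) x s := by
      simpa using (hasDerivAt_id s).smul_const x
    have h2 := hg.hasFDerivAt.comp_hasDerivAt s h1
    simpa [Function.comp_def] using h2.hasDerivWithinAt

end ConeWulff

namespace ConeWulff

variable {N : ℕ}

local notation "𝔼" => EuclideanSpace ℝ (Fin N)

variable {S Ω : Set (EuclideanSpace ℝ (Fin N))} {H : EuclideanSpace ℝ (Fin N) → ℝ}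

/-! ### Radial solutions -/

/-- The function `k (R² - H₀²) / 2`; for `k = 1 / N` it is the solution on the Wulff shape of
radius `R`. -/
noncomputable def radial (H : EuclideanSpace ℝ (Fin N) → ℝ) (k R : ℝ)
    (x : EuclideanSpace ℝ (Fin N)) : ℝ :=
  k * (R ^ 2 / 2 - lagrangian (dualNorm H) x)

theorem hasGradientAt_radial (hH : IsNorm H) (hC : ContDiffOn ℝ 1 H {0}ᶜ)
    (hV : StrictConvexOn ℝ univ (lagrangian H)) (k R : ℝ) (x : 𝔼) :
    HasGradientAt (radial H k R) (-k • dualGradient H x) x := by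
  have h := (((hasGradientAt_lagrangian_dualNorm hH hC hV x).hasFDerivAt.const_sub
    (R ^ 2 / 2)).const_mul k)
  rw [hasGradientAt_iff_hasFDerivAt]
  refine h.congr_fderiv ?_
  simp

theorem contDiff_radial (hH : IsNorm H) (hC : ContDiffOn ℝ 1 H {0}ᶜ)
    (hV : StrictConvexOn ℝ univ (lagrangian H)) (k R : ℝ) : ContDiff ℝ 1 (radial H k R) := by
  refine contDiff_one_iff_fderiv.2
    ⟨fun x => (hasGradientAt_radial hH hC hV k R x).differentiableAt, ?_⟩
  have : fderiv ℝ (radial H k R)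
      = fun x => InnerProductSpace.toDual ℝ 𝔼 (-k • dualGradient H x) :=
    funext fun x => (hasGradientAt_radial hH hC hV k R x).hasFDerivAt.fderiv
  rw [this]
  have hc := continuous_dualGradient hH hC hV
  exact (InnerProductSpace.toDual ℝ 𝔼).continuous.comp (by fun_prop)

theorem gradient_lagrangian_gradient_radial (hH : IsNorm H) (hC : ContDiffOn ℝ 1 H {0}ᶜ)
    (hV : StrictConvexOn ℝ univ (lagrangian H)) (k R : ℝ) (x : 𝔼) :
    gradient (lagrangian H) (gradient (radial H k R) x) = -k • x := by
  rw [(hasGradientAt_radial hH hC hV k R x).gradient, gradient_lagrangian_smul hH hC,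
    gradient_lagrangian_dualGradient hH hC]

/-! ### Tangential fields -/

theorem isTangentialField_linear_combination {F₁ F₂ : 𝔼 → 𝔼} {c₁ c₂ : ℝ} (hSo : IsOpen S)
    (hΩ : IsOpen Ω) (hΩb : Bornology.IsBounded Ω) (h₁ : IsTangentialField S Ω c₁ F₁)
    (h₂ : IsTangentialField S Ω c₂ F₂) (a b : ℝ) :
    IsTangentialField S Ω (a * c₁ + b * c₂) (fun x => a • F₁ x + b • F₂ x) where
  continuousOn := by
    have hc₁ := h₁.continuousOn
    have hc₂ := h₂.continuousOn
    fun_prop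
  tangential p hp φ hφ := by
    rw [inner_add_right, inner_smul_right, inner_smul_right, h₁.tangential p hp φ hφ,
      h₂.tangential p hp φ hφ, mul_zero, mul_zero, add_zero]
  weak v hv hvc hvU := by
    have hU := hSo.inter hΩ
    have hUb : Bornology.IsBounded (S ∩ Ω) := hΩb.subset inter_subset_right
    have hUR : S ∩ Ω ⊆ regularSet S Ω := subset_union_left
    obtain ⟨C₁, hC₁⟩ := hv.continuous.bounded_above_of_compact_support hvc
    obtain ⟨C₂, hC₂⟩ := (continuous_gradient hv).bounded_above_of_compact_support
      (hasCompactSupport_gradient hvc)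
    have ht : IsTestOn (S ∩ Ω) (tsupport v) v := ⟨hv.contDiffOn,
      fun x _ hx => image_eq_zero_of_notMem_tsupport hx, max C₁ C₂,
      fun x _ => ⟨(hC₁ x).trans (le_max_left _ _), (hC₂ x).trans (le_max_right _ _)⟩⟩
    have i₁ := ht.integrableOn_inner hU hUb hvc h₁.continuousOn hUR (hvU.trans hUR)
    have i₂ := ht.integrableOn_inner hU hUb hvc h₂.continuousOn hUR (hvU.trans hUR)
    simp only [inner_add_right, inner_smul_right]
    rw [integral_add (i₁.const_mul a) (i₂.const_mul b), integral_const_mul, integral_const_mul,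
      h₁.weak v hv hvc hvU, h₂.weak v hv hvc hvU]
    ring

/-- Up to the factor -k, this is the flux of every radial comparison function. The cone structure
makes it tangential on Γ₁. -/
theorem isTangentialField_id (hSo : IsOpen S) (hSc : ∀ x ∈ S, ∀ t : ℝ, 0 < t → t • x ∈ S)
    (hΩ : IsOpen Ω) : IsTangentialField S Ω (-N) (fun x => x) where
  continuousOn := continuousOn_id
  tangential _ hp _ hφ := hφ.inner_self_eq_zero_of_cone hSo hSc
    (gammaOne_subset_frontier hSo hΩ hp.1)
  weak v hv hvc hvU := by
    have h := integral_inner_gradient_id hv hvc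
    rw [finrank_euclideanSpace_fin] at h
    rw [setIntegral_eq_integral_of_forall_compl_eq_zero fun x hx => by
        rw [gradient_eq_zero_of_notMem_tsupport fun h => hx (hvU h), inner_zero_left],
      setIntegral_eq_integral_of_forall_compl_eq_zero fun x hx =>
        image_eq_zero_of_notMem_tsupport fun h => hx (hvU h), h]

theorem isTangentialField_flux (hH : IsNorm H) (hC : ContDiffOn ℝ 1 H {0}ᶜ) (hSo : IsOpen S)
    (hΩ : IsOpen Ω) (hΩb : Bornology.IsBounded Ω) (hS : HasC1BoundaryOffOrigin S) {u : 𝔼 → ℝ}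
    (hu : ContDiffOn ℝ 1 u (regularSet S Ω)) (hw : IsWeakSolution H S Ω (fun _ => 1) u)
    (hN : ∀ x ∈ gammaOne S Ω \ {0}, ∀ n, IsOutwardNormal S x n →
      inner ℝ (gradient (lagrangian H) (gradientWithin u (regularSet S Ω) x)) n = 0) :
    IsTangentialField S Ω 1
      (fun x => gradient (lagrangian H) (gradientWithin u (regularSet S Ω) x)) where
  continuousOn := (continuous_gradient_lagrangian hH hC).comp_continuousOn
    (hS.continuousOn_gradientWithin hSo hΩ hu)
  tangential p hp φ hφ := by
    have h := hN p hp _ ⟨φ, hφ, rfl⟩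
    rw [inner_smul_right, mul_eq_zero, inv_eq_zero, norm_eq_zero] at h
    rw [real_inner_comm]
    exact h.resolve_left hφ.2.2.1
  weak v hv hvc hvU := by
    have h := hw.integral_inner_eq hSo hΩ hΩb (hu.mono subset_union_left) hv hvc hvU
    simp only [one_mul] at h ⊢
    rw [← h]
    refine setIntegral_congr_fun (hSo.inter hΩ).measurableSet fun x hx => ?_
    simp only [(hasGradientAt_of_mem_inter hSo hΩ hu hx).gradient]

theorem memLp_flux (hH : IsNorm H) (hC : ContDiffOn ℝ 1 H {0}ᶜ) (hSo : IsOpen S)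
    (hΩ : IsOpen Ω) (hΩb : Bornology.IsBounded Ω) {u f : 𝔼 → ℝ}
    (hu : ContDiffOn ℝ 1 u (regularSet S Ω)) (hw : IsWeakSolution H S Ω f u) :
    MemLp (fun x => gradient (lagrangian H) (gradientWithin u (regularSet S Ω) x)) 2
      (volume.restrict (S ∩ Ω)) := by
  have h1 := hw.memLp_gradient hSo hΩ hΩb (hu.mono subset_union_left)
  obtain ⟨C, -, hCb⟩ := exists_norm_gradient_lagrangian_le hH hC
  have h2 : MemLp (fun x => gradient (lagrangian H) (gradient u x)) 2
      (volume.restrict (S ∩ Ω)) :=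
    h1.of_le_mul ((continuous_gradient_lagrangian hH hC).comp_aestronglyMeasurable h1.1)
      (Eventually.of_forall fun x => hCb _)
  refine h2.ae_eq ?_
  filter_upwards [ae_restrict_mem (hSo.inter hΩ).measurableSet] with x hx
  rw [(hasGradientAt_of_mem_inter hSo hΩ hu hx).gradient]

theorem memLp_id_of_isBounded {U : Set 𝔼} (hU : MeasurableSet U) (hUb : Bornology.IsBounded U) :
    MemLp (fun x : 𝔼 => x) 2 (volume.restrict U) := by
  have hfin : IsFiniteMeasure (volume.restrict U) :=
    ⟨by rw [Measure.restrict_apply_univ]; exact hUb.measure_lt_top⟩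
  obtain ⟨M, hM⟩ := hUb.exists_norm_le
  refine MemLp.of_bound continuous_id.aestronglyMeasurable M ?_
  filter_upwards [ae_restrict_mem hU] with x hx using hM x hx

/-! ### Comparison with radial solutions -/

section Comparison

variable {u : EuclideanSpace ℝ (Fin N) → ℝ}

theorem eq_zero_of_mem_closure_gammaZero (hSo : IsOpen S) (hΩ : IsOpen Ω) (hΩ0 : (0 : 𝔼) ∈ Ω)
    (huC0 : ContinuousOn u (closure (S ∩ Ω) \ {0})) (hu0 : ∀ x ∈ gammaZero S Ω, u x = 0) :
    ∀ z ∈ closure (gammaZero S Ω), u z = 0 := by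
  have hsub : closure (gammaZero S Ω) ⊆ closure (S ∩ Ω) \ {0} := fun z hz =>
    ⟨closure_gammaZero_subset_closure hSo hz, fun h =>
      closure_gammaZero_subset hΩ hz ((mem_singleton_iff.1 h) ▸ hΩ0)⟩
  intro z hz
  have h1 : Tendsto u (𝓝[gammaZero S Ω] z) (𝓝 (u z)) :=
    (huC0 z (hsub hz)).mono (subset_closure.trans hsub)
  have h2 : Tendsto u (𝓝[gammaZero S Ω] z) (𝓝 0) := by
    refine tendsto_const_nhds.congr' ?_
    filter_upwards [self_mem_nhdsWithin] with x hx using (hu0 x hx).symm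
  have := mem_closure_iff_nhdsWithin_neBot.1 hz
  exact tendsto_nhds_unique h1 h2

variable (hN : 2 ≤ N) (hH : IsNorm H) (hC : ContDiffOn ℝ 1 H {0}ᶜ)
  (hV : StrictConvexOn ℝ univ (lagrangian H)) (hSo : IsOpen S)
  (hS0 : (0 : EuclideanSpace ℝ (Fin N)) ∉ S)
  (hSc : ∀ x ∈ S, ∀ t : ℝ, 0 < t → t • x ∈ S) (hS : HasC1BoundaryOffOrigin S) (hΩ : IsOpen Ω)
  (hΩb : Bornology.IsBounded Ω)
  (huC1 : ContDiffOn ℝ 1 u (regularSet S Ω))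
  (huC0 : ContinuousOn u (closure (S ∩ Ω) \ {0}))
  (huw : IsWeakSolution H S Ω (fun _ => 1) u)
  (huN : ∀ x ∈ gammaOne S Ω \ {0}, ∀ n, IsOutwardNormal S x n →
    inner ℝ (gradient (lagrangian H) (gradientWithin u (regularSet S Ω) x)) n = 0)
  (hu0 : ∀ z ∈ closure (gammaZero S Ω), u z = 0)

include hN hH hC hV hSo hS0 hSc hS hΩ hΩb huC1 huC0 huw huN hu0

/-- The maximum principle is applied to w = `radial H k R` - u with G the difference of the fluxes,
-k x - DV(Du). Then -div G = kN - 1 ≤ 0, and strict monotonicity of DV makes ⟨Dw, G⟩ positive unless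
Dw = 0. -/
theorem radial_le_of_nonpos {k R : ℝ} (hk : k * N ≤ 1)
    (hR : ∀ z ∈ closure (gammaZero S Ω), radial H k R z ≤ 0) :
    ∀ x ∈ S ∩ Ω, radial H k R x ≤ u x := by
  have hU := hSo.inter hΩ
  have hUb : Bornology.IsBounded (S ∩ Ω) := hΩb.subset inter_subset_right
  have hr := contDiff_radial hH hC hV k R
  have hF := isTangentialField_linear_combination hSo hΩ hΩb
    (isTangentialField_flux hH hC hSo hΩ hΩb hS huC1 huw huN) (isTangentialField_id hSo hSc hΩ)
    (-1) (-k)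
  have hg : ∀ x ∈ S ∩ Ω, gradient (fun y => radial H k R y - u y) x
      = gradient (radial H k R) x - gradientWithin u (regularSet S Ω) x := by
    intro x hx
    have h1 := hasGradientAt_of_mem_inter hSo hΩ huC1 hx
    have h2 := (hr.differentiable one_ne_zero x).hasGradientAt
    refine HasGradientAt.gradient ?_
    rw [hasGradientAt_iff_hasFDerivAt, map_sub]
    exact h2.hasFDerivAt.sub h1.hasFDerivAt
  have hGx : ∀ x : 𝔼, (-1 : ℝ) • gradient (lagrangian H) (gradientWithin u (regularSet S Ω) x)
      + -k • x = gradient (lagrangian H) (gradient (radial H k R) x)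
        - gradient (lagrangian H) (gradientWithin u (regularSet S Ω) x) := fun x => by
    rw [gradient_lagrangian_gradient_radial hH hC hV]
    module
  have key := nonpos_of_nonpos_on_gammaZero hN hSo hS0 hSc hΩ hΩb hS
    (w := fun y => radial H k R y - u y) (hr.contDiffOn.sub huC1)
    (hr.continuous.continuousOn.sub huC0)
    (fun z hz => by rw [hu0 z hz, sub_zero]; exact hR z hz) hF
    (((memLp_flux hH hC hSo hΩ hΩb huC1 huw).const_smul (-1 : ℝ)).add
      ((memLp_id_of_isBounded hU.measurableSet hUb).const_smul (-k)))
    (by linarith) ?_ ?_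
  · intro x hx
    linarith [key x hx]
  · intro x hx
    rw [hg x hx, hGx]
    rcases eq_or_ne (gradient (radial H k R) x) (gradientWithin u (regularSet S Ω) x) with h | h
    · simp [h]
    · exact (hV.inner_sub_pos (hasGradientAt_lagrangian hH hC _)
        (hasGradientAt_lagrangian hH hC _) h).le
  · intro x hx h0
    rw [hg x hx, hGx] at h0
    rw [hg x hx]
    by_contra h
    exact (hV.inner_sub_pos (hasGradientAt_lagrangian hH hC _)
      (hasGradientAt_lagrangian hH hC _) (sub_ne_zero.1 h)).ne' h0

/-- The same comparison with the roles exchanged: here -div G = 1 - kN ≤ 0. -/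
theorem le_radial_of_nonneg {k R : ℝ} (hk : 1 ≤ k * N)
    (hR : ∀ z ∈ closure (gammaZero S Ω), 0 ≤ radial H k R z) :
    ∀ x ∈ S ∩ Ω, u x ≤ radial H k R x := by
  have hU := hSo.inter hΩ
  have hUb : Bornology.IsBounded (S ∩ Ω) := hΩb.subset inter_subset_right
  have hr := contDiff_radial hH hC hV k R
  have hF := isTangentialField_linear_combination hSo hΩ hΩb
    (isTangentialField_flux hH hC hSo hΩ hΩb hS huC1 huw huN) (isTangentialField_id hSo hSc hΩ)
    1 k
  have hg : ∀ x ∈ S ∩ Ω, gradient (fun y => u y - radial H k R y) x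
      = gradientWithin u (regularSet S Ω) x - gradient (radial H k R) x := by
    intro x hx
    have h1 := hasGradientAt_of_mem_inter hSo hΩ huC1 hx
    have h2 := (hr.differentiable one_ne_zero x).hasGradientAt
    refine HasGradientAt.gradient ?_
    rw [hasGradientAt_iff_hasFDerivAt, map_sub]
    exact h1.hasFDerivAt.sub h2.hasFDerivAt
  have hGx : ∀ x : 𝔼, (1 : ℝ) • gradient (lagrangian H) (gradientWithin u (regularSet S Ω) x)
      + k • x = gradient (lagrangian H) (gradientWithin u (regularSet S Ω) x)
        - gradient (lagrangian H) (gradient (radial H k R) x) := fun x => by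
    rw [gradient_lagrangian_gradient_radial hH hC hV]
    module
  have key := nonpos_of_nonpos_on_gammaZero hN hSo hS0 hSc hΩ hΩb hS
    (w := fun y => u y - radial H k R y) (huC1.sub hr.contDiffOn)
    (huC0.sub hr.continuous.continuousOn)
    (fun z hz => by rw [hu0 z hz, zero_sub, neg_nonpos]; exact hR z hz) hF
    (((memLp_flux hH hC hSo hΩ hΩb huC1 huw).const_smul (1 : ℝ)).add
      ((memLp_id_of_isBounded hU.measurableSet hUb).const_smul k))
    (by linarith) ?_ ?_
  · intro x hx
    linarith [key x hx]
  · intro x hx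
    rw [hg x hx, hGx]
    rcases eq_or_ne (gradientWithin u (regularSet S Ω) x) (gradient (radial H k R) x) with h | h
    · simp [h]
    · exact (hV.inner_sub_pos (hasGradientAt_lagrangian hH hC _)
        (hasGradientAt_lagrangian hH hC _) h).le
  · intro x hx h0
    rw [hg x hx, hGx] at h0
    rw [hg x hx]
    by_contra h
    exact (hV.inner_sub_pos (hasGradientAt_lagrangian hH hC _)
      (hasGradientAt_lagrangian hH hC _) (sub_ne_zero.1 h)).ne' h0

end Comparison

end ConeWulff

namespace ConeWulff

variable {N : ℕ}

local notation "𝔼" => EuclideanSpace ℝ (Fin N)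

variable {S Ω : Set (EuclideanSpace ℝ (Fin N))} {H : EuclideanSpace ℝ (Fin N) → ℝ}
  {u : EuclideanSpace ℝ (Fin N) → ℝ}

/-! ### Gradient bounds at boundary points where the solution is touched -/

theorem smul_mem_closure_of_cone (hSc : ∀ x ∈ S, ∀ t : ℝ, 0 < t → t • x ∈ S) {z : 𝔼}
    (hz : z ∈ closure S) {t : ℝ} (ht : 0 < t) : t • z ∈ closure S :=
  map_mem_closure (continuous_const_smul t) hz fun x hx => hSc x hx t ht

theorem mem_closure_inter_normBall {H₀ : 𝔼 → ℝ} (hH₀ : IsNorm H₀)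
    (hSc : ∀ x ∈ S, ∀ t : ℝ, 0 < t → t • x ∈ S) {z : 𝔼} (hz : z ∈ closure S)
    (hz0 : 0 < H₀ z) : z ∈ closure (S ∩ normBall H₀ (H₀ z)) := by
  have hopen : IsOpen (normBall H₀ (H₀ z)) := isOpen_lt hH₀.continuous continuous_const
  have hlim : Tendsto (fun t : ℝ => t • z) (𝓝[<] 1) (𝓝 z) := by
    have : Continuous fun t : ℝ => t • z := by fun_prop
    simpa using (this.tendsto 1).mono_left nhdsWithin_le_nhds
  rw [← closure_closure]
  refine mem_closure_of_tendsto hlim ?_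
  filter_upwards [Ioo_mem_nhdsLT (show (0 : ℝ) < 1 by norm_num)] with t ht
  refine hopen.closure_inter ⟨smul_mem_closure_of_cone hSc hz ht.1, ?_⟩
  change H₀ (t • z) < H₀ z
  rw [hH₀.smul_of_nonneg ht.1.le]
  nlinarith [ht.2]

theorem radial_smul {H₀ : 𝔼 → ℝ} (h : dualNorm H = H₀) (hH₀ : IsNorm H₀) (k R : ℝ) {t : ℝ}
    (ht : 0 ≤ t) (z : 𝔼) : radial H k R (t • z) = k * (R ^ 2 / 2 - (t * H₀ z) ^ 2 / 2) := by
  rw [radial, lagrangian, h, hH₀.smul_of_nonneg ht]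

/-- If H(Du) < c near z, then moving from y to t y raises u by at most c R (1 - t), by the mean
value theorem along the ray. Letting y → z inside the Wulff shape, where the rays stay in Ω, and
using the lower barrier at t z gives k R (1 + t) / 2 ≤ c, which fails for c < k R and t close to 1.
-/
theorem le_of_radial_le (hH : IsNorm H) (hC : ContDiffOn ℝ 1 H {0}ᶜ)
    (hV : StrictConvexOn ℝ univ (lagrangian H))
    (hSc : ∀ x ∈ S, ∀ t : ℝ, 0 < t → t • x ∈ S) {g : 𝔼 → 𝔼} {z : 𝔼} {k q₁ : ℝ}
    (hg : ∀ x ∈ S ∩ Ω, HasGradientAt u (g x) x)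
    (hq : Tendsto (fun x => H (g x)) (𝓝[S ∩ Ω] z) (𝓝 q₁))
    (huz : Tendsto u (𝓝[S ∩ Ω] z) (𝓝 0)) (hz : z ∈ closure S) (hz0 : 0 < dualNorm H z)
    (hball : S ∩ normBall (dualNorm H) (dualNorm H z) ⊆ Ω)
    (hle : ∀ x ∈ S ∩ Ω, radial H k (dualNorm H z) x ≤ u x) :
    k * dualNorm H z ≤ q₁ := by
  have hH₀ := isNorm_dualNorm hH hC
  have hr := (contDiff_radial hH hC hV k (dualNorm H z)).continuous
  set R := dualNorm H z with hR
  set D := S ∩ normBall (dualNorm H) R with hD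
  have hDU : D ⊆ S ∩ Ω := fun x hx => ⟨hx.1, hball hx⟩
  have hne : (𝓝[D] z).NeBot :=
    mem_closure_iff_nhdsWithin_neBot.1 (mem_closure_inter_normBall hH₀ hSc hz hz0)
  have hneU : (𝓝[S ∩ Ω] z).NeBot := hne.mono (nhdsWithin_mono _ hDU)
  have hq0 : 0 ≤ q₁ := ge_of_tendsto' hq fun x => hH.nonneg _
  by_contra! hlt
  obtain ⟨c, hc1, hc2⟩ := exists_between hlt
  have hc0 : 0 < c := hq0.trans_lt hc1
  obtain ⟨δ, hδ, hδU⟩ := Metric.eventually_nhds_iff_ball.1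
    (eventually_nhdsWithin_iff.1 (hq.eventually (gt_mem_nhds hc1)))
  have ht1 : ∀ᶠ t : ℝ in 𝓝[<] 1, (1 - t) * ‖z‖ < δ / 2 := by
    have : Continuous fun t : ℝ => (1 - t) * ‖z‖ := by fun_prop
    refine ((this.tendsto 1).mono_left nhdsWithin_le_nhds).eventually (gt_mem_nhds ?_)
    simpa using hδ
  have ht2 : ∀ᶠ t : ℝ in 𝓝[<] 1, c < k * R * ((1 + t) / 2) := by
    have : Continuous fun t : ℝ => k * R * ((1 + t) / 2) := by fun_prop
    refine ((this.tendsto 1).mono_left nhdsWithin_le_nhds).eventually (lt_mem_nhds ?_)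
    simpa using hc2
  obtain ⟨t, ⟨ht1, ht2⟩, ht⟩ :=
    ((ht1.and ht2).and (Ioo_mem_nhdsLT (show (0 : ℝ) < 1 by norm_num))).exists
  -- The segment from t z to z itself may lie in ∂S, so the estimate is made at interior points y
  -- and passed to the limit.
  have hstep : ∀ᶠ y in 𝓝[D] z, radial H k R (t • y) ≤ u y + c * R * (1 - t) := by
    filter_upwards [self_mem_nhdsWithin,
      mem_nhdsWithin_of_mem_nhds (Metric.ball_mem_nhds z (half_pos hδ))] with y hy hyz
    have hmem : ∀ s ∈ Icc t 1, s • y ∈ S ∩ Ω ∧ H (g (s • y)) < c := by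
      intro s hs
      have hs0 : 0 < s := ht.1.trans_le hs.1
      have hsU : s • y ∈ S ∩ Ω := by
        refine hDU ⟨hSc y hy.1 s hs0, ?_⟩
        change dualNorm H (s • y) < R
        rw [hH₀.smul_of_nonneg hs0.le]
        have h1 : dualNorm H y < R := hy.2
        nlinarith [hs.2, hH₀.nonneg y]
      refine ⟨hsU, hδU _ ?_ hsU⟩
      rw [Metric.mem_ball, dist_eq_norm] at hyz ⊢
      calc ‖s • y - z‖ = ‖s • (y - z) - (1 - s) • z‖ := by congr 1; module
        _ ≤ s * ‖y - z‖ + (1 - s) * ‖z‖ := by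
          refine (norm_sub_le _ _).trans ?_
          rw [norm_smul, norm_smul, Real.norm_of_nonneg hs0.le,
            Real.norm_of_nonneg (sub_nonneg.2 hs.2)]
        _ ≤ 1 * ‖y - z‖ + (1 - t) * ‖z‖ := by
          have := hs.1
          have := hs.2
          gcongr
        _ < δ := by linarith
    have hder : ∀ s ∈ Icc t 1, HasDerivAt (fun s : ℝ => u (s • y)) (inner ℝ (g (s • y)) y) s := by
      intro s hs
      have h1 := (hg _ (hmem s hs).1).hasFDerivAt
      have h2 : HasDerivAt (fun s : ℝ => s • y) y s := by
        simpa using (hasDerivAt_id s).smul_const y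
      have h3 := h1.comp_hasDerivAt s h2
      rwa [InnerProductSpace.toDual_apply_apply] at h3
    obtain ⟨s, hs, hsl⟩ := exists_hasDerivAt_eq_slope (fun s : ℝ => u (s • y)) _ ht.2
      (fun s hs => (hder s hs).continuousAt.continuousWithinAt)
      (fun s hs => hder s (Ioo_subset_Icc_self hs))
    rw [eq_div_iff (sub_pos.2 ht.2).ne', one_smul] at hsl
    have hsm := hmem s (Ioo_subset_Icc_self hs)
    have h1 := inner_le_dualNorm_mul hH hC (-y) (g (s • y))
    rw [hH₀.map_neg, inner_neg_left, real_inner_comm] at h1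
    have h2 : dualNorm H y * H (g (s • y)) ≤ R * c := by
      have h3 : dualNorm H y ≤ R := le_of_lt hy.2
      have h4 := hsm.2.le
      have h5 := hH.nonneg (g (s • y))
      gcongr
    have h6 := hle _ (hmem t (left_mem_Icc.2 ht.2.le)).1
    nlinarith [sub_pos.2 ht.2]
  have hlim : radial H k R (t • z) ≤ 0 + c * R * (1 - t) := by
    refine le_of_tendsto_of_tendsto ?_ ?_ hstep
    · exact ((hr.comp (continuous_const_smul t)).tendsto z).mono_left nhdsWithin_le_nhds
    · exact (huz.mono_left (nhdsWithin_mono _ hDU)).add_const _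
  rw [radial_smul rfl hH₀ _ _ ht.1.le, ← hR] at hlim
  have h1 := mul_lt_mul_of_pos_right ht2 (mul_pos hz0 (sub_pos.2 ht.2))
  nlinarith

/-- In the interior the steepest direction DV(ξ) works. On Γ₁ the conormal condition makes it
tangent to ∂S, so it is tilted slightly inward; the strict inequality c < H ξ leaves room for the
tilt. -/
theorem exists_ascent_direction_of_mem_regularSet (hH : IsNorm H) (hC : ContDiffOn ℝ 1 H {0}ᶜ)
    (hSo : IsOpen S) (hΩ : IsOpen Ω) (hS : HasC1BoundaryOffOrigin S) {x ξ : 𝔼} {c : ℝ}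
    (hx : x ∈ regularSet S Ω) (hc0 : 0 ≤ c) (hc : c < H ξ)
    (hξ : x ∈ gammaOne S Ω \ {0} → ∀ n, IsOutwardNormal S x n →
      inner ℝ (gradient (lagrangian H) ξ) n = 0) :
    ∃ d, c * dualNorm H d < inner ℝ ξ d ∧ ∀ᶠ s : ℝ in 𝓝[>] 0, x + s • d ∈ S ∩ Ω := by
  have hξ0 : ξ ≠ 0 := by
    rintro rfl
    rw [hH.map_zero] at hc
    linarith
  obtain ⟨t, ht, ht1, ht2⟩ := exists_ascent_direction hH hC hξ0
  set d := t • gradient (lagrangian H) ξ with hd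
  rcases hx with hx | hx
  · refine ⟨d, by rwa [ht1, ht2, mul_one], ?_⟩
    have hcont : Tendsto (fun s : ℝ => x + s • d) (𝓝[>] 0) (𝓝 x) := by
      have : Continuous fun s : ℝ => x + s • d := by fun_prop
      simpa using (this.tendsto 0).mono_left nhdsWithin_le_nhds
    exact hcont.eventually ((hSo.inter hΩ).mem_nhds hx)
  · obtain ⟨φ, hφ⟩ := exists_isLocalDefiningFunction hSo hΩ hS hx
    have h0 : inner ℝ (gradient φ x) d = 0 := by
      have h := hξ hx _ ⟨φ, hφ, rfl⟩
      rw [inner_smul_right, mul_eq_zero, inv_eq_zero, norm_eq_zero] at h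
      rw [hd, inner_smul_right, real_inner_comm, h.resolve_left hφ.2.2.1, mul_zero]
    have hev : ∀ᶠ τ : ℝ in 𝓝[>] 0, c * dualNorm H (d + τ • (-gradient φ x))
        < inner ℝ ξ (d + τ • (-gradient φ x)) := by
      have hcn := (isNorm_dualNorm hH hC).continuous
      have hcont : Continuous fun τ : ℝ => inner ℝ ξ (d + τ • (-gradient φ x))
          - c * dualNorm H (d + τ • (-gradient φ x)) := by fun_prop
      have h1 := ((hcont.tendsto 0).mono_left (nhdsWithin_le_nhds (s := Ioi 0))).eventually
        (lt_mem_nhds (a := 0) (by rw [zero_smul, add_zero, ht1, ht2]; linarith))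
      filter_upwards [h1] with τ hτ using sub_pos.1 hτ
    obtain ⟨τ, hτ, hτ0⟩ := (hev.and self_mem_nhdsWithin).exists
    refine ⟨_, hτ, eventually_add_smul_mem_inter hΩ hx.1 hφ ?_⟩
    rw [inner_add_right, h0, inner_smul_right, zero_add]
    exact mul_neg_of_pos_of_neg hτ0 hφ.inner_neg_gradient

theorem _root_.HasGradientWithinAt.inner_le_of_eventually {E : Type*} [NormedAddCommGroup E]
    [InnerProductSpace ℝ E] [CompleteSpace E] {f : E → ℝ} {g x d : E} {A : Set E} {a : ℝ}
    (h : HasGradientWithinAt f g A x) (hd : ∀ᶠ s : ℝ in 𝓝[>] 0, x + s • d ∈ A)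
    (ha : ∀ᶠ s : ℝ in 𝓝[>] 0, f (x + s • d) - f x ≤ s * a) : inner ℝ g d ≤ a := by
  set T := Ioi (0 : ℝ) ∩ {s | x + s • d ∈ A} with hT
  have hc : HasDerivAt (fun s : ℝ => x + s • d) d 0 := by
    simpa using ((hasDerivAt_id (0 : ℝ)).smul_const d).const_add x
  have h1 : HasFDerivWithinAt f (InnerProductSpace.toDual ℝ E g) A (x + (0 : ℝ) • d) := by
    simpa using h.hasFDerivWithinAt
  have h2 := h1.comp_hasDerivWithinAt (t := A) (s := T) 0 hc.hasDerivWithinAt fun s hs => hs.2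
  have h3 : HasDerivWithinAt (f ∘ fun s : ℝ => x + s • d) (inner ℝ g d) (Ioi 0) 0 := by
    refine HasDerivWithinAt.mono_of_mem_nhdsWithin (t := T) (by simpa using h2) ?_
    filter_upwards [hd, self_mem_nhdsWithin] with s h1 h2 using ⟨h2, h1⟩
  rw [hasDerivWithinAt_iff_tendsto_slope' (by simp)] at h3
  refine le_of_tendsto h3 ?_
  filter_upwards [ha, self_mem_nhdsWithin] with s hs hs0
  have hs0 : 0 < s := hs0
  simp only [slope_def_field, Function.comp_apply, zero_smul, add_zero, sub_zero]
  rw [div_le_iff₀ hs0]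
  linarith

/-- Suppose k R < c' < c < q₁, so that H(Du) ≥ c near z. Maximise u - c' H₀(· - x₀) over a small
H₀-ball about a point x₀ near z. Because u vanishes on Γ₀ the maximum is not there; the upper
barrier, of slope about k R < c', excludes the rim of the ball; at any remaining point, on Γ₁ or
inside, there is a direction along which u grows faster than c' H₀. -/
theorem le_of_le_radial (hH : IsNorm H) (hC : ContDiffOn ℝ 1 H {0}ᶜ)
    (hV : StrictConvexOn ℝ univ (lagrangian H)) (hSo : IsOpen S) (hS0 : (0 : 𝔼) ∉ S)
    (hΩ : IsOpen Ω) (hΩ0 : (0 : 𝔼) ∈ Ω) (hΩb : Bornology.IsBounded Ω) (hS : HasC1BoundaryOffOrigin S)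
    (huC1 : ContDiffOn ℝ 1 u (regularSet S Ω))
    (huC0 : ContinuousOn u (closure (S ∩ Ω) \ {0}))
    (huN : ∀ x ∈ gammaOne S Ω \ {0}, ∀ n, IsOutwardNormal S x n →
      inner ℝ (gradient (lagrangian H) (gradientWithin u (regularSet S Ω) x)) n = 0)
    (hu0 : ∀ z ∈ closure (gammaZero S Ω), u z = 0) {z : 𝔼} {k q₁ : ℝ} (hk : 0 ≤ k)
    (hz : z ∈ closure (gammaZero S Ω))
    (hq : Tendsto (fun x => H (gradientWithin u (regularSet S Ω) x)) (𝓝[S ∩ Ω] z) (𝓝 q₁))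
    (hpos : ∀ x ∈ S ∩ Ω, 0 ≤ u x)
    (hle : ∀ x ∈ S ∩ Ω, u x ≤ radial H k (dualNorm H z) x) :
    q₁ ≤ k * dualNorm H z := by
  have hH₀ := isNorm_dualNorm hH hC
  have hH₀c := hH₀.continuous
  have hr := (contDiff_radial hH hC hV k (dualNorm H z)).continuous
  have hgc := hS.continuousOn_gradientWithin hSo hΩ huC1
  have hz0 : z ≠ 0 := fun h => closure_gammaZero_subset hΩ hz (h ▸ hΩ0)
  have hzU : z ∈ closure (S ∩ Ω) := closure_gammaZero_subset_closure hSo hz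
  have hRpos : 0 < dualNorm H z := hH₀.pos hz0
  set R := dualNorm H z with hR
  set g := gradientWithin u (regularSet S Ω) with hg
  by_contra! hlt
  obtain ⟨c', hc'1, hc'2⟩ := exists_between hlt
  obtain ⟨c, hc1, hc2⟩ := exists_between hc'2
  have hc'0 : 0 < c' := (mul_nonneg hk hRpos.le).trans_lt hc'1
  obtain ⟨δ₁, hδ₁, hδU⟩ := Metric.eventually_nhds_iff_ball.1
    (eventually_nhdsWithin_iff.1 (hq.eventually (lt_mem_nhds hc2)))
  set δ := min δ₁ ‖z‖ with hδ
  have hδ0 : 0 < δ := lt_min hδ₁ (norm_pos_iff.2 hz0)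
  have hball0 : (0 : 𝔼) ∉ Metric.ball z δ := by
    rw [Metric.mem_ball, dist_eq_norm, zero_sub, norm_neg]
    exact not_lt.2 (min_le_right _ _)
  have hreg : ∀ x ∈ regularSet S Ω ∩ Metric.ball z δ, c ≤ H (g x) := by
    rintro x ⟨hx, hxb⟩
    have hne : (𝓝[S ∩ Ω] x).NeBot :=
      mem_closure_iff_nhdsWithin_neBot.1 (regularSet_subset_closure hx)
    have hlim : Tendsto (fun y => H (g y)) (𝓝[S ∩ Ω] x) (𝓝 (H (g x))) :=
      (hH.continuous.tendsto _).comp ((hgc x hx).mono subset_union_left)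
    refine ge_of_tendsto hlim ?_
    filter_upwards [self_mem_nhdsWithin,
      mem_nhdsWithin_of_mem_nhds (Metric.isOpen_ball.mem_nhds hxb)] with y hy hyb
    exact (hδU y (Metric.ball_subset_ball (min_le_left _ _) hyb) hy).le
  obtain ⟨m, hm, hmH⟩ := hH₀.exists_mul_norm_le
  -- The second bound keeps the H₀-ball within the Euclidean ball of radius δ about z; the first
  -- keeps R - 2ρ nonnegative, which the squaring of the barrier estimate requires.
  set ρ := min (R / 4) (m * δ / 4) with hρ
  have hρ0 : 0 < ρ := lt_min (by positivity) (by positivity)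
  have hρR : ρ ≤ R / 4 := min_le_left _ _
  have hρδ : ρ ≤ m * δ / 4 := min_le_right _ _
  -- The second condition says that on the rim H₀(x - x₀) = ρ the barrier, at most k R (ρ + H₀(x₀ -
  -- z)), lies below c' ρ. It holds for x₀ close to z since k R < c'.
  obtain ⟨x₀, hx₀U, hx₀1, hx₀2⟩ : ∃ x₀ ∈ S ∩ Ω, dualNorm H (x₀ - z) < ρ ∧
      k * R * (ρ + dualNorm H (x₀ - z)) < c' * ρ := by
    have hne : (𝓝[S ∩ Ω] z).NeBot := mem_closure_iff_nhdsWithin_neBot.1 hzU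
    have hc₁ : Continuous fun x => dualNorm H (x - z) := by fun_prop
    have hc₂ : Continuous fun x => k * R * (ρ + dualNorm H (x - z)) := by fun_prop
    have h1 := ((hc₁.tendsto z).mono_left (nhdsWithin_le_nhds (s := S ∩ Ω))).eventually
      (gt_mem_nhds (a := ρ) (by simpa [hH₀.map_zero] using hρ0))
    have h2 := ((hc₂.tendsto z).mono_left (nhdsWithin_le_nhds (s := S ∩ Ω))).eventually
      (gt_mem_nhds (a := c' * ρ) (by
        rw [sub_self, hH₀.map_zero, add_zero]
        exact mul_lt_mul_of_pos_right hc'1 hρ0))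
    obtain ⟨x, hx, hx1, hx2⟩ := (eventually_mem_nhdsWithin.and (h1.and h2)).exists
    exact ⟨x, hx, hx1, hx2⟩
  set K := closure (S ∩ Ω) ∩ {x | dualNorm H (x - x₀) ≤ ρ} with hK
  have hKz : ∀ x ∈ K, dualNorm H (x - z) ≤ ρ + dualNorm H (x₀ - z) := by
    intro x hx
    have h1 := hH₀.add_le (x - x₀) (x₀ - z)
    rw [sub_add_sub_cancel] at h1
    have h2 : dualNorm H (x - x₀) ≤ ρ := hx.2
    linarith
  have hKb : K ⊆ Metric.ball z δ := by
    intro x hx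
    rw [Metric.mem_ball, dist_eq_norm]
    have h1 := hKz x hx
    have h2 := hmH (x - z)
    by_contra! h
    have h3 := mul_le_mul_of_nonneg_left h hm.le
    have h4 := mul_pos hm hδ0
    linarith
  have hK0 : K ⊆ closure (S ∩ Ω) \ {0} := fun x hx =>
    ⟨hx.1, fun h => hball0 ((mem_singleton_iff.1 h) ▸ hKb hx)⟩
  have hKc : IsCompact K := by
    refine (hΩb.subset inter_subset_right).isCompact_closure.inter_right ?_
    exact isClosed_le (by fun_prop) continuous_const
  have hx₀K : x₀ ∈ K := ⟨subset_closure hx₀U, by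
    change dualNorm H (x₀ - x₀) ≤ ρ
    rw [sub_self, hH₀.map_zero]; exact hρ0.le⟩
  obtain ⟨x, hxK, hmax⟩ := hKc.exists_isMaxOn ⟨x₀, hx₀K⟩
    (f := fun x => u x - c' * dualNorm H (x - x₀))
    ((huC0.mono hK0).sub (by fun_prop))
  have hx0 : 0 ≤ u x - c' * dualNorm H (x - x₀) := by
    have h := hmax hx₀K
    simp only [mem_ofPred_eq, sub_self, hH₀.map_zero, mul_zero, sub_zero] at h
    exact (hpos x₀ hx₀U).trans h
  have hxΓ : x ∉ closure (gammaZero S Ω) := by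
    intro h
    rw [hu0 x h] at hx0
    have hne : x - x₀ ≠ 0 := sub_ne_zero.2 fun h' =>
      closure_gammaZero_subset hΩ h (h' ▸ hx₀U.2)
    have := mul_pos hc'0 (hH₀.pos hne)
    linarith
  have hxr : u x ≤ radial H k R x := by
    have hne : (𝓝[S ∩ Ω] x).NeBot := mem_closure_iff_nhdsWithin_neBot.1 hxK.1
    refine le_of_tendsto_of_tendsto ((huC0 x (hK0 hxK)).mono fun y hy =>
      ⟨subset_closure hy, fun h => hS0 ((mem_singleton_iff.1 h) ▸ hy.1)⟩) ((hr.tendsto x).mono_left nhdsWithin_le_nhds)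
      (eventually_mem_nhdsWithin.mono hle)
  have hxρ : dualNorm H (x - x₀) < ρ := by
    refine lt_of_le_of_ne hxK.2 fun h => ?_
    rw [h] at hx0
    have h1 := hKz x hxK
    have h2 := hH₀.add_le x (z - x)
    rw [add_sub_cancel, ← hR, ← neg_sub x z, hH₀.map_neg] at h2
    have h3 : u x ≤ k * (R ^ 2 / 2 - dualNorm H x ^ 2 / 2) := hxr
    have h4 : R ^ 2 / 2 - dualNorm H x ^ 2 / 2 ≤ R * (ρ + dualNorm H (x₀ - z)) := by
      have h6 : 0 ≤ dualNorm H (x₀ - z) := hH₀.nonneg _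
      have h7 : (R - (ρ + dualNorm H (x₀ - z))) ^ 2 ≤ dualNorm H x ^ 2 :=
        pow_le_pow_left₀ (by linarith) (by linarith) 2
      nlinarith [sq_nonneg (ρ + dualNorm H (x₀ - z))]
    have h5 := mul_le_mul_of_nonneg_left h4 hk
    linarith
  have hxreg : x ∈ regularSet S Ω :=
    closure_inter_diff_subset hSo hΩ ⟨⟨hxK.1, hxΓ⟩, (hK0 hxK).2⟩
  obtain ⟨d, hd1, hd2⟩ := exists_ascent_direction_of_mem_regularSet hH hC hSo hΩ hS hxreg hc'0.le
    (hc1.trans_le (hreg x ⟨hxreg, hKb hxK⟩)) (huN x)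
  have hgx : HasGradientWithinAt u (g x) (regularSet S Ω) x :=
    ((huC1 x hxreg).differentiableWithinAt one_ne_zero).hasGradientWithinAt
  refine hd1.not_ge (hgx.inner_le_of_eventually (hd2.mono fun s hs => Or.inl hs) ?_)
  have hcont : Continuous fun s : ℝ => dualNorm H (x + s • d - x₀) := by fun_prop
  have hev := ((hcont.tendsto 0).mono_left (nhdsWithin_le_nhds (s := Ioi 0))).eventually
    (gt_mem_nhds (a := ρ) (by simpa using hxρ))
  filter_upwards [hd2, hev, self_mem_nhdsWithin] with s hs1 hs2 hs0
  have hs0 : 0 < s := hs0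
  have h1 := hmax (show x + s • d ∈ K from ⟨subset_closure hs1, hs2.le⟩)
  simp only [mem_ofPred_eq] at h1
  have h2 := hH₀.add_le (x - x₀) (s • d)
  rw [hH₀.smul_of_nonneg hs0.le, ← add_sub_right_comm] at h2
  have h3 := mul_le_mul_of_nonneg_left h2 hc'0.le
  linarith

end ConeWulff

/-! ### Conclusion: comparing the extreme values of H₀ on Γ₀. -/

open ConeWulff

theorem theorem1p1 {N : ℕ} (hN : 2 ≤ N)
    -- the domain `Ω`
    (Ω : Set (EuclideanSpace ℝ (Fin N))) (hΩo : IsOpen Ω) (hΩc : IsConnected Ω)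
    (hΩb : Bornology.IsBounded Ω) (hΩ0 : (0 : EuclideanSpace ℝ (Fin N)) ∈ Ω)
    -- the cone `S` over a domain `ω` of the unit sphere
    (ω : Set (Metric.sphere (0 : EuclideanSpace ℝ (Fin N)) 1)) (hωo : IsOpen ω)
    (hωc : IsConnected ω)
    (S : Set (EuclideanSpace ℝ (Fin N))) (hS : S = ConeWulff.coneOver ω)
    (hSC1 : ConeWulff.HasC1BoundaryOffOrigin S)
    -- the norm `H`
    (H : EuclideanSpace ℝ (Fin N) → ℝ) (hH : ConeWulff.IsNorm H)
    (hHC1 : ContDiffOn ℝ 1 H {0}ᶜ)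
    (hV : StrictConvexOn ℝ Set.univ (ConeWulff.lagrangian H))
    -- the function `q`
    (q : ℝ → ℝ) (hq : ∀ r, 0 < r → 0 < q r)
    (hqr : StrictMonoOn (fun r => q r / r) (Set.Ioi 0))
    -- the solution `u`, of class `C¹` up to `Γ₁ ∖ {O}` and continuous up to the boundary off `O`
    (u : EuclideanSpace ℝ (Fin N) → ℝ)
    (huC1 : ContDiffOn ℝ 1 u (ConeWulff.regularSet S Ω))
    (huC0 : ContinuousOn u (closure (S ∩ Ω) \ {0}))
    (huweak : ConeWulff.IsWeakSolution H S Ω (fun _ => 1) u)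
    (huDirichlet : ∀ x ∈ ConeWulff.gammaZero S Ω, u x = 0)
    (huNeumann : ∀ x ∈ ConeWulff.gammaOne S Ω \ {0}, ∀ n, ConeWulff.IsOutwardNormal S x n →
      inner ℝ (gradient (ConeWulff.lagrangian H)
        (gradientWithin u (ConeWulff.regularSet S Ω) x)) n = 0)
    (huover : ∀ z ∈ closure (ConeWulff.gammaZero S Ω),
      Filter.Tendsto (fun x => H (gradientWithin u (ConeWulff.regularSet S Ω) x))
        (nhdsWithin z (S ∩ Ω)) (nhds (q (ConeWulff.dualNorm H z)))) :
    ∃ R : ℝ, 0 < R ∧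
      S ∩ Ω = S ∩ ConeWulff.normBall (ConeWulff.dualNorm H) R := by

  have hSo : IsOpen S := hS ▸ isOpen_coneOver hωo
  have hS0 : (0 : EuclideanSpace ℝ (Fin N)) ∉ S := hS ▸ zero_notMem_coneOver ω
  have hSc : ∀ x ∈ S, ∀ t : ℝ, 0 < t → t • x ∈ S := fun x hx t ht => by
    rw [hS] at hx ⊢
    exact smul_mem_coneOver hx ht
  have hH₀ := isNorm_dualNorm hH hHC1
  have hu0 := eq_zero_of_mem_closure_gammaZero hSo hΩo hΩ0 huC0 huDirichlet
  have hNpos : (0 : ℝ) < N := by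
    have : 0 < N := by omega
    exact_mod_cast this
  have hkN : (1 / N : ℝ) * N = 1 := one_div_mul_cancel hNpos.ne'
  have hnorm : ∀ z ∈ closure (gammaZero S Ω), 0 < dualNorm H z := fun z hz =>
    hH₀.pos fun h => closure_gammaZero_subset hΩo hz (h ▸ hΩ0)
  have hlimu : ∀ z ∈ closure (gammaZero S Ω), Tendsto u (𝓝[S ∩ Ω] z) (𝓝 0) := fun z hz => by
    rw [← hu0 z hz]
    refine (huC0 z ⟨closure_gammaZero_subset_closure hSo hz, fun h => ?_⟩).mono fun y hy =>
      ⟨subset_closure hy, fun h => hS0 ((mem_singleton_iff.1 h) ▸ hy.1)⟩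
    exact closure_gammaZero_subset hΩo hz ((mem_singleton_iff.1 h) ▸ hΩ0)
  have hΓne : (closure (gammaZero S Ω)).Nonempty := by
    obtain ⟨x, hx⟩ := hωc.nonempty
    have hxS : (x : EuclideanSpace ℝ (Fin N)) ∈ S := hS ▸ ⟨x, hx, 1, one_pos, (one_smul _ _).symm⟩
    have hcont : Tendsto (fun t : ℝ => t • (x : EuclideanSpace ℝ (Fin N))) (𝓝[>] 0) (𝓝 0) := by
      have : Continuous fun t : ℝ => t • (x : EuclideanSpace ℝ (Fin N)) := by fun_prop
      simpa using (this.tendsto 0).mono_left nhdsWithin_le_nhds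
    obtain ⟨t, ht, ht0⟩ := ((hcont.eventually (hΩo.mem_nhds hΩ0)).and self_mem_nhdsWithin).exists
    obtain ⟨s, -, hs, -⟩ := exists_smul_mem_gammaZero hSc hS0 hΩo hΩb ⟨hSc _ hxS t ht0, ht⟩
    exact ⟨_, subset_closure hs⟩
  have hΓc : IsCompact (closure (gammaZero S Ω)) :=
    (hΩb.closure.subset fun x hx => hx.2.1).isCompact_closure
  obtain ⟨z₁, hz₁, hmin⟩ := hΓc.exists_isMinOn hΓne hH₀.continuous.continuousOn
  obtain ⟨z₂, hz₂, hmax⟩ := hΓc.exists_isMaxOn hΓne hH₀.continuous.continuousOn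
  have hmin : ∀ z ∈ closure (gammaZero S Ω), dualNorm H z₁ ≤ dualNorm H z := hmin
  have hmax : ∀ z ∈ closure (gammaZero S Ω), dualNorm H z ≤ dualNorm H z₂ := hmax
  have hsub : S ∩ normBall (dualNorm H) (dualNorm H z₁) ⊆ Ω := by
    rintro x ⟨hxS, hx⟩
    by_contra hxΩ
    obtain ⟨t, ht, ht1, htΓ⟩ := exists_smul_mem_gammaZero_of_notMem hSc hΩo hΩ0 hxS hxΩ
    have h1 := hmin _ (subset_closure htΓ)
    rw [hH₀.smul_of_nonneg ht.le] at h1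
    have h2 : dualNorm H x < dualNorm H z₁ := hx
    nlinarith [hH₀.nonneg x]
  -- The value k = 0 turns the radial function into the zero function.
  have hpos : ∀ x ∈ S ∩ Ω, 0 ≤ u x := fun x hx => by
    simpa [radial] using radial_le_of_nonpos hN hH hHC1 hV hSo hS0 hSc hSC1 hΩo hΩb huC1 huC0 huweak
      huNeumann hu0 (k := 0) (R := 0) (by simp) (fun z _ => by simp [radial]) x hx
  have hlow := radial_le_of_nonpos hN hH hHC1 hV hSo hS0 hSc hSC1 hΩo hΩb huC1 huC0 huweak
    huNeumann hu0 (k := 1 / N) (R := dualNorm H z₁) hkN.le fun z hz => by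
      have := pow_le_pow_left₀ (hnorm z₁ hz₁).le (hmin z hz) 2
      refine mul_nonpos_of_nonneg_of_nonpos (by positivity) ?_
      rw [lagrangian]
      linarith
  have hupp := le_radial_of_nonneg hN hH hHC1 hV hSo hS0 hSc hSC1 hΩo hΩb huC1 huC0 huweak
    huNeumann hu0 (k := 1 / N) (R := dualNorm H z₂) hkN.ge fun z hz => by
      have := pow_le_pow_left₀ (hnorm z hz).le (hmax z hz) 2
      refine mul_nonneg (by positivity) ?_
      rw [lagrangian]
      linarith
  have hq₁ := le_of_radial_le hH hHC1 hV hSc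
    (fun x hx => hasGradientAt_of_mem_inter hSo hΩo huC1 hx) (huover z₁ hz₁) (hlimu z₁ hz₁)
    (closure_mono inter_subset_left hz₁) (hnorm z₁ hz₁) hsub hlow
  have hq₂ := le_of_le_radial hH hHC1 hV hSo hS0 hΩo hΩ0 hΩb hSC1 huC1 huC0 huNeumann hu0
    (by positivity) hz₂ (huover z₂ hz₂) hpos hupp
  -- The slope bounds read q(R₂)/R₂ ≤ 1/N ≤ q(R₁)/R₁, which contradicts strict monotonicity if R₁ <
  -- R₂.
  have heq : dualNorm H z₁ = dualNorm H z₂ := by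
    refine le_antisymm (hmin z₂ hz₂) (not_lt.1 fun h => ?_)
    have h1 := hqr (hnorm z₁ hz₁) (hnorm z₂ hz₂) h
    refine h1.not_ge (le_trans ?_ ((le_div_iff₀ (hnorm z₁ hz₁)).2 hq₁))
    exact (div_le_iff₀ (hnorm z₂ hz₂)).2 hq₂
  refine ⟨dualNorm H z₁, hnorm z₁ hz₁, Subset.antisymm (fun x hx => ⟨hx.1, ?_⟩)
    fun x hx => ⟨hx.1, hsub hx⟩⟩
  -- The ray from x reaches Γ₀ only at some t > 1, where H₀ is at most R₂, so H₀ x is strictly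
  -- smaller.
  obtain ⟨t, ht, htΓ, -⟩ := exists_smul_mem_gammaZero hSc hS0 hΩo hΩb hx
  have h1 := hmax _ (subset_closure htΓ)
  rw [hH₀.smul_of_nonneg (by linarith)] at h1
  have h2 := hH₀.pos fun h : x = 0 => hS0 (h ▸ hx.1)
  change dualNorm H x < dualNorm H z₁
  rw [heq]
  nlinarith
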